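/- **Setting.** Algorithms are programs for a word RAM: finitely many registers and arrays of natural numbers, the usual arithmetic and bitwise operations, assignments, branching and loops, unit cost per instruction and per test. "Words of $O(\log s)$ bits" means that all values written during a run are at most $s^{O(1)}$. A graph with $n\ge 1$ vertices is given by its adjacency matrix. An SLP for a string $u$ is a context-free grammar $G$ with $L(G)=\{u\}$ in which every nonterminal has exactly one rule, whose right-hand side is two nonterminals or one terminal, and occurs in some string derived from the start symbol; $|G|$ is the total length of the right-hand sides. Given an SLP $G$ with $L(G)=\{u\}$ and a finite nonempty set $\mathcal D$ of nonempty words, *Word Break* asks whether $u$ is a concatenation of words of $\mathcal D$; put $M=\sum_{d\in\mathcal D}|d|$ and $m=\max_{d\in\mathcal D}|d|$. "Combinatorial algorithm" has no formal definition. The lower bound is stated for every class $\mathcal C$ of programs (to be read as "the combinatorial algorithms") that is closed under prefixing with one fixed preprocessing program $R_k$, whose input-output behaviour is specified in part 2 of the theorem. For $k\ge 1$, the *Combinatorial $k$-Clique Conjecture for $\mathcal C$* says: for no $\varepsilon>0$ does a program in $\mathcal C$ decide, in $O(n^{4k-\varepsilon})$ time on words of $O(\log n)$ bits, whether an $n$-vertex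 graph contains a $4k$-clique. **The string and the dictionary of a graph.** Let $\mathcal G$ be a graph on $\{1,\dots,n\}$, $n\ge1$, let $k\ge 1$ and $N=n^k$, and identify the $k$-cliques of $\mathcal G$ with distinct integers in $\{1,\dots,N\}$ in any way. Over the alphabet $\{1,\dots,N,\$,\#,\gamma,\mu,\alpha,\beta\}$ put $f_0(s_1\cdots s_\ell)=\alpha s_1\beta\cdots\alpha s_\ell\beta$ and $f_1(s_1\cdots s_\ell)=s_1\beta\alpha\cdots s_\ell\beta\alpha$. For a $2k$-clique $A=\{a_1,\dots,a_{2k}\}$ let $$w_A=\$\,1 2\cdots N\,\# a_1\#\,1 2\cdots N\,\# a_2\#\cdots\# a_{2k}\#\,1 2\cdots N\,\$ ,\qquad w(\mathcal G)=\Bigl(\bigodot_A f_0(\mu w_A\gamma w_A\mu)\Bigr)\mu\mu ,$$ the concatenation being over all $2k$-cliques $A$ in any order. The dictionary $\mathcal D(\mathcal G)$ consists of - $f_1(\$1\cdots(B-1))$ and $f_1(B\cdots N)$ for every $k$-clique $B$; - $f_1(B\cdots N\# i\# 1\cdots(B-1))$ for every $k$-clique $B$ and every vertex $i\notin B$ adjacent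 to all of $B$; - $f_1(B\cdots N\$\gamma\$1\cdots(C-1))$ for all disjoint $k$-cliques $B,C$ with all edges between them; - $\alpha\sigma\beta$ and $\beta\alpha\sigma$ for every $\sigma\in\{1,\dots,N,\$,\#,\gamma,\mu\}$; - $\alpha\mu\beta\alpha$, $\$\beta\alpha\mu$ and $\beta\mu\mu$. **Theorem.** Let $k\ge1$. 1. For all $n\ge 1$ and all $n$-vertex graphs $\mathcal G$: $w(\mathcal G)$ is a concatenation of words of $\mathcal D(\mathcal G)$ if and only if $\mathcal G$ contains a $4k$-clique. Moreover $w(\mathcal G)$ has an SLP of size $O(N^2)$, and $\sum_{d\in\mathcal D(\mathcal G)}|d|=O(N^3)$ and $\max_{d\in\mathcal D(\mathcal G)}|d|=O(N)$, with constants depending only on $k$. 2. There is a program $R_k$ which, in $O(N^3\log N)$ time (read as $O(N^3(1+\log N))$) on words of $O(\log n)$ bits, turns every graph $\mathcal G$ with $n\ge 1$ vertices into an SLP for $w(\mathcal G)$ and the dictionary $\mathcal D(\mathcal G)$, for some choice of the numbering of the $k$-cliques and of the order of the $2k$-cliques and of the vertices within each, with every letter replaced by a distinct binary block of a common length $O(1+\log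 N)$, and such that the following holds. Let $\mathcal C$ be any class of programs such that for every $A\in\mathcal C$ the program "first $R_k$, then $A$" is in $\mathcal C$. If the Combinatorial $k$-Clique Conjecture holds for $\mathcal C$, then for every fixed alphabet size $\sigma\ge 2$ and every $\varepsilon>0$, no program in $\mathcal C$ solves Word Break for strings over a $\sigma$-letter alphabet, given an SLP $G$ and a dictionary $\mathcal D$, in $O(|G|\cdot m^{2-\varepsilon}+M)$ time on words of $O(\log(|G|+M))$ bits. -/

import Mathlib

namespace WordBreak

open scoped Classical

noncomputable section

/-! ### Word Break and straight-line programs -/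

/-- `w` is a concatenation of words from the dictionary `D`. -/
def Factorizable {T : Type*} (D : Set (List T)) (w : List T) : Prop :=
  ∃ fs : List (List T), (∀ f ∈ fs, f ∈ D) ∧ fs.flatten = w

/-- `g` is a straight-line program with language `{w}`: every nonterminal has exactly one rule,
every right-hand side consists of two nonterminals or of one terminal, every nonterminal occurs in
some string derived from the starting nonterminal, and `w` is the only word that is generated. -/
structure IsSLP {T : Type*} (g : ContextFreeGrammar T) (w : List T) : Prop where
  existsUnique_rule : ∀ v : g.NT, ∃! r, r ∈ g.rules ∧ r.input = v
  normalForm : ∀ r ∈ g.rules,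
    (∃ a b : g.NT, r.output = [Symbol.nonterminal a, Symbol.nonterminal b]) ∨
      (∃ a : T, r.output = [Symbol.terminal a])
  reachable : ∀ v : g.NT, ∃ γ : List (Symbol T g.NT),
    g.Derives [Symbol.nonterminal g.initial] γ ∧ Symbol.nonterminal v ∈ γ
  mem_language : ∀ u : List T, u ∈ g.language ↔ u = w

/-- The size of a grammar: the total length of the right-hand sides. -/
def grammarSize {T : Type*} (g : ContextFreeGrammar T) : ℕ :=
  ∑ r ∈ g.rules, r.output.length

/-! ### The word RAM

Programs of a structured language over registers and finitely many arrays (all indexed by `ℕ` and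
holding natural numbers), with unit cost for every instruction and every test. -/

/-- The binary operations of the machine. -/
inductive Op
  | add | sub | mul | div | mod | and | or | xor | shl | shr

/-- Truncated subtraction; division by zero gives zero. -/
def Op.eval : Op → ℕ → ℕ → ℕ
  | .add, a, b => a + b
  | .sub, a, b => a - b
  | .mul, a, b => a * b
  | .div, a, b => a / b
  | .mod, a, b => a % b
  | .and, a, b => a &&& b
  | .or, a, b => a ||| b
  | .xor, a, b => a ^^^ b
  | .shl, a, b => a <<< b
  | .shr, a, b => a >>> b

/-- Programs. In `load x a y` and `store a y x`, `a` is the name of an array, `y` is the register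
that holds the index, and `x` is the register that receives or provides the value; `ite x p q` and
`loop x p` test whether register `x` is nonzero. -/
inductive Prog
  | const (x c : ℕ)
  | op (o : Op) (x y z : ℕ)
  | load (x a y : ℕ)
  | store (a y x : ℕ)
  | seq (p q : Prog)
  | ite (x : ℕ) (p q : Prog)
  | loop (x : ℕ) (p : Prog)

/-- The contents of the registers and of the arrays. -/
@[ext]
structure Store where
  reg : ℕ → ℕ
  arr : ℕ → ℕ → ℕ

/-- Write `v` into register `x`. -/
def Store.setReg (s : Store) (x v : ℕ) : Store :=
  { s with reg := Function.update s.reg x v }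

/-- Write `v` into cell `i` of array `a`. -/
def Store.setArr (s : Store) (a i v : ℕ) : Store :=
  { s with arr := Function.update s.arr a (Function.update (s.arr a) i v) }

/-- `Exec W p s t s'`: started in `s`, the program `p` halts in `s'` after exactly `t` steps, and
every value that is written on the way is at most `W` (so words of `O(log W)` bits suffice). -/
inductive Exec (W : ℕ) : Prog → Store → ℕ → Store → Prop
  | const (s : Store) (x c : ℕ) (h : c ≤ W) : Exec W (.const x c) s 1 (s.setReg x c)
  | op (s : Store) (o : Op) (x y z : ℕ) (h : o.eval (s.reg y) (s.reg z) ≤ W) :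
      Exec W (.op o x y z) s 1 (s.setReg x (o.eval (s.reg y) (s.reg z)))
  | load (s : Store) (x a y : ℕ) (h : s.arr a (s.reg y) ≤ W) :
      Exec W (.load x a y) s 1 (s.setReg x (s.arr a (s.reg y)))
  | store (s : Store) (a y x : ℕ) (h : s.reg x ≤ W) :
      Exec W (.store a y x) s 1 (s.setArr a (s.reg y) (s.reg x))
  | seq {p q : Prog} {s₁ s₂ s₃ : Store} {t₁ t₂ : ℕ} (h₁ : Exec W p s₁ t₁ s₂)
      (h₂ : Exec W q s₂ t₂ s₃) : Exec W (.seq p q) s₁ (t₁ + t₂) s₃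
  | ite_true {x : ℕ} {p q : Prog} {s s' : Store} {t : ℕ} (hx : s.reg x ≠ 0)
      (h : Exec W p s t s') : Exec W (.ite x p q) s (t + 1) s'
  | ite_false {x : ℕ} {p q : Prog} {s s' : Store} {t : ℕ} (hx : s.reg x = 0)
      (h : Exec W q s t s') : Exec W (.ite x p q) s (t + 1) s'
  | loop_false {x : ℕ} {p : Prog} {s : Store} (hx : s.reg x = 0) : Exec W (.loop x p) s 1 s
  | loop_true {x : ℕ} {p : Prog} {s₁ s₂ s₃ : Store} {t₁ t₂ : ℕ} (hx : s₁.reg x ≠ 0)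
      (h₁ : Exec W p s₁ t₁ s₂) (h₂ : Exec W (.loop x p) s₂ t₂ s₃) :
      Exec W (.loop x p) s₁ (t₁ + t₂ + 1) s₃

/-! ### Clique detection -/

/-- The graph has a clique with `c` vertices. -/
def HasClique {n : ℕ} (G : SimpleGraph (Fin n)) (c : ℕ) : Prop :=
  ∃ S : Finset (Fin n), G.IsNClique c S

/-- The input of a graph problem: `n` in register `0`, the adjacency matrix, row by row, in
array `0`, and zero everywhere else. -/
def graphStore {n : ℕ} (G : SimpleGraph (Fin n)) : Store where
  reg x := if x = 0 then n else 0
  arr a i := if a = 0 ∧ ∃ u v : Fin n, i = u * n + v ∧ G.Adj u v then 1 else 0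

/-- On all graphs with `n ≥ 1` vertices, `P` decides (answer `1` or `0` in register `0`) whether
there is a `c`-clique, in `O(n ^ e)` steps on words of `O(log n)` bits. -/
def SolvesClique (P : Prog) (c : ℕ) (e : ℝ) : Prop :=
  ∃ C b : ℕ, ∀ n : ℕ, 1 ≤ n → ∀ G : SimpleGraph (Fin n), ∃ (t : ℕ) (s : Store),
    Exec ((n + 2) ^ b) P (graphStore G) t s ∧
    s.reg 0 = (if HasClique G c then 1 else 0) ∧
    (t : ℝ) ≤ C * (n : ℝ) ^ e

/-- The `k`-Clique Conjecture for a class `𝒞` of algorithms and a given `k`: no algorithm in `𝒞`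
detects `4k`-cliques in `O(n ^ (4k - ε))` time, for any `ε > 0`. -/
def CliqueConjecture (𝒞 : Set Prog) (k : ℕ) : Prop :=
  ¬ ∃ P ∈ 𝒞, ∃ ε : ℝ, 0 < ε ∧ SolvesClique P (4 * k) (4 * k - ε)

/-! ### Word Break on SLP-compressed strings -/

/-- The grammar with nonterminals `0, …, s - 1`, given by its right-hand sides. -/
def grammarOf {s : ℕ} (start : Fin s) (rhs : Fin s → ℕ ⊕ (Fin s × Fin s)) :
    ContextFreeGrammar ℕ where
  NT := Fin s
  initial := start
  rules := Finset.univ.image fun v => ⟨v, match rhs v with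
    | .inl a => [Symbol.terminal a]
    | .inr (b, c) => [Symbol.nonterminal b, Symbol.nonterminal c]⟩

/-- An instance of Word Break on SLP-compressed strings: an SLP with language `{text}`, and a
nonempty dictionary of distinct nonempty words. Letters are natural numbers. -/
structure Instance where
  numNT : ℕ
  start : Fin numNT
  rhs : Fin numNT → ℕ ⊕ (Fin numNT × Fin numNT)
  text : List ℕ
  isSLP : IsSLP (grammarOf start rhs) text
  dict : List (List ℕ)
  nodup : dict.Nodup
  dict_ne_nil : dict ≠ []
  word_ne_nil : ∀ d ∈ dict, d ≠ []

namespace Instance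

variable (I : Instance)

/-- The size `|G|` of the SLP. -/
def slpSize : ℕ := grammarSize (grammarOf I.start I.rhs)

/-- `M`, the total length of the dictionary. -/
def totalLength : ℕ := (I.dict.map List.length).sum

/-- `m`, the maximum length of a word of the dictionary. -/
def maxLength : ℕ := (I.dict.map List.length).foldr max 0

/-- All letters of the SLP and of the dictionary belong to `{0, …, σ - 1}`. -/
def OverAlphabet (σ : ℕ) : Prop :=
  (∀ v a, I.rhs v = .inl a → a < σ) ∧ ∀ d ∈ I.dict, ∀ a ∈ d, a < σ

/-- The input as it is given to the machine. Registers `0`, `1`, `2` hold the number of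
nonterminals, the starting nonterminal and the number of words. For a nonterminal `v` with
right-hand side a letter `a`, cell `v` of the arrays `0`, `1`, `2` holds `0`, `a`, `0`; for a
right-hand side `b c` it holds `1`, `b`, `c`. Array `3` holds the lengths of the words, and array
`4` holds their concatenation. Everything else is zero. -/
def toStore : Store where
  reg
    | 0 => I.numNT
    | 1 => I.start
    | 2 => I.dict.length
    | _ => 0
  arr
    | 0, i => if h : i < I.numNT then
        (match I.rhs ⟨i, h⟩ with | .inl _ => 0 | .inr _ => 1) else 0
    | 1, i => if h : i < I.numNT then
        (match I.rhs ⟨i, h⟩ with | .inl a => a | .inr (b, _) => b) else 0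
    | 2, i => if h : i < I.numNT then
        (match I.rhs ⟨i, h⟩ with | .inl _ => 0 | .inr (_, c) => c) else 0
    | 3, i => (I.dict.map List.length).getD i 0
    | 4, i => I.dict.flatten.getD i 0
    | _, _ => 0

/-- The text can be partitioned into words of the dictionary. -/
def Answer : Prop := Factorizable {d | d ∈ I.dict} I.text

end Instance

/-- On all instances over the alphabet `{0, …, σ - 1}`, `P` decides (answer `1` or `0` in register
`0`) Word Break in `O(|G| * m ^ (2 - ε) + M)` steps on words of `O(log (|G| + M))` bits. -/
def SolvesWordBreak (σ : ℕ) (P : Prog) (ε : ℝ) : Prop :=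
  ∃ C b : ℕ, ∀ I : Instance, I.OverAlphabet σ → ∃ (t : ℕ) (s : Store),
    Exec ((I.slpSize + I.totalLength) ^ b) P I.toStore t s ∧
    s.reg 0 = (if I.Answer then 1 else 0) ∧
    (t : ℝ) ≤ C * (I.slpSize * (I.maxLength : ℝ) ^ (2 - ε) + I.totalLength)

/-! ### The string and the dictionary of a graph -/

/-- The alphabet `{1, 2, …} ∪ {$, #, γ, μ, α, β}`. -/
inductive Letter
  | num (i : ℕ)
  | dollar | hash | gam | mu | al | be

open Letter

/-- The finite alphabet `{1, …, N} ∪ {$, #, γ, μ, α, β}`. -/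
def alphabet (N : ℕ) : Finset Letter :=
  (Finset.Icc 1 N).image num ∪ {dollar, hash, gam, mu, al, be}

/-- The string `1 2 ⋯ (B - 1)`. -/
def below (B : ℕ) : List Letter := (List.range' 1 (B - 1)).map num

/-- The string `B (B + 1) ⋯ N`. -/
def above (N B : ℕ) : List Letter := (List.range' B (N + 1 - B)).map num

/-- `f₀(s) = α s₁ β α s₂ β ⋯ α s_ℓ β`. -/
def f₀ (s : List Letter) : List Letter := s.flatMap fun x => [al, x, be]

/-- `f₁(s) = s₁ β α s₂ β α ⋯ s_ℓ β α`. -/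
def f₁ (s : List Letter) : List Letter := s.flatMap fun x => [x, be, al]

variable {n : ℕ}

/-- The symbol of a vertex; the vertices are `1, …, n`. -/
def vert (v : Fin n) : Letter := num (v + 1)

/-- `w_A = $ 1 2 ⋯ N # a₁ # 1 2 ⋯ N # a₂ # ⋯ # a_{2k} # 1 2 ⋯ N $`. -/
def gadget (N : ℕ) (A : List (Fin n)) : List Letter :=
  [dollar] ++ above N 1 ++ (A.flatMap fun a => [hash, vert a, hash] ++ above N 1) ++ [dollar]

/-- `w = (⨀_A f₀(μ w_A γ w_A μ)) μ μ`, over a list `As` of (listings of) cliques. -/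
def graphWord (N : ℕ) (As : List (List (Fin n))) : List Letter :=
  (As.flatMap fun A => f₀ ([mu] ++ gadget N A ++ [gam] ++ gadget N A ++ [mu])) ++ [mu, mu]

variable (G : SimpleGraph (Fin n)) (k : ℕ)

/-- `As` lists every `2k`-clique of `G` exactly once, each as a list `a₁, …, a_{2k}` of its
vertices. -/
def IsCliqueList (As : List (List (Fin n))) : Prop :=
  (∀ A ∈ As, A.Nodup) ∧ (As.map List.toFinset).Nodup ∧
    ∀ S : Finset (Fin n), S ∈ As.map List.toFinset ↔ G.IsNClique (2 * k) S

/-- `num` identifies the `k`-cliques of `G` with distinct integers in `{1, …, n ^ k}`. -/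
def IsCliqueNumbering (ι : Finset (Fin n) → ℕ) : Prop :=
  (∀ B, G.IsNClique k B → ι B ∈ Finset.Icc 1 (n ^ k)) ∧ Set.InjOn ι {B | G.IsNClique k B}

/-- The `k`-cliques of `G`. -/
def cliques : Finset (Finset (Fin n)) := Finset.univ.filter fun B => G.IsNClique k B

/-- Disjoint sets of vertices with all edges between them. -/
def IsBiClique (B C : Finset (Fin n)) : Prop :=
  Disjoint B C ∧ ∀ b ∈ B, ∀ c ∈ C, G.Adj b c

/-- The dictionary of `G`, with respect to a numbering `ι` of the `k`-cliques. -/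
def graphDict (ι : Finset (Fin n) → ℕ) : Finset (List Letter) :=
  let N := n ^ k
  ((cliques G k).image fun B => f₁ ([dollar] ++ below (ι B))) ∪
  ((cliques G k).image fun B => f₁ (above N (ι B))) ∪
  ((((cliques G k) ×ˢ (Finset.univ : Finset (Fin n))).filter
      fun p => p.2 ∉ p.1 ∧ ∀ b ∈ p.1, G.Adj p.2 b).image
    fun p => f₁ (above N (ι p.1) ++ [hash, vert p.2, hash] ++ below (ι p.1))) ∪
  ((((cliques G k) ×ˢ (cliques G k)).filter fun p => IsBiClique G p.1 p.2).image
    fun p => f₁ (above N (ι p.1) ++ [dollar, gam, dollar] ++ below (ι p.2))) ∪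
  (((Finset.Icc 1 N).image num ∪ {dollar, hash, gam, mu}).image fun x => [al, x, be]) ∪
  (((Finset.Icc 1 N).image num ∪ {dollar, hash, gam, mu}).image fun x => [be, al, x]) ∪
  {[al, mu, be, al], [dollar, be, al, mu], [be, mu, mu]}

/-- `code` is a code with distinct code words of common length `L` for the letters in `S`. -/
def IsBlockCode (S : Finset Letter) (L : ℕ) (code : Letter → List ℕ) : Prop :=
  (∀ x ∈ S, (code x).length = L) ∧ Set.InjOn code (S : Set Letter)

/-- Given a graph `G` with `n ≥ 1` vertices, the program `R` replaces the input, in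
`O(N ^ 3 * log N)` steps on words of `O(log n)` bits, where `N = n ^ k`, by the string (as an SLP)
and the dictionary of `G`, their letters written in binary as blocks of `O(log N)` bits. -/
def ComputesReduction (R : Prog) : Prop :=
  ∃ C b : ℕ, ∀ n : ℕ, 1 ≤ n → ∀ G : SimpleGraph (Fin n),
    ∃ (ι : Finset (Fin n) → ℕ) (As : List (List (Fin n))) (L : ℕ) (code : Letter → List ℕ)
      (I : Instance) (t : ℕ),
      IsCliqueNumbering G k ι ∧ IsCliqueList G k As ∧
      L ≤ C * (Nat.log 2 (n ^ k) + 1) ∧ IsBlockCode (alphabet (n ^ k)) L code ∧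
      I.OverAlphabet 2 ∧
      I.text = (graphWord (n ^ k) As).flatMap code ∧
      I.dict.toFinset = (graphDict G k ι).image (fun d => d.flatMap code) ∧
      Exec ((n + 2) ^ b) R (graphStore G) t I.toStore ∧
      t ≤ C * ((n ^ k) ^ 3 * (Nat.log 2 (n ^ k) + 1))

end

end WordBreak

/-!
**The string of a graph.** Suppose that `w` is a concatenation of words of the dictionary. The
letters `α` and `β` force such a factorization to run in three phases. It begins with words `α s β`,
and since no word begins with `μ`, the final `μ μ` can only be reached through `β μ μ`, hence after
two changes of phase. The word `α μ β α` changes to the second phase, in which a word is the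
spread-out copy `f₁ u` of a *piece* `u` (`exists_switch`), and `$ β α μ` changes to the third phase,
in which words are `β α s` (`exists_pieces`). Both changes happen in the block of the same
`2k`-clique `A`, so that `w_A γ w_A` without its last `$` is cut into pieces
(`exists_block_of_pieces`). The cut carries a clique along: the piece `$ 1 ⋯ (B - 1)` opens some
clique `B`; from then on the next piece has to begin with the number `B`, and at a vertex `a` of `A`
the only possible piece is `B ⋯ N # a # 1 ⋯ (B - 1)`, which requires that `a` is joined to all of
`B` and keeps `B` open (`pieces_along_vertices`). At `$ γ $` the cut passes to a clique `C` joined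
to `B`, and the second copy of `w_A` joins `C` to `A`. So `A ∪ B ∪ C` is a `4k`-clique
(`hasClique_of_factorizable`). Conversely, a `4k`-clique is split into `A`, `B` and `C`, which
determine the factorization (`factorizable_of_hasClique`).

**The straight-line program.** Spelling out `w` takes about `N ^ 3` letters, but the parts
`f₀ (1 ⋯ N)` are all the same. One chain of rules spells out this part, and a second chain, in which
it is a single symbol, spells out `w` with a bounded number of symbols for every `2k`-clique
(`isSLP_chain`, `isSLP_graphWord`). As a rule of a chain only refers to its predecessor and to one
symbol, a program can write the rules one by one, in the order of the text.

**The reduction.** A `k`-clique has the number `b + 1`, where the increasing digits of `b < N` in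
base `n` are its vertices, and similarly for `2k`-cliques. A letter is coded by a block of
`⌊log₂ (16 N)⌋` bits. With these choices the grammar and the dictionary are written by a handful of
nested loops over numbers. They are expressed in a small language `Cmd` of programs with bounded
loops that append to their output; its programs have a denotational output and a time bound, and
their translation into the word RAM respects both and writes only values that are polynomial in `n`
(`Cmd.exists_sound`). What remains is to compute the output (`Cmd.out_main`) and the time
(`Cmd.exists_time_main`) of one such program, and to surround it by code that moves the input and
cleans up the store (`runs_reduction`, `toStore_reducedInstance`). Block coding does not affect
whether a word is a concatenation of words of a dictionary (`IsBlockCode.factorizable_iff`), so the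
instance that is written has a positive answer if and only if there is a `4k`-clique.

**The lower bound.** On this instance `|G|` is `O(N ^ 2 log N)`, `m` is `O(N log N)`, and `M` is
`O(N ^ 3 log N)`. Hence an algorithm for Word Break that takes time `O(|G| m ^ (2 - ε) + M)`, run
after the reduction, would detect `4k`-cliques in time `O(N ^ (4 - ε'))` for a smaller `ε' > 0` that
absorbs the logarithms (`exists_time_bound`, `exists_solvesClique`), and `N ^ 4 = n ^ (4 k)`.
-/

namespace WordBreak

open scoped Classical
open Letter
noncomputable section

/-! ### Pieces of the dictionary -/

/-- The words `u` whose spread-out copies `f₁ u` belong to the dictionary. -/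
inductive IsPiece {n : ℕ} (G : SimpleGraph (Fin n)) (k : ℕ) (ι : Finset (Fin n) → ℕ) :
    List Letter → Prop
  | opening {B : Finset (Fin n)} (hB : G.IsNClique k B) :
      IsPiece G k ι (dollar :: below (ι B))
  | closing {B : Finset (Fin n)} (hB : G.IsNClique k B) :
      IsPiece G k ι (above (n ^ k) (ι B))
  | vertex {B : Finset (Fin n)} {v : Fin n} (hB : G.IsNClique k B) (hv : v ∉ B)
      (hadj : ∀ b ∈ B, G.Adj v b) :
      IsPiece G k ι (above (n ^ k) (ι B) ++ hash :: vert v :: hash :: below (ι B))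
  | bridge {B C : Finset (Fin n)} (hB : G.IsNClique k B) (hC : G.IsNClique k C)
      (hBC : IsBiClique G B C) :
      IsPiece G k ι (above (n ^ k) (ι B) ++ dollar :: gam :: dollar :: below (ι C))

/-- The letters other than `α` and `β`. -/
def plain (N : ℕ) : Finset Letter :=
  (Finset.Icc 1 N).image num ∪ {dollar, hash, gam, mu}

theorem plain_eq (N : ℕ) :
    plain N = (Finset.Icc 1 N).image num ∪ {dollar, hash, gam, mu} := rfl

theorem num_mem_plain {N i : ℕ} : num i ∈ plain N ↔ 1 ≤ i ∧ i ≤ N := by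
  simp [plain]

theorem dollar_mem_plain {N : ℕ} : dollar ∈ plain N := by simp [plain]

theorem hash_mem_plain {N : ℕ} : hash ∈ plain N := by simp [plain]

theorem gam_mem_plain {N : ℕ} : gam ∈ plain N := by simp [plain]

theorem mu_mem_plain {N : ℕ} : mu ∈ plain N := by simp [plain]

theorem ne_al_of_mem_plain {N : ℕ} {x : Letter} (hx : x ∈ plain N) : x ≠ al := by
  rintro rfl; simp [plain] at hx

theorem ne_be_of_mem_plain {N : ℕ} {x : Letter} (hx : x ∈ plain N) : x ≠ be := by
  rintro rfl; simp [plain] at hx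

theorem mem_graphDict {n : ℕ} {G : SimpleGraph (Fin n)} {k : ℕ} {ι : Finset (Fin n) → ℕ}
    {f : List Letter} :
    f ∈ graphDict G k ι ↔ (∃ u, IsPiece G k ι u ∧ f = f₁ u) ∨
      (∃ x ∈ plain (n ^ k), f = [al, x, be]) ∨ (∃ x ∈ plain (n ^ k), f = [be, al, x]) ∨
      f = [al, mu, be, al] ∨ f = [dollar, be, al, mu] ∨ f = [be, mu, mu] := by
  simp only [graphDict, Finset.mem_union, Finset.mem_image, Finset.mem_insert,
    Finset.mem_singleton, ← plain_eq, Finset.mem_filter, Finset.mem_product, Finset.mem_univ,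
    cliques, true_and, and_true, Prod.exists]
  constructor
  · rintro ((((((⟨B, hB, rfl⟩ | ⟨B, hB, rfl⟩) | ⟨B, v, ⟨hB, hv, ha⟩, rfl⟩) |
      ⟨B, C, ⟨⟨hB, hC⟩, h⟩, rfl⟩) | ⟨x, hx, rfl⟩) | ⟨x, hx, rfl⟩) | h)
    · exact .inl ⟨_, .opening hB, by simp⟩
    · exact .inl ⟨_, .closing hB, rfl⟩
    · exact .inl ⟨_, .vertex hB hv ha, by simp⟩
    · exact .inl ⟨_, .bridge hB hC h, by simp⟩
    · exact .inr (.inl ⟨x, hx, rfl⟩)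
    · exact .inr (.inr (.inl ⟨x, hx, rfl⟩))
    · exact .inr (.inr (.inr h))
  · rintro (⟨u, hu, rfl⟩ | ⟨x, hx, rfl⟩ | ⟨x, hx, rfl⟩ | h)
    · refine .inl (.inl (.inl ?_))
      cases hu with
      | @opening B hB => exact .inl (.inl (.inl ⟨B, hB, by simp⟩))
      | @closing B hB => exact .inl (.inl (.inr ⟨B, hB, rfl⟩))
      | @vertex B v hB hv ha => exact .inl (.inr ⟨B, v, ⟨hB, hv, ha⟩, by simp⟩)
      | @bridge B C hB hC h => exact .inr ⟨B, C, ⟨⟨hB, hC⟩, h⟩, by simp⟩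
    · exact .inl (.inl (.inr ⟨x, hx, rfl⟩))
    · exact .inl (.inr ⟨x, hx, rfl⟩)
    · exact .inr h

theorem above_eq_cons {N B : ℕ} (h : B ≤ N) : above N B = num B :: above N (B + 1) := by
  have h1 : N + 1 - B = (N + 1 - (B + 1)) + 1 := by omega
  rw [above, h1, List.range'_succ]
  rfl

theorem below_append_above {N B : ℕ} (h1 : 1 ≤ B) (h : B ≤ N) :
    below B ++ above N B = above N 1 := by
  rw [below, above, above, ← List.map_append]
  congr 1
  have := List.range'_append (s := 1) (m := B - 1) (n := N + 1 - B) (step := 1)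
  rw [show 1 + 1 * (B - 1) = B by omega] at this
  rw [this]
  congr 1
  omega

theorem exists_num_of_mem_below {B : ℕ} {x : Letter} (h : x ∈ below B) :
    ∃ i, 1 ≤ i ∧ i < B ∧ x = num i := by
  simp only [below, List.mem_map, List.mem_range'_1] at h
  obtain ⟨i, hi, rfl⟩ := h
  exact ⟨i, by omega, by omega, rfl⟩

theorem exists_num_of_mem_above {N B : ℕ} {x : Letter} (h : x ∈ above N B) :
    ∃ i, B ≤ i ∧ i ≤ N ∧ x = num i := by
  simp only [above, List.mem_map, List.mem_range'_1] at h
  obtain ⟨i, hi, rfl⟩ := h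
  exact ⟨i, by omega, by omega, rfl⟩

section Pieces

variable {n : ℕ} {G : SimpleGraph (Fin n)} {k : ℕ} {ι : Finset (Fin n) → ℕ}

theorem vert_mem_plain (hk : 1 ≤ k) (v : Fin n) : vert v ∈ plain (n ^ k) := by
  rw [vert, num_mem_plain]
  have : n ≤ n ^ k := Nat.le_self_pow (by omega) n
  omega

theorem IsCliqueNumbering.one_le (hι : IsCliqueNumbering G k ι) {B : Finset (Fin n)}
    (hB : G.IsNClique k B) : 1 ≤ ι B := (Finset.mem_Icc.mp (hι.1 B hB)).1

theorem IsCliqueNumbering.le (hι : IsCliqueNumbering G k ι) {B : Finset (Fin n)}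
    (hB : G.IsNClique k B) : ι B ≤ n ^ k := (Finset.mem_Icc.mp (hι.1 B hB)).2

theorem mem_plain_of_mem_below (hι : IsCliqueNumbering G k ι) {B : Finset (Fin n)}
    (hB : G.IsNClique k B) {x : Letter} (hx : x ∈ below (ι B)) : x ∈ plain (n ^ k) := by
  obtain ⟨i, h1, h2, rfl⟩ := exists_num_of_mem_below hx
  exact num_mem_plain.2 ⟨h1, by have := hι.le hB; omega⟩

theorem mem_plain_of_mem_above {N B : ℕ} (h : 1 ≤ B) {x : Letter} (hx : x ∈ above N B) :
    x ∈ plain N := by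
  obtain ⟨i, h1, h2, rfl⟩ := exists_num_of_mem_above hx
  exact num_mem_plain.2 ⟨by omega, h2⟩

theorem IsPiece.mem_plain (hk : 1 ≤ k) (hι : IsCliqueNumbering G k ι) {u : List Letter}
    (hu : IsPiece G k ι u) {x : Letter} (hx : x ∈ u) : x ∈ plain (n ^ k) ∧ x ≠ mu := by
  have hb : ∀ {B : ℕ}, x ∈ below B → x ≠ mu := by
    intro B h; obtain ⟨i, -, -, rfl⟩ := exists_num_of_mem_below h; simp
  have ha : ∀ {B : ℕ}, x ∈ above (n ^ k) B → x ≠ mu := by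
    intro B h; obtain ⟨i, -, -, rfl⟩ := exists_num_of_mem_above h; simp
  cases hu with
  | opening hB =>
    rcases List.mem_cons.1 hx with rfl | h
    · exact ⟨dollar_mem_plain, by simp⟩
    · exact ⟨mem_plain_of_mem_below hι hB h, hb h⟩
  | closing hB => exact ⟨mem_plain_of_mem_above (hι.one_le hB) hx, ha hx⟩
  | vertex hB =>
    simp only [List.mem_append, List.mem_cons] at hx
    rcases hx with h | rfl | rfl | rfl | h
    · exact ⟨mem_plain_of_mem_above (hι.one_le hB) h, ha h⟩
    · exact ⟨hash_mem_plain, by simp⟩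
    · exact ⟨vert_mem_plain hk _, by simp [vert]⟩
    · exact ⟨hash_mem_plain, by simp⟩
    · exact ⟨mem_plain_of_mem_below hι hB h, hb h⟩
  | bridge hB hC =>
    simp only [List.mem_append, List.mem_cons] at hx
    rcases hx with h | rfl | rfl | rfl | h
    · exact ⟨mem_plain_of_mem_above (hι.one_le hB) h, ha h⟩
    · exact ⟨dollar_mem_plain, by simp⟩
    · exact ⟨gam_mem_plain, by simp⟩
    · exact ⟨dollar_mem_plain, by simp⟩
    · exact ⟨mem_plain_of_mem_below hι hC h, hb h⟩

/-- A piece begins with `$` and then opens a clique, or it begins with the number of a clique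
and then closes it, possibly passing on to the next occurrence of a clique. -/
theorem IsPiece.eq_cons (hι : IsCliqueNumbering G k ι) {u : List Letter}
    (hu : IsPiece G k ι u) :
    (∃ B, G.IsNClique k B ∧ u = dollar :: below (ι B)) ∨
      ∃ B, G.IsNClique k B ∧ ∃ u', u = num (ι B) :: u' := by
  cases hu with
  | @opening B hB => exact .inl ⟨B, hB, rfl⟩
  | @closing B hB => exact .inr ⟨B, hB, _, above_eq_cons (hι.le hB)⟩
  | @vertex B v hB => exact .inr ⟨B, hB, _, by rw [above_eq_cons (hι.le hB)]; rfl⟩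
  | @bridge B C hB => exact .inr ⟨B, hB, _, by rw [above_eq_cons (hι.le hB)]; rfl⟩

/-- A word that is cut into pieces does not begin with `#`, `γ` or `μ`. -/
theorem head_of_flatten_pieces (hι : IsCliqueNumbering G k ι) {us : List (List Letter)}
    (hus : ∀ u ∈ us, IsPiece G k ι u) {x : Letter} {r : List Letter}
    (h : us.flatten = x :: r) : x = dollar ∨ ∃ i, x = num i := by
  cases us with
  | nil => simp at h
  | cons u us =>
    rcases (hus u (by simp)).eq_cons hι with ⟨B, hB, rfl⟩ | ⟨B, hB, u', rfl⟩
    · simp at h; exact .inl h.1.symm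
    · simp at h; exact .inr ⟨_, h.1.symm⟩

/-- If a word that is cut into pieces begins with `B ⋯ N` for a clique `B`, then so does its first
piece, with the same clique. -/
theorem first_piece_of_above (hι : IsCliqueNumbering G k ι) {us : List (List Letter)}
    (hus : ∀ u ∈ us, IsPiece G k ι u) {B : Finset (Fin n)} (hB : G.IsNClique k B)
    {r : List Letter} (h : us.flatten = above (n ^ k) (ι B) ++ r) :
    ∃ us' : List (List Letter), (∀ u ∈ us', IsPiece G k ι u) ∧
      (r = us'.flatten ∨
        (∃ v : Fin n, v ∉ B ∧ (∀ b ∈ B, G.Adj v b) ∧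
          r = hash :: vert v :: hash :: (below (ι B) ++ us'.flatten)) ∨
        ∃ C : Finset (Fin n), G.IsNClique k C ∧ IsBiClique G B C ∧
          r = dollar :: gam :: dollar :: (below (ι C) ++ us'.flatten)) := by
  have hcons := above_eq_cons (hι.le hB)
  cases us with
  | nil => rw [hcons] at h; simp at h
  | cons u us =>
    refine ⟨us, fun v hv => hus v (by simp [hv]), ?_⟩
    have hu := hus u (by simp)
    have key : ∀ {B' : Finset (Fin n)}, G.IsNClique k B' → ∀ {r' : List Letter},
        above (n ^ k) (ι B') ++ r' = above (n ^ k) (ι B) ++ r → B' = B ∧ r' = r := by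
      intro B' hB' r' h'
      have h0 := h'
      rw [hcons, above_eq_cons (hι.le hB')] at h0
      simp only [List.cons_append, List.cons.injEq, num.injEq] at h0
      have := hι.2 (Set.mem_ofPred.2 hB') (Set.mem_ofPred.2 hB) h0.1
      subst this
      exact ⟨rfl, List.append_cancel_left h'⟩
    cases hu with
    | @opening B' hB' => rw [hcons] at h; simp at h
    | @closing B' hB' =>
      rw [List.flatten_cons] at h
      exact .inl (key hB' h).2.symm
    | @vertex B' v hB' hv ha =>
      rw [List.flatten_cons, List.append_assoc] at h
      obtain ⟨rfl, h⟩ := key hB' h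
      exact .inr (.inl ⟨v, hv, ha, by simpa using h.symm⟩)
    | @bridge B' C hB' hC hBC =>
      rw [List.flatten_cons, List.append_assoc] at h
      obtain ⟨rfl, h⟩ := key hB' h
      exact .inr (.inr ⟨C, hC, hBC, by simpa using h.symm⟩)

/-- The occurrences of the vertices of `A` in a gadget, without its first `$ 1 ⋯ N` and its last
`$`. -/
def vertexPart (N : ℕ) (A : List (Fin n)) : List Letter :=
  A.flatMap fun a => [hash, vert a, hash] ++ above N 1

theorem gadget_eq (N : ℕ) (A : List (Fin n)) :
    gadget N A = dollar :: (above N 1 ++ (vertexPart N A ++ [dollar])) := by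
  simp [gadget, vertexPart]

/-- Once the clique `B` is open, the pieces cut through every vertex of `A`, and hence `B` stays the
same along `A` and is completely joined to `A`. -/
theorem pieces_along_vertices (hι : IsCliqueNumbering G k ι) {B : Finset (Fin n)}
    (hB : G.IsNClique k B) {R : List Letter} :
    ∀ (A : List (Fin n)) (us : List (List Letter)), (∀ u ∈ us, IsPiece G k ι u) →
      us.flatten = above (n ^ k) (ι B) ++ (vertexPart (n ^ k) A ++ R) →
      (∀ a ∈ A, a ∉ B ∧ ∀ b ∈ B, G.Adj a b) ∧
        ∃ us' : List (List Letter), (∀ u ∈ us', IsPiece G k ι u) ∧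
          us'.flatten = above (n ^ k) (ι B) ++ R := by
  intro A
  induction A with
  | nil => intro us hus h; exact ⟨by simp, us, hus, by simpa [vertexPart] using h⟩
  | cons a A ih =>
    intro us hus h
    obtain ⟨us', hus', h' | ⟨v, hv, hadj, h'⟩ | ⟨C, -, -, h'⟩⟩ := first_piece_of_above hι hus hB h
    · exfalso
      have h'' := h'.symm
      simp only [vertexPart, List.flatMap_cons, List.cons_append] at h''
      simpa using head_of_flatten_pieces hι hus' h''
    · simp only [vertexPart, List.flatMap_cons, List.cons_append, List.cons.injEq, true_and,
        List.nil_append, vert, num.injEq] at h'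
      obtain ⟨hav, h'⟩ := h'
      obtain rfl : a = v := Fin.ext (by omega)
      rw [← below_append_above (hι.one_le hB) (hι.le hB)] at h'
      simp only [List.append_assoc] at h'
      have h3 := List.append_cancel_left h'
      rw [below_append_above (hι.one_le hB) (hι.le hB)] at h3
      obtain ⟨h4, h5⟩ := ih us' hus' (by rw [← h3]; simp [vertexPart, vert])
      exact ⟨by simpa using ⟨⟨hv, hadj⟩, h4⟩, h5⟩
    · simp [vertexPart] at h'

/-- A cut of `w_A γ w_A`, without its last `$`, into pieces reveals two cliques that are completely
joined to each other and to `A`. -/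
theorem exists_cliques_of_pieces (hι : IsCliqueNumbering G k ι) {A : List (Fin n)}
    {us : List (List Letter)} (hus : ∀ u ∈ us, IsPiece G k ι u)
    (h : us.flatten ++ [dollar] = gadget (n ^ k) A ++ gam :: gadget (n ^ k) A) :
    ∃ B C : Finset (Fin n), G.IsNClique k B ∧ G.IsNClique k C ∧ IsBiClique G B C ∧
      ∀ a ∈ A, (a ∉ B ∧ ∀ b ∈ B, G.Adj a b) ∧ a ∉ C ∧ ∀ c ∈ C, G.Adj a c := by
  have h1 : us.flatten = dollar :: (above (n ^ k) 1 ++ (vertexPart (n ^ k) A ++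
      dollar :: gam :: dollar :: (above (n ^ k) 1 ++ vertexPart (n ^ k) A))) := by
    apply List.append_cancel_right (bs := [dollar])
    rw [h, gadget_eq]
    simp
  cases us with
  | nil => simp at h1
  | cons u us =>
    have hus' : ∀ u ∈ us, IsPiece G k ι u := fun v hv => hus v (by simp [hv])
    rcases (hus u (by simp)).eq_cons hι with ⟨B, hB, rfl⟩ | ⟨B, hB, u', rfl⟩
    · simp only [List.flatten_cons, List.cons_append, List.cons.injEq, true_and] at h1
      rw [← below_append_above (hι.one_le hB) (hι.le hB)] at h1
      simp only [List.append_assoc] at h1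
      replace h1 := List.append_cancel_left h1
      rw [← List.append_assoc (below _), below_append_above (hι.one_le hB) (hι.le hB)] at h1
      obtain ⟨hAB, us2, hus2, h2⟩ := pieces_along_vertices hι hB A us hus' h1
      obtain ⟨us3, hus3, h' | ⟨v, hv, hadj, h'⟩ | ⟨C, hC, hBC, h'⟩⟩ :=
        first_piece_of_above hι hus2 hB h2
      · exfalso
        cases us3 with
        | nil => simp at h'
        | cons u us3 =>
          have hus4 : ∀ u ∈ us3, IsPiece G k ι u := fun v hv => hus3 v (by simp [hv])
          rcases (hus3 u (by simp)).eq_cons hι with ⟨C, hC, rfl⟩ | ⟨C, hC, u', rfl⟩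
          · simp only [List.flatten_cons, List.cons_append, List.cons.injEq, true_and] at h'
            cases hb : below (ι C) with
            | nil =>
              rw [hb] at h'
              simpa using head_of_flatten_pieces hι hus4 h'.symm
            | cons x l =>
              obtain ⟨i, -, -, rfl⟩ := exists_num_of_mem_below (B := ι C) (x := x) (by simp [hb])
              rw [hb] at h'
              simp at h'
          · simp at h'
      · simp at h'
      · simp only [List.cons.injEq, true_and] at h'
        rw [← below_append_above (hι.one_le hC) (hι.le hC), List.append_assoc] at h'
        replace h' := List.append_cancel_left h'
        obtain ⟨hAC, -⟩ := pieces_along_vertices hι hC (R := []) A us3 hus3 (by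
          rw [← h']; simp)
        exact ⟨B, C, hB, hC, hBC, fun a ha => ⟨hAB a ha, hAC a ha⟩⟩
    · simp at h1

/-! ### The three phases of a factorization -/

/-- In the first phase, `α s β` is read letter by letter, until `α μ β α` enters the second phase.
It is entered at some point, because no word begins with `μ`. -/
theorem exists_switch (hι : IsCliqueNumbering G k ι) :
    ∀ (s : List Letter) (fs : List (List Letter)), (∀ f ∈ fs, f ∈ graphDict G k ι) →
      fs.flatten = f₀ s ++ [mu, mu] →
      ∃ (fs' : List (List Letter)) (s₁ s₂ : List Letter) (x : Letter),
        (∀ f ∈ fs', f ∈ graphDict G k ι) ∧ s = s₁ ++ mu :: x :: s₂ ∧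
          fs'.flatten = x :: be :: (f₀ s₂ ++ [mu, mu]) := by
  intro s
  induction s with
  | nil =>
    intro fs hfs h
    exfalso
    cases fs with
    | nil => simp [f₀] at h
    | cons f fs =>
      rcases mem_graphDict.1 (hfs f (by simp)) with
        ⟨u, hu, rfl⟩ | ⟨x, -, rfl⟩ | ⟨x, -, rfl⟩ | rfl | rfl | rfl
      · rcases hu.eq_cons hι with ⟨B, hB, rfl⟩ | ⟨B, hB, u', rfl⟩ <;> simp [f₀, f₁] at h
      all_goals simp [f₀] at h
  | cons y s ih =>
    intro fs hfs h
    cases fs with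
    | nil => simp [f₀] at h
    | cons f fs =>
      have hfs' : ∀ f ∈ fs, f ∈ graphDict G k ι := fun f hf => hfs f (by simp [hf])
      rcases mem_graphDict.1 (hfs f (by simp)) with
        ⟨u, hu, rfl⟩ | ⟨x, -, rfl⟩ | ⟨x, -, rfl⟩ | rfl | rfl | rfl
      · rcases hu.eq_cons hι with ⟨B, hB, rfl⟩ | ⟨B, hB, u', rfl⟩ <;> simp [f₀, f₁] at h
      · simp only [f₀, List.flatten_cons, List.flatMap_cons, List.cons_append, List.nil_append,
          List.cons.injEq, true_and] at h
        obtain ⟨fs', s₁, s₂, z, h1, h2, h3⟩ := ih fs hfs' h.2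
        exact ⟨fs', y :: s₁, s₂, z, h1, by simp [h2], h3⟩
      · simp [f₀] at h
      · simp only [f₀, List.flatten_cons, List.flatMap_cons, List.cons_append, List.nil_append,
          List.cons.injEq, true_and] at h
        obtain ⟨rfl, h⟩ := h
        cases s with
        | nil => simp at h
        | cons z s =>
          simp only [List.flatMap_cons, List.cons_append, List.nil_append,
            List.cons.injEq, true_and] at h
          exact ⟨fs, [], s, z, hfs', rfl, h⟩
      all_goals simp [f₀] at h

/-- A word `f₁ u` at the beginning of a text in the second phase covers whole groups `s β α`, and
the text after it is again in the second phase. -/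
theorem f₁_prefix {r : List Letter} :
    ∀ (u s : List Letter) (x : Letter), f₁ u ++ r = x :: be :: (f₀ s ++ [mu, mu]) →
      ∃ (y : Letter) (s' : List Letter), x :: s = u ++ y :: s' ∧
        r = y :: be :: (f₀ s' ++ [mu, mu]) := by
  intro u
  induction u with
  | nil => intro s x h; exact ⟨x, s, rfl, by simpa [f₁] using h⟩
  | cons z u ih =>
    intro s x h
    cases s with
    | nil => simp [f₀, f₁] at h
    | cons y s =>
      simp only [f₀, f₁, List.flatMap_cons, List.cons_append, List.nil_append,
        List.cons.injEq, true_and] at h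
      obtain ⟨rfl, h⟩ := h
      obtain ⟨y', s', h1, h2⟩ := ih s y h
      exact ⟨y', s', by simp [h1], h2⟩

/-- In the second phase the text is cut into pieces, until `$ β α μ` enters the last phase. -/
theorem exists_pieces :
    ∀ (fs : List (List Letter)) (x : Letter) (s : List Letter),
      x ∈ plain (n ^ k) → (∀ y ∈ s, y ∈ plain (n ^ k)) → (∀ f ∈ fs, f ∈ graphDict G k ι) →
      fs.flatten = x :: be :: (f₀ s ++ [mu, mu]) →
      ∃ (us : List (List Letter)) (s' : List Letter), (∀ u ∈ us, IsPiece G k ι u) ∧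
        x :: s = us.flatten ++ dollar :: mu :: s' := by
  intro fs
  induction fs with
  | nil => intro x s _ _ _ h; simp at h
  | cons f fs ih =>
    intro x s hx hs hfs h
    have hfs' : ∀ f ∈ fs, f ∈ graphDict G k ι := fun f hf => hfs f (by simp [hf])
    rcases mem_graphDict.1 (hfs f (by simp)) with
      ⟨u, hu, rfl⟩ | ⟨y, -, rfl⟩ | ⟨y, -, rfl⟩ | rfl | rfl | rfl
    · obtain ⟨y, s', h1, h2⟩ := f₁_prefix u s x h
      have hmem : ∀ z ∈ u ++ y :: s', z ∈ plain (n ^ k) := by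
        rw [← h1]; simpa using ⟨hx, hs⟩
      obtain ⟨us, s'', h3, h4⟩ := ih y s' (hmem y (by simp))
        (fun z hz => hmem z (by simp [hz])) hfs' h2
      exact ⟨u :: us, s'', by simpa using ⟨hu, h3⟩, by rw [h1, h4]; simp⟩
    · simp only [List.flatten_cons, List.cons_append, List.cons.injEq] at h
      exact absurd h.1.symm (ne_al_of_mem_plain hx)
    · simp only [List.flatten_cons, List.cons_append, List.cons.injEq] at h
      exact absurd h.1.symm (ne_be_of_mem_plain hx)
    · simp only [List.flatten_cons, List.cons_append, List.cons.injEq] at h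
      exact absurd h.1.symm (ne_al_of_mem_plain hx)
    · cases s with
      | nil => simp [f₀] at h
      | cons y s =>
        simp [f₀] at h
        obtain ⟨rfl, rfl, -⟩ := h
        exact ⟨[], s, by simp, rfl⟩
    · simp only [List.flatten_cons, List.cons_append, List.cons.injEq] at h
      exact absurd h.1.symm (ne_be_of_mem_plain hx)

/-- The letters of `w` between `α` and `β` that belong to one clique. -/
def cliqueBlock (N : ℕ) (A : List (Fin n)) : List Letter :=
  mu :: (gadget N A ++ gam :: gadget N A ++ [mu])

theorem graphWord_eq (N : ℕ) (As : List (List (Fin n))) :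
    graphWord N As = f₀ (As.flatMap (cliqueBlock N)) ++ [mu, mu] := by
  simp only [graphWord, cliqueBlock, f₀, List.flatMap_assoc, List.cons_append, List.nil_append,
    List.append_assoc]

theorem mem_plain_of_mem_gadget (hk : 1 ≤ k) {A : List (Fin n)} {x : Letter}
    (hx : x ∈ gadget (n ^ k) A) : x ∈ plain (n ^ k) ∧ x ≠ mu := by
  have ha : x ∈ above (n ^ k) 1 → x ∈ plain (n ^ k) ∧ x ≠ mu := by
    intro h
    refine ⟨mem_plain_of_mem_above le_rfl h, ?_⟩
    obtain ⟨i, -, -, rfl⟩ := exists_num_of_mem_above h; simp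
  simp only [gadget, List.mem_append, List.mem_flatMap, List.mem_cons,
    List.not_mem_nil, or_false] at hx
  rcases hx with ((rfl | h) | ⟨a, -, (rfl | rfl | rfl) | h⟩) | rfl
  · exact ⟨dollar_mem_plain, by simp⟩
  · exact ha h
  · exact ⟨hash_mem_plain, by simp⟩
  · exact ⟨vert_mem_plain hk a, by simp [vert]⟩
  · exact ⟨hash_mem_plain, by simp⟩
  · exact ha h
  · exact ⟨dollar_mem_plain, by simp⟩

theorem mem_plain_of_mem_cliqueBlock (hk : 1 ≤ k) {A : List (Fin n)} {x : Letter}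
    (hx : x ∈ cliqueBlock (n ^ k) A) : x ∈ plain (n ^ k) := by
  simp only [cliqueBlock, List.mem_cons, List.mem_append, List.not_mem_nil, or_false] at hx
  rcases hx with rfl | (h | rfl | h) | rfl
  · exact mu_mem_plain
  · exact (mem_plain_of_mem_gadget hk h).1
  · exact gam_mem_plain
  · exact (mem_plain_of_mem_gadget hk h).1
  · exact mu_mem_plain

theorem append_cons_inj_of_notMem {T : Type*} {m : T} {x y : List T} :
    ∀ {a b : List T}, m ∉ a → m ∉ b → a ++ m :: x = b ++ m :: y → a = b ∧ x = y := by
  intro a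
  induction a with
  | nil =>
    intro b _ hb h
    cases b with
    | nil => simpa using h
    | cons c b => simp at h hb; exact absurd h.1 hb.1
  | cons c a ih =>
    intro b ha hb h
    cases b with
    | nil => simp at h ha; exact absurd h.1.symm ha.1
    | cons d b =>
      simp at h ha hb
      obtain ⟨rfl, h⟩ := h
      obtain ⟨rfl, rfl⟩ := ih ha.2 hb.2 h
      exact ⟨rfl, rfl⟩

/-- The second phase spans the part of a block between its two letters `μ`: it cannot start at the
end of a block, because the letter after it is `μ` again. -/
theorem exists_block_of_pieces (hk : 1 ≤ k) (hι : IsCliqueNumbering G k ι)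
    {us : List (List Letter)} (hus : ∀ u ∈ us, IsPiece G k ι u) {s' : List Letter} :
    ∀ (As : List (List (Fin n))) (s₁ : List Letter),
      As.flatMap (cliqueBlock (n ^ k)) = s₁ ++ mu :: (us.flatten ++ dollar :: mu :: s') →
      ∃ A ∈ As, us.flatten ++ [dollar] = gadget (n ^ k) A ++ gam :: gadget (n ^ k) A := by
  have hus_mu : mu ∉ us.flatten ++ [dollar] := by
    simp only [List.mem_append, List.mem_flatten, List.mem_singleton, not_or]
    refine ⟨?_, by simp⟩
    rintro ⟨u, hu, h⟩
    exact ((hus u hu).mem_plain hk hι h).2 rfl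
  intro As
  induction As with
  | nil => intro s₁ h; simp at h
  | cons A As ih =>
    intro s₁ h
    set g := gadget (n ^ k) A ++ gam :: gadget (n ^ k) A with hg
    have hg_mu : mu ∉ g := by
      simp only [hg, List.mem_append, List.mem_cons, not_or]
      exact ⟨fun h => (mem_plain_of_mem_gadget hk h).2 rfl, by simp,
        fun h => (mem_plain_of_mem_gadget hk h).2 rfl⟩
    have hblock : cliqueBlock (n ^ k) A = mu :: (g ++ [mu]) := by simp [cliqueBlock, hg]
    rw [List.flatMap_cons, hblock] at h
    cases s₁ with
    | nil =>
      refine ⟨A, by simp, ?_⟩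
      simp only [List.cons_append, List.append_assoc, List.nil_append, List.cons.injEq,
        true_and] at h
      exact (append_cons_inj_of_notMem hg_mu hus_mu (by simpa using h)).1.symm
    | cons y s₁ =>
      simp only [List.cons_append, List.append_assoc, List.nil_append, List.cons.injEq] at h
      obtain ⟨-, h⟩ := h
      by_cases hs : mu ∈ s₁
      · -- The chosen `μ` lies beyond the first `μ` of `s₁`, which is the end of this block.
        obtain ⟨a, b, rfl, ha⟩ := List.eq_append_cons_of_mem hs
        have h' : g ++ mu :: As.flatMap (cliqueBlock (n ^ k)) =
            a ++ mu :: (b ++ mu :: (us.flatten ++ dollar :: mu :: s')) := by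
          simpa [hg] using h
        obtain ⟨-, h2⟩ := append_cons_inj_of_notMem hg_mu ha h'
        obtain ⟨A', hA', h3⟩ := ih b h2
        exact ⟨A', by simp [hA'], h3⟩
      · -- The chosen `μ` ends this block, so the letter after it is the `μ` of the next block.
        exfalso
        obtain ⟨-, h2⟩ := append_cons_inj_of_notMem hg_mu hs h
        cases As with
        | nil => simp at h2
        | cons A' As =>
          rw [List.flatMap_cons, cliqueBlock] at h2
          cases hf : us.flatten with
          | nil => rw [hf] at h2; simp at h2
          | cons z l =>
            rw [hf] at h2
            simp only [List.cons_append, List.cons.injEq] at h2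
            apply hus_mu
            rw [hf, ← h2.1]
            simp

/-- Sets of vertices that are cliques and completely joined to each other form a clique. -/
theorem isNClique_union {a b : ℕ} {S T : Finset (Fin n)} (hS : G.IsNClique a S)
    (hT : G.IsNClique b T) (hST : ∀ s ∈ S, ∀ t ∈ T, G.Adj s t) :
    G.IsNClique (a + b) (S ∪ T) := by
  have hd : Disjoint S T := by
    rw [Finset.disjoint_left]
    intro x hx hx'
    exact G.loopless.irrefl x (hST x hx x hx')
  rw [SimpleGraph.isNClique_iff] at *
  refine ⟨?_, by rw [Finset.card_union_of_disjoint hd, hS.2, hT.2]⟩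
  intro x hx y hy hxy
  simp only [Finset.coe_union, Set.mem_union, Finset.mem_coe] at hx hy
  rcases hx with hx | hx <;> rcases hy with hy | hy
  · exact hS.1 hx hy hxy
  · exact hST x hx y hy
  · exact (hST y hy x hx).symm
  · exact hT.1 hx hy hxy

/-- A factorization of `w` yields cliques `B` and `C` with `k` elements each that are joined to each
other and to some `2k`-clique `A`. -/
theorem hasClique_of_factorizable (hk : 1 ≤ k) (hι : IsCliqueNumbering G k ι)
    {As : List (List (Fin n))} (hAs : IsCliqueList G k As)
    (h : Factorizable (graphDict G k ι : Set (List Letter)) (graphWord (n ^ k) As)) :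
    HasClique G (4 * k) := by
  obtain ⟨fs, hfs, h⟩ := h
  rw [graphWord_eq] at h
  have hplain : ∀ x ∈ As.flatMap (cliqueBlock (n ^ k)), x ∈ plain (n ^ k) := by
    intro x hx
    obtain ⟨A, -, hA⟩ := List.mem_flatMap.1 hx
    exact mem_plain_of_mem_cliqueBlock hk hA
  obtain ⟨fs', s₁, s₂, x, hfs', h1, h2⟩ := exists_switch hι _ fs (by simpa using hfs) h
  rw [h1] at hplain
  obtain ⟨us, s', hus, h3⟩ := exists_pieces fs' x s₂ (hplain x (by simp))
    (fun y hy => hplain y (by simp [hy])) hfs' h2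
  rw [h3] at h1
  obtain ⟨A, hA, h4⟩ := exists_block_of_pieces hk hι hus As s₁ h1
  obtain ⟨B, C, hB, hC, hBC, hall⟩ := exists_cliques_of_pieces hι hus h4
  have hA' : G.IsNClique (2 * k) A.toFinset :=
    (hAs.2.2 _).1 (List.mem_map.2 ⟨A, hA, rfl⟩)
  have hABC := isNClique_union hA' (isNClique_union hB hC hBC.2) (by
    intro a ha t ht
    have := hall a (List.mem_toFinset.1 ha)
    rcases Finset.mem_union.1 ht with ht | ht
    · exact this.1.2 t ht
    · exact this.2.2 t ht)
  exact ⟨_, by rwa [show 4 * k = 2 * k + (k + k) by ring]⟩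

/-! ### Factorizing the string of a graph with a clique -/

theorem Factorizable.nil {T : Type*} {D : Set (List T)} : Factorizable D [] :=
  ⟨[], by simp, rfl⟩

theorem Factorizable.append {T : Type*} {D : Set (List T)} {u v : List T}
    (hu : Factorizable D u) (hv : Factorizable D v) : Factorizable D (u ++ v) := by
  obtain ⟨fs, h1, rfl⟩ := hu
  obtain ⟨gs, h2, rfl⟩ := hv
  exact ⟨fs ++ gs, by simpa [or_imp, forall_and] using ⟨h1, h2⟩, by simp⟩

theorem Factorizable.of_mem {T : Type*} {D : Set (List T)} {u : List T} (hu : u ∈ D) :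
    Factorizable D u := ⟨[u], by simpa using hu, by simp⟩

theorem Factorizable.flatMap {T S : Type*} {D : Set (List T)} {g : S → List T} {s : List S}
    (h : ∀ x ∈ s, Factorizable D (g x)) : Factorizable D (s.flatMap g) := by
  induction s with
  | nil => exact .nil
  | cons x s ih =>
    rw [List.flatMap_cons]
    exact (h x (by simp)).append (ih fun y hy => h y (by simp [hy]))

theorem f₀_append (u v : List Letter) : f₀ (u ++ v) = f₀ u ++ f₀ v := List.flatMap_append

theorem f₁_append (u v : List Letter) : f₁ (u ++ v) = f₁ u ++ f₁ v := List.flatMap_append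

/-- The second phase starts after a letter `α`, and its words are of the form `f₁ u`. -/
theorem f₀_append_al (u : List Letter) : f₀ u ++ [al] = al :: f₁ u := by
  induction u with
  | nil => rfl
  | cons x u ih =>
    simp only [f₀, f₁, List.flatMap_cons, List.cons_append, List.nil_append] at ih ⊢
    rw [ih]

/-- The last phase starts at a letter `β`, and its words are `β α s`. -/
theorem be_cons_f₀ (s : List Letter) :
    be :: f₀ s = (s.flatMap fun x => [be, al, x]) ++ [be] := by
  induction s with
  | nil => rfl
  | cons x s ih =>
    simp only [f₀, List.flatMap_cons, List.cons_append, List.nil_append] at ih ⊢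
    rw [ih]

/-- The pieces for an open clique `B` that is completely joined to `A`. -/
theorem factorizable_vertices (hι : IsCliqueNumbering G k ι) {B : Finset (Fin n)}
    (hB : G.IsNClique k B) {R : List Letter} (hR : Factorizable
      (graphDict G k ι : Set (List Letter)) (f₁ (above (n ^ k) (ι B) ++ R))) :
    ∀ A : List (Fin n), (∀ a ∈ A, a ∉ B ∧ ∀ b ∈ B, G.Adj a b) →
      Factorizable (graphDict G k ι : Set (List Letter))
        (f₁ (above (n ^ k) (ι B) ++ (vertexPart (n ^ k) A ++ R))) := by
  intro A
  induction A with
  | nil => intro _; simpa [vertexPart] using hR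
  | cons a A ih =>
    intro hA
    have ih' := ih fun b hb => hA b (by simp [hb])
    have hpiece : f₁ (above (n ^ k) (ι B) ++ hash :: vert a :: hash :: below (ι B)) ∈
        (graphDict G k ι : Set (List Letter)) :=
      mem_graphDict.2 (.inl ⟨_, .vertex hB (hA a (by simp)).1 (hA a (by simp)).2, rfl⟩)
    have h := (Factorizable.of_mem hpiece).append ih'
    rw [← f₁_append] at h
    convert h using 2
    simp only [vertexPart, List.flatMap_cons, List.append_assoc, List.cons_append,
      List.nil_append, ← below_append_above (hι.one_le hB) (hι.le hB)]

/-- A `4k`-clique is divided into a `2k`-clique `A` and `k`-cliques `B` and `C`; the factorization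
is in its second phase on the block of `A`, first with `B` and then with `C` open. -/
theorem factorizable_of_hasClique (hk : 1 ≤ k) (hι : IsCliqueNumbering G k ι)
    {As : List (List (Fin n))} (hAs : IsCliqueList G k As) (h : HasClique G (4 * k)) :
    Factorizable (graphDict G k ι : Set (List Letter)) (graphWord (n ^ k) As) := by
  obtain ⟨S, hS⟩ := h
  rw [SimpleGraph.isNClique_iff] at hS
  obtain ⟨A', hAS, hAc⟩ := Finset.exists_subset_card_eq (s := S) (n := 2 * k) (by omega)
  have hc : (S \ A').card = 2 * k := by rw [Finset.card_sdiff_of_subset hAS]; omega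
  obtain ⟨B, hBS, hBc⟩ := Finset.exists_subset_card_eq (s := S \ A') (n := k) (by omega)
  obtain ⟨C, hCS, hCc⟩ := Finset.exists_subset_card_eq (s := (S \ A') \ B) (n := k)
    (by rw [Finset.card_sdiff_of_subset hBS]; omega)
  have hBS' : B ⊆ S := hBS.trans Finset.sdiff_subset
  have hCS' : C ⊆ S := (hCS.trans Finset.sdiff_subset).trans Finset.sdiff_subset
  have hsub : ∀ {T : Finset (Fin n)} {c : ℕ}, T ⊆ S → T.card = c → G.IsNClique c T :=
    fun hT hc => SimpleGraph.isNClique_iff _ |>.2 ⟨hS.1.subset (by exact_mod_cast hT), hc⟩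
  have hB := hsub hBS' hBc
  have hC := hsub hCS' hCc
  obtain ⟨A, hA, rfl⟩ := List.mem_map.1 ((hAs.2.2 A').2 (hsub hAS hAc))
  have hBA : ∀ b ∈ B, b ∉ A := fun b hb ha =>
    (Finset.mem_sdiff.1 (hBS hb)).2 (List.mem_toFinset.2 ha)
  have hCA : ∀ c ∈ C, c ∉ A := fun c hc ha =>
    (Finset.mem_sdiff.1 (Finset.mem_sdiff.1 (hCS hc)).1).2 (List.mem_toFinset.2 ha)
  have hCB : ∀ c ∈ C, c ∉ B := fun c hc => (Finset.mem_sdiff.1 (hCS hc)).2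
  have hadj : ∀ x ∈ S, ∀ y ∈ S, x ≠ y → G.Adj x y := fun x hx y hy hxy => hS.1 hx hy hxy
  have hAS' : ∀ a ∈ A, a ∈ S := fun a ha => hAS (List.mem_toFinset.2 ha)
  have hAB : ∀ a ∈ A, a ∉ B ∧ ∀ b ∈ B, G.Adj a b := fun a ha =>
    ⟨fun hb => hBA a hb ha, fun b hb =>
      hadj a (hAS' a ha) b (hBS' hb) (by rintro rfl; exact hBA a hb ha)⟩
  have hAC : ∀ a ∈ A, a ∉ C ∧ ∀ c ∈ C, G.Adj a c := fun a ha =>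
    ⟨fun hc => hCA a hc ha, fun c hc =>
      hadj a (hAS' a ha) c (hCS' hc) (by rintro rfl; exact hCA a hc ha)⟩
  have hBC : IsBiClique G B C := by
    refine ⟨Finset.disjoint_left.2 fun b hb hc => hCB b hc hb, fun b hb c hc => ?_⟩
    exact hadj b (hBS' hb) c (hCS' hc) (by rintro rfl; exact hCB b hc hb)
  have hmid : Factorizable (graphDict G k ι : Set (List Letter))
      (f₁ (dollar :: (above (n ^ k) 1 ++ (vertexPart (n ^ k) A ++
        dollar :: gam :: dollar :: (above (n ^ k) 1 ++ vertexPart (n ^ k) A))))) := by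
    -- The pieces are put together from the last to the first.
    have h1 : Factorizable (graphDict G k ι : Set (List Letter))
        (f₁ (above (n ^ k) (ι C) ++ (vertexPart (n ^ k) A ++ []))) :=
      factorizable_vertices hι hC (.of_mem (mem_graphDict.2
        (.inl ⟨_, .closing hC, by simp⟩))) A hAC
    have h2 := (Factorizable.of_mem (show f₁ _ ∈ (graphDict G k ι : Set (List Letter)) from
      mem_graphDict.2 (.inl ⟨_, .bridge hB hC hBC, rfl⟩))).append h1
    rw [← f₁_append, List.append_assoc] at h2
    have h3 := factorizable_vertices hι hB h2 A hAB
    have h4 := (Factorizable.of_mem (show f₁ _ ∈ (graphDict G k ι : Set (List Letter)) from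
      mem_graphDict.2 (.inl ⟨_, .opening hB, rfl⟩))).append h3
    rw [← f₁_append] at h4
    convert h4 using 2
    simp only [List.cons_append, List.append_nil, ← List.append_assoc (below _) (above _ _),
      below_append_above (hι.one_le hB) (hι.le hB), below_append_above (hι.one_le hC) (hι.le hC)]
  obtain ⟨As₁, As₂, rfl⟩ := List.append_of_mem hA
  have hplain : ∀ {A : List (List (Fin n))} {x : Letter},
      x ∈ A.flatMap (cliqueBlock (n ^ k)) → x ∈ plain (n ^ k) := by
    intro A x hx
    obtain ⟨A, -, hA⟩ := List.mem_flatMap.1 hx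
    exact mem_plain_of_mem_cliqueBlock hk hA
  have hpre : Factorizable (graphDict G k ι : Set (List Letter))
      (f₀ (As₁.flatMap (cliqueBlock (n ^ k)))) :=
    .flatMap fun x hx => .of_mem (mem_graphDict.2 (.inr (.inl ⟨x, hplain hx, rfl⟩)))
  have hpost : Factorizable (graphDict G k ι : Set (List Letter))
      ((As₂.flatMap (cliqueBlock (n ^ k))).flatMap fun x => [be, al, x]) :=
    .flatMap fun x hx => .of_mem (mem_graphDict.2 (.inr (.inr (.inl ⟨x, hplain hx, rfl⟩))))
  have hin : Factorizable (graphDict G k ι : Set (List Letter)) [al, mu, be, al] :=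
    .of_mem (mem_graphDict.2 (by simp))
  have hout : Factorizable (graphDict G k ι : Set (List Letter)) [dollar, be, al, mu] :=
    .of_mem (mem_graphDict.2 (by simp))
  have hend : Factorizable (graphDict G k ι : Set (List Letter)) [be, mu, mu] :=
    .of_mem (mem_graphDict.2 (by simp))
  convert hpre.append (hin.append (hmid.append (hout.append (hpost.append hend)))) using 1
  rw [graphWord_eq, List.flatMap_append, f₀_append, List.append_assoc, List.flatMap_cons]
  congr 1
  set p := dollar :: (above (n ^ k) 1 ++ (vertexPart (n ^ k) A ++
        dollar :: gam :: dollar :: (above (n ^ k) 1 ++ vertexPart (n ^ k) A))) with hp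
  set s := As₂.flatMap (cliqueBlock (n ^ k))
  have e1 : cliqueBlock (n ^ k) A ++ s = mu :: (p ++ dollar :: mu :: s) := by
    rw [cliqueBlock, gadget_eq]; simp [hp]
  have e2 : ∀ l : List Letter, f₀ (p ++ dollar :: mu :: s) ++ l =
      al :: (f₁ p ++ ([dollar, be, al, mu] ++ (be :: f₀ s ++ l))) := by
    intro l
    rw [f₀_append, show f₀ (dollar :: mu :: s) = [al] ++ (dollar :: be :: al :: mu :: be :: f₀ s)
      from rfl, ← List.append_assoc, f₀_append_al]
    simp
  rw [e1, show f₀ (mu :: (p ++ dollar :: mu :: s)) = al :: mu :: be :: f₀ (p ++ dollar :: mu :: s)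
    from rfl, List.cons_append, List.cons_append, List.cons_append, e2, be_cons_f₀]
  simp

end Pieces

/-! ### Straight-line programs from chains of rules -/

section SLP

variable {T : Type*} {s : ℕ}

/-- The rule of the nonterminal `v` with the given right-hand side. -/
def slpRule (rhs : Fin s → T ⊕ (Fin s × Fin s)) (v : Fin s) : ContextFreeRule T (Fin s) :=
  ⟨v, match rhs v with
    | .inl a => [Symbol.terminal a]
    | .inr (b, c) => [Symbol.nonterminal b, Symbol.nonterminal c]⟩

/-- The word denoted by a sentential form, if `val v` is the word of the nonterminal `v`. -/
def expand (val : Fin s → List T) (γ : List (Symbol T (Fin s))) : List T :=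
  γ.flatMap fun
    | .terminal a => [a]
    | .nonterminal v => val v

theorem expand_map_terminal (val : Fin s → List T) (u : List T) :
    expand val (u.map Symbol.terminal) = u := by
  induction u with
  | nil => rfl
  | cons a u ih =>
    simp only [expand, List.map_cons, List.flatMap_cons, List.cons_append, List.nil_append] at ih ⊢
    rw [ih]

/-- A grammar in which every rule refers to earlier nonterminals only, and in which every
nonterminal but the last is used by a later one, is a straight-line program. -/
theorem isSLP_of_acyclic (start : Fin s) (rules : Finset (ContextFreeRule T (Fin s)))
    (rhs : Fin s → T ⊕ (Fin s × Fin s)) (hrules : ∀ r, r ∈ rules ↔ ∃ v, r = slpRule rhs v)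
    (val : Fin s → List T) (hleaf : ∀ v a, rhs v = .inl a → val v = [a])
    (hnode : ∀ v b c, rhs v = .inr (b, c) → b < v ∧ c < v ∧ val v = val b ++ val c)
    (hlast : ∀ v, v ≤ start)
    (hused : ∀ v, v ≠ start → ∃ w, v < w ∧ ∃ b c, rhs w = .inr (b, c) ∧ (v = b ∨ v = c)) :
    IsSLP ⟨Fin s, start, rules⟩ (val start) := by
  set g : ContextFreeGrammar T := ⟨Fin s, start, rules⟩
  have hmem : ∀ v, slpRule rhs v ∈ g.rules := fun v => (hrules _).2 ⟨v, rfl⟩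
  have hprod : ∀ v : Fin s, g.Produces [Symbol.nonterminal v] (slpRule rhs v).output := fun v =>
    ⟨_, hmem v, (slpRule rhs v).rewrites_iff.2 ⟨[], [], by simp [slpRule], by simp⟩⟩
  have hexp : ∀ v, expand val (slpRule rhs v).output = val v := by
    intro v
    rcases h : rhs v with a | ⟨b, c⟩
    · simp [slpRule, h, expand, hleaf v a h]
    · simp [slpRule, h, expand, (hnode v b c h).2.2]
  have hinv : ∀ {γ δ : List (Symbol T (Fin s))}, g.Derives γ δ → expand val δ = expand val γ := by
    intro γ δ h
    induction h with
    | refl => rfl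
    | tail _ h ih =>
      obtain ⟨r, hr, h⟩ := h
      obtain ⟨v, rfl⟩ := (hrules r).1 hr
      obtain ⟨p, q, h1, h2⟩ := h.exists_parts
      rw [← ih, h1, h2]
      have := hexp v
      simp only [expand, List.flatMap_append] at this ⊢
      rw [this]
      simp [slpRule]
  have hder : ∀ (m : ℕ) (v : Fin s), (v : ℕ) < m →
      g.Derives [Symbol.nonterminal v] ((val v).map Symbol.terminal) := by
    intro m
    induction m with
    | zero => intro v hv; omega
    | succ m ih =>
      intro v hv
      rcases h : rhs v with a | ⟨b, c⟩
      · have h1 := hprod v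
        rw [slpRule, h] at h1
        rw [hleaf v a h]
        exact h1.single
      · have h1 := hprod v
        obtain ⟨hb, hc, hv'⟩ := hnode v b c h
        rw [slpRule, h] at h1
        rw [hv', List.map_append]
        have hb' := ih b (by have := Fin.lt_def.1 hb; omega)
        have hc' := ih c (by have := Fin.lt_def.1 hc; omega)
        exact h1.single.trans ((hb'.append_right [Symbol.nonterminal c]).trans
          (hc'.append_left _))
  refine ⟨?_, ?_, ?_, ?_⟩
  · intro v
    refine ⟨slpRule rhs v, ⟨hmem v, rfl⟩, ?_⟩
    rintro r ⟨hr, rfl⟩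
    obtain ⟨v, rfl⟩ := (hrules r).1 hr
    rfl
  · intro r hr
    obtain ⟨v, rfl⟩ := (hrules r).1 hr
    rcases h : rhs v with a | ⟨b, c⟩
    · exact .inr ⟨a, by simp [slpRule, h]⟩
    · exact .inl ⟨b, c, by simp [slpRule, h]⟩
  · -- Reachability is passed from the last nonterminal down.
    have : ∀ (m : ℕ) (v : Fin s), s ≤ v + m → ∃ γ : List (Symbol T g.NT),
        g.Derives [Symbol.nonterminal g.initial] γ ∧ Symbol.nonterminal v ∈ γ := by
      intro m
      induction m with
      | zero => intro v hv; exact absurd v.2 (by omega)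
      | succ m ih =>
        intro v hv
        by_cases hvs : v = start
        · subst hvs
          exact ⟨_, .refl _, List.mem_singleton.2 rfl⟩
        · obtain ⟨w, hvw, b, c, h, hbc⟩ := hused v hvs
          obtain ⟨γ, hγ, hw⟩ := ih w (by have := Fin.lt_def.1 hvw; omega)
          obtain ⟨p, q, rfl⟩ := List.append_of_mem hw
          refine ⟨p ++ ((slpRule rhs w).output ++ q), hγ.trans ?_, ?_⟩
          · have h1 := ((hprod w).append_right q).append_left p
            exact h1.single
          · simp only [slpRule, h, List.mem_append]
            rcases hbc with rfl | rfl <;> simp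
    exact fun v => this s v (by omega)
  · intro u
    rw [ContextFreeGrammar.mem_language_iff]
    constructor
    · intro h
      have := hinv h
      rw [expand_map_terminal] at this
      rw [this]
      exact List.append_nil (val start)
    · rintro rfl
      exact hder s start start.2

theorem grammarSize_le (start : Fin s) (rules : Finset (ContextFreeRule T (Fin s)))
    (rhs : Fin s → T ⊕ (Fin s × Fin s)) (hrules : ∀ r, r ∈ rules ↔ ∃ v, r = slpRule rhs v) :
    grammarSize (⟨Fin s, start, rules⟩ : ContextFreeGrammar T) ≤ 2 * s := by
  have h1 : rules = Finset.univ.image (slpRule rhs) := by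
    ext r; simp [hrules, eq_comm]
  have h2 : rules.card ≤ s := by
    rw [h1]; exact Finset.card_image_le.trans (by simp)
  have h3 : grammarSize (⟨Fin s, start, rules⟩ : ContextFreeGrammar T) ≤ rules.card • 2 := by
    refine Finset.sum_le_card_nsmul _ _ _ fun r hr => ?_
    obtain ⟨v, rfl⟩ := (hrules r).1 hr
    rcases h : rhs v with a | ⟨b, c⟩ <;> simp [slpRule, h]
  rw [smul_eq_mul] at h3
  omega

/-- A list of items `(β, x)` describes rules: the nonterminal `r` with item `(β, x)` produces the
letter `τ x` if `r ≤ β`, and the nonterminals `r - 1` and `x` otherwise. So a run of items with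
common first component `β`, beginning at position `β`, spells out a word from left to right. -/
def itemRhs (τ : ℕ → T) (its : List (ℕ × ℕ)) (v : Fin its.length) :
    T ⊕ (Fin its.length × Fin its.length) :=
  if h : its[v].1 < v ∧ its[v].2 < its.length then
    .inr (⟨v - 1, by omega⟩, ⟨its[v].2, h.2⟩)
  else .inl (τ its[v].2)

/-- The items of a straight-line program with letters `τ 0, …, τ (a - 1)`, an auxiliary chain that
spells out the letters `us`, and a main chain that spells out the symbols `ms`. The number
`a + us.length - 1` among the symbols stands for the word of the auxiliary chain. -/
def chainItems (a : ℕ) (us ms : List ℕ) : List (ℕ × ℕ) :=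
  (List.range a).map (fun i => (i, i)) ++
    (us.map (fun x => (a, x)) ++ ms.map fun x => (a + us.length, x))

theorem length_chainItems (a : ℕ) (us ms : List ℕ) :
    (chainItems a us ms).length = a + us.length + ms.length := by
  simp [chainItems]; omega

theorem chainItems_leaf {a : ℕ} {us ms : List ℕ} {r : ℕ} (h : r < a)
    (hr : r < (chainItems a us ms).length) : (chainItems a us ms)[r] = (r, r) := by
  simp [chainItems, h]

theorem chainItems_aux {a : ℕ} {us ms : List ℕ} {j : ℕ} (h : j < us.length)
    (hr : a + j < (chainItems a us ms).length) :
    (chainItems a us ms)[a + j] = (a, us[j]) := by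
  simp [chainItems, h]

theorem chainItems_main {a : ℕ} {us ms : List ℕ} {j : ℕ} (h : j < ms.length)
    (hr : a + us.length + j < (chainItems a us ms).length) :
    (chainItems a us ms)[a + us.length + j] = (a + us.length, ms[j]) := by
  have h1 : ¬ a + us.length + j < a := by omega
  have h2 : ¬ a + us.length + j - a < us.length := by omega
  have h3 : a + us.length + j - a - us.length = j := by omega
  simp [chainItems, List.getElem_append, h1, h2, h3]

/-- The word of a symbol in the main chain. -/
def symbolWord (τ : ℕ → T) (a : ℕ) (us : List ℕ) (x : ℕ) : List T :=
  if x < a then [τ x] else us.map τ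

/-- The word of the nonterminal `r`. -/
def chainVal (τ : ℕ → T) (a : ℕ) (us ms : List ℕ) (r : ℕ) : List T :=
  if r < a then [τ r]
  else if r < a + us.length then (us.take (r - a + 1)).map τ
  else (ms.take (r - (a + us.length) + 1)).flatMap (symbolWord τ a us)

theorem chain_cases {a : ℕ} {us ms : List ℕ} {r : ℕ} (hr : r < (chainItems a us ms).length) :
    r < a ∨ (∃ j, j < us.length ∧ r = a + j) ∨ ∃ j, j < ms.length ∧ r = a + us.length + j := by
  rw [length_chainItems] at hr
  by_cases h1 : r < a
  · exact .inl h1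
  by_cases h2 : r < a + us.length
  · exact .inr (.inl ⟨r - a, by omega, by omega⟩)
  · exact .inr (.inr ⟨r - (a + us.length), by omega, by omega⟩)

theorem chainVal_leaf {τ : ℕ → T} {a : ℕ} {us ms : List ℕ} {r : ℕ} (h : r < a) :
    chainVal τ a us ms r = [τ r] := by simp [chainVal, h]

theorem chainVal_aux {τ : ℕ → T} {a : ℕ} {us ms : List ℕ} {j : ℕ} (h : j < us.length) :
    chainVal τ a us ms (a + j) = (us.take (j + 1)).map τ := by simp [chainVal, h]

theorem chainVal_main {τ : ℕ → T} {a : ℕ} {us ms : List ℕ} {j : ℕ} :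
    chainVal τ a us ms (a + us.length + j) =
      (ms.take (j + 1)).flatMap (symbolWord τ a us) := by
  have h1 : ¬ a + us.length + j < a := by omega
  simp [chainVal, h1]

/-- The symbols of the main chain have the values that they stand for. -/
theorem chainVal_symbol {τ : ℕ → T} {a : ℕ} {us ms : List ℕ} {x : ℕ}
    (h : x < a ∨ us ≠ [] ∧ x = a + us.length - 1) :
    chainVal τ a us ms x = symbolWord τ a us x := by
  rcases h with h | ⟨h, rfl⟩
  · rw [chainVal_leaf h, symbolWord, if_pos h]
  · have := List.length_pos_iff.2 h
    rw [show a + us.length - 1 = a + (us.length - 1) by omega, chainVal_aux (by omega),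
      symbolWord, if_neg (by omega), List.take_of_length_le (by omega)]

/-- `isSLP_chain` with the first symbol of the main chain split off: only this symbol has to be a
letter, because the first rule of a chain produces a single letter. -/
theorem isSLP_chain_cons (τ : ℕ → T) (a : ℕ) (us : List ℕ) (m₀ : ℕ) (ms : List ℕ)
    (hus : ∀ x ∈ us, x < a) (hm₀ : m₀ < a)
    (hms : ∀ x ∈ ms, x < a ∨ us ≠ [] ∧ x = a + us.length - 1)
    (hletters : ∀ x < a, x ∈ us.tail ∨ x ∈ ms) (haux : us ≠ [] → a + us.length - 1 ∈ ms)
    (its : List (ℕ × ℕ)) (hits : its = chainItems a us (m₀ :: ms))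
    (start : Fin its.length) (hstart : (start : ℕ) + 1 = its.length)
    (rules : Finset (ContextFreeRule T (Fin its.length)))
    (hrules : ∀ r, r ∈ rules ↔ ∃ v, r = slpRule (itemRhs τ its) v) :
    IsSLP ⟨_, start, rules⟩ ((m₀ :: ms).flatMap (symbolWord τ a us)) := by
  have hlen : its.length = a + us.length + (m₀ :: ms).length := by
    rw [hits, length_chainItems]
  -- The right-hand sides, in the order leaves, auxiliary chain, main chain.
  have leaf : ∀ (v : Fin its.length), (v : ℕ) < a → itemRhs τ its v = .inl (τ v) := by
    intro v hv
    subst hits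
    have := chainItems_leaf (ms := m₀ :: ms) (us := us) hv v.2
    simp [itemRhs, this]
  have node : ∀ (v : Fin its.length) (β x : ℕ), its[v] = (β, x) → β < v →
      (hx : x < its.length) → itemRhs τ its v = .inr (⟨v - 1, by omega⟩, ⟨x, hx⟩) := by
    intro v β x h h1 hx
    have h2 : its[v].1 < v ∧ its[v].2 < its.length := by rw [h]; exact ⟨h1, hx⟩
    simp only [itemRhs, dif_pos h2]
    simp [h]
  have base : ∀ (v : Fin its.length) (x : ℕ), its[v] = ((v : ℕ), x) →
      itemRhs τ its v = .inl (τ x) := by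
    intro v x h
    have h2 : ¬ (its[v].1 < v ∧ its[v].2 < its.length) := by rw [h]; simp
    simp only [itemRhs, dif_neg h2]
    simp [h]
  have aux : ∀ (j : ℕ) (hj : j < us.length) (h : a + j < its.length),
      its[a + j] = (a, us[j]) := by subst hits; exact fun j hj h => chainItems_aux hj h
  have main : ∀ (j : ℕ) (hj : j < (m₀ :: ms).length) (h : a + us.length + j < its.length),
      its[a + us.length + j] = (a + us.length, (m₀ :: ms)[j]) :=
    by subst hits; exact fun j hj h => chainItems_main hj h
  have cases : ∀ v : Fin its.length, (v : ℕ) < a ∨ (∃ j, j < us.length ∧ (v : ℕ) = a + j) ∨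
      ∃ j, j < (m₀ :: ms).length ∧ (v : ℕ) = a + us.length + j := by
    subst hits; exact fun v => chain_cases v.2
  have hsym : ∀ x ∈ m₀ :: ms, x < a ∨ us ≠ [] ∧ x = a + us.length - 1 := by
    simpa using ⟨.inl hm₀, hms⟩
  have hsym_lt : ∀ x ∈ m₀ :: ms, x < a + us.length := by
    intro x hx
    rcases hsym x hx with h | ⟨h, rfl⟩
    · omega
    · have := List.length_pos_iff.2 h; omega
  have hval : ((m₀ :: ms).flatMap (symbolWord τ a us)) =
      (fun v : Fin its.length => chainVal τ a us (m₀ :: ms) v) start := by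
    simp only [List.length_cons] at hlen
    have : (start : ℕ) = a + us.length + ms.length := by omega
    simp only [this, chainVal_main]
    rw [List.take_of_length_le (by simp)]
  rw [hval]
  refine isSLP_of_acyclic start rules (itemRhs τ its) hrules
    (fun v => chainVal τ a us (m₀ :: ms) v) ?_ ?_ (fun v => Fin.le_def.2 (by omega)) ?_
  · intro v b h
    rcases cases v with hv | ⟨j, hj, hv⟩ | ⟨j, hj, hv⟩
    · rw [leaf v hv, Sum.inl.injEq] at h
      rw [chainVal_leaf hv, h]
    · have hv' : its[v] = (a, us[j]) := by
        have := aux j hj (by omega); simp [hv, this]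
      rcases Nat.eq_zero_or_pos j with rfl | hj0
      · rw [base v us[0] (by simpa [hv] using hv'), Sum.inl.injEq] at h
        cases us with
        | nil => simp at hj
        | cons u us => rw [hv, chainVal_aux hj]; simpa using h
      · rw [node v a us[j] hv' (by omega) (by have := hus us[j] (by simp); omega)] at h
        simp at h
    · have hv' : its[v] = (a + us.length, (m₀ :: ms)[j]) := by
        have := main j hj (by omega); simp [hv, this]
      rcases Nat.eq_zero_or_pos j with rfl | hj0
      · rw [base v m₀ (by simpa [hv] using hv'), Sum.inl.injEq] at h
        rw [hv, chainVal_main]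
        simpa [symbolWord, hm₀] using h
      · rw [node v _ _ hv' (by omega)
          (by have := hsym_lt (m₀ :: ms)[j] (List.getElem_mem _); omega)] at h
        simp at h
  · intro v b c h
    rcases cases v with hv | ⟨j, hj, hv⟩ | ⟨j, hj, hv⟩
    · rw [leaf v hv] at h; simp at h
    · have hv' : its[v] = (a, us[j]) := by
        have := aux j hj (by omega); simp [hv, this]
      rcases Nat.eq_zero_or_pos j with rfl | hj0
      · rw [base v us[0] (by simpa [hv] using hv')] at h; simp at h
      · have hx : us[j] < a := hus us[j] (by simp)
        rw [node v a us[j] hv' (by omega) (by omega)] at h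
        simp only [Sum.inr.injEq, Prod.mk.injEq] at h
        obtain ⟨rfl, rfl⟩ := h
        refine ⟨Fin.lt_def.2 (by simp only; omega), Fin.lt_def.2 (by simp only; omega), ?_⟩
        simp only
        rw [hv, show a + j - 1 = a + (j - 1) by omega, chainVal_aux hj, chainVal_aux (by omega),
          chainVal_leaf hx, show j - 1 + 1 = j by omega, List.take_succ_eq_append_getElem hj,
          List.map_append]
        rfl
    · have hv' : its[v] = (a + us.length, (m₀ :: ms)[j]) := by
        have := main j hj (by omega); simp [hv, this]
      rcases Nat.eq_zero_or_pos j with rfl | hj0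
      · rw [base v m₀ (by simpa [hv] using hv')] at h; simp at h
      · have hxm : (m₀ :: ms)[j] ∈ m₀ :: ms := List.getElem_mem _
        have hx := hsym_lt _ hxm
        rw [node v _ _ hv' (by omega) (by omega)] at h
        simp only [Sum.inr.injEq, Prod.mk.injEq] at h
        obtain ⟨rfl, rfl⟩ := h
        refine ⟨Fin.lt_def.2 (by simp only; omega), Fin.lt_def.2 (by simp only; omega), ?_⟩
        simp only
        rw [hv, show a + us.length + j - 1 = a + us.length + (j - 1) by omega, chainVal_main,
          chainVal_main, chainVal_symbol (hsym _ hxm), show j - 1 + 1 = j by omega,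
          List.take_succ_eq_append_getElem hj, List.flatMap_append, List.flatMap_singleton]
  · -- A letter or the auxiliary chain is used where it occurs; any other nonterminal by its
    -- successor.
    intro v hvs
    have hvs' : (v : ℕ) ≠ start := fun h => hvs (Fin.ext h)
    have usedMain : ∀ x (hx : x < its.length), x ∈ ms → x < a + us.length →
        ∃ w : Fin its.length, x < w ∧ ∃ b c, itemRhs τ its w = .inr (b, c) ∧ c = ⟨x, hx⟩ := by
      intro x hx hxm hxa
      obtain ⟨j, hj, rfl⟩ := List.getElem_of_mem hxm
      simp only [List.length_cons] at hlen
      have hw : a + us.length + (j + 1) < its.length := by omega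
      have := main (j + 1) (by simpa using hj) hw
      refine ⟨⟨_, hw⟩, by simp only; omega, _, _, node ⟨_, hw⟩ _ ms[j] (by simpa using this)
        (by simp only; omega) hx, rfl⟩
    rcases cases v with hv | ⟨j, hj, hv⟩ | ⟨j, hj, hv⟩
    · rcases hletters v hv with h | h
      · obtain ⟨j, hj, h⟩ := List.getElem_of_mem h
        simp only [List.length_tail] at hj
        have hw : a + (j + 1) < its.length := by omega
        have := aux (j + 1) (by omega) hw
        rw [List.getElem_tail] at h
        refine ⟨⟨_, hw⟩, Fin.lt_def.2 (by simp only; omega), _, _,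
          node ⟨_, hw⟩ _ v (by simpa [h] using this) (by simp only; omega) v.2, .inr rfl⟩
      · obtain ⟨w, h1, b, c, h2, h3⟩ := usedMain v v.2 h (by omega)
        exact ⟨w, h1, b, c, h2, .inr h3.symm⟩
    · by_cases hj' : j + 1 < us.length
      · have hw : a + (j + 1) < its.length := by omega
        have := aux (j + 1) hj' hw
        refine ⟨⟨_, hw⟩, Fin.lt_def.2 (by simp only; omega), _, _,
          node ⟨_, hw⟩ _ us[j + 1] (by simpa using this) (by simp only; omega)
            (by have := hus us[j + 1] (by simp); omega), .inl (Fin.ext (by simp only; omega))⟩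
      · have hne : us ≠ [] := by rintro rfl; simp at hj
        have hv' : (v : ℕ) = a + us.length - 1 := by omega
        obtain ⟨w, h1, b, c, h2, h3⟩ := usedMain v v.2 (hv' ▸ haux hne) (by omega)
        exact ⟨w, h1, b, c, h2, .inr h3.symm⟩
    · simp only [List.length_cons] at hlen hj
      have hw : a + us.length + (j + 1) < its.length := by omega
      have hj' : j + 1 < (m₀ :: ms).length := by simp only [List.length_cons]; omega
      have := main (j + 1) hj' hw
      refine ⟨⟨_, hw⟩, Fin.lt_def.2 (by simp only; omega), _, _,
        node ⟨_, hw⟩ _ (m₀ :: ms)[j + 1] (by simpa using this) (by simp only; omega)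
          (by have := hsym_lt (m₀ :: ms)[j + 1] (List.getElem_mem _); omega),
        .inl (Fin.ext (by simp only; omega))⟩

/-- Chains that use all their letters, and the auxiliary chain, form a straight-line program. -/
theorem isSLP_chain (τ : ℕ → T) (a : ℕ) (us ms : List ℕ) (hne : ms ≠ [])
    (hus : ∀ x ∈ us, x < a) (hhead : ∀ x, ms.head? = some x → x < a)
    (hms : ∀ x ∈ ms, x < a ∨ us ≠ [] ∧ x = a + us.length - 1)
    (hletters : ∀ x < a, x ∈ us.tail ∨ x ∈ ms.tail)
    (haux : us ≠ [] → a + us.length - 1 ∈ ms.tail)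
    (its : List (ℕ × ℕ)) (hits : its = chainItems a us ms)
    (start : Fin its.length) (hstart : (start : ℕ) + 1 = its.length)
    (rules : Finset (ContextFreeRule T (Fin its.length)))
    (hrules : ∀ r, r ∈ rules ↔ ∃ v, r = slpRule (itemRhs τ its) v) :
    IsSLP ⟨_, start, rules⟩ (ms.flatMap (symbolWord τ a us)) := by
  cases ms with
  | nil => exact absurd rfl hne
  | cons m₀ ms =>
    exact isSLP_chain_cons τ a us m₀ ms hus (hhead m₀ rfl) (fun x hx => hms x (by simp [hx]))
      hletters haux its hits start hstart rules hrules

end SLP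

/-! ### A straight-line program for the string of a graph -/

section GraphSLP

variable {n : ℕ}

/-- The tokens for `α x β`. A token is a letter, or `none`, which stands for `f₀ (1 ⋯ N)`. -/
def spread (x : Letter) : List (Option Letter) := [some al, some x, some be]

/-- The tokens for `f₀ (w_A)`. -/
def gadgetTokens (A : List (Fin n)) : List (Option Letter) :=
  spread dollar ++ none :: ((A.flatMap fun a =>
    spread hash ++ (spread (vert a) ++ (spread hash ++ [none]))) ++ spread dollar)

/-- The tokens for the part of `w` that belongs to the clique `A`. -/
def blockTokens (A : List (Fin n)) : List (Option Letter) :=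
  spread mu ++ (gadgetTokens A ++ (spread gam ++ (gadgetTokens A ++ spread mu)))

/-- The tokens for `w`. -/
def wordTokens (As : List (List (Fin n))) : List (Option Letter) :=
  As.flatMap blockTokens ++ [some mu, some mu]

/-- The word of a token. -/
def tokenWord (N : ℕ) : Option Letter → List Letter
  | none => f₀ (above N 1)
  | some x => [x]

theorem flatMap_spread (N : ℕ) (x : Letter) : (spread x).flatMap (tokenWord N) = f₀ [x] := rfl

theorem flatMap_gadgetTokens (N : ℕ) (A : List (Fin n)) :
    (gadgetTokens A).flatMap (tokenWord N) = f₀ (gadget N A) := by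
  have h : ∀ A : List (Fin n), (A.flatMap fun a =>
      spread hash ++ (spread (vert a) ++ (spread hash ++ [none]))).flatMap (tokenWord N) =
      f₀ (A.flatMap fun a => [hash, vert a, hash] ++ above N 1) := by
    intro A
    induction A with
    | nil => rfl
    | cons a A ih =>
      rw [List.flatMap_cons, List.flatMap_append, ih, List.flatMap_cons, f₀_append]
      congr 1
      simp [flatMap_spread, tokenWord, f₀]
  simp only [gadgetTokens, List.flatMap_append, List.flatMap_cons, h, flatMap_spread, gadget,
    f₀_append, tokenWord, List.append_assoc]

theorem flatMap_wordTokens (N : ℕ) (As : List (List (Fin n))) :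
    (wordTokens As).flatMap (tokenWord N) = graphWord N As := by
  have h : ∀ A : List (Fin n), (blockTokens A).flatMap (tokenWord N) =
      f₀ ([mu] ++ gadget N A ++ [gam] ++ gadget N A ++ [mu]) := by
    intro A
    simp only [blockTokens, List.flatMap_append, flatMap_gadgetTokens, flatMap_spread, f₀_append,
      List.append_assoc]
  simp only [wordTokens, List.flatMap_append, List.flatMap_assoc, h, graphWord]
  rfl

theorem length_f₀ (s : List Letter) : (f₀ s).length = 3 * s.length := by simp [f₀, mul_comm]

theorem length_f₁ (s : List Letter) : (f₁ s).length = 3 * s.length := by simp [f₁, mul_comm]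

theorem length_blockTokens (A : List (Fin n)) : (blockTokens A).length = 23 + 20 * A.length := by
  have : (A.flatMap fun a => spread hash ++ (spread (vert a) ++ (spread hash ++ [none]))).length =
      10 * A.length := by
    induction A with
    | nil => rfl
    | cons a A ih => rw [List.flatMap_cons, List.length_append, ih]; simp [spread]; ring
  have hs : ∀ x, (spread x).length = 3 := fun _ => rfl
  simp only [blockTokens, gadgetTokens, List.length_append, List.length_cons, this, hs]
  ring

theorem plain_subset_alphabet {N : ℕ} : plain N ⊆ alphabet N := by
  intro x hx
  simp only [plain, alphabet, Finset.mem_union, Finset.mem_insert, Finset.mem_singleton] at hx ⊢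
  tauto

theorem al_mem_alphabet {N : ℕ} : al ∈ alphabet N := by simp [alphabet]

theorem be_mem_alphabet {N : ℕ} : be ∈ alphabet N := by simp [alphabet]

theorem mem_alphabet_of_mem_f₀ {N : ℕ} {s : List Letter} (hs : ∀ x ∈ s, x ∈ plain N) {y : Letter}
    (hy : y ∈ f₀ s) : y ∈ alphabet N := by
  simp only [f₀, List.mem_flatMap, List.mem_cons, List.not_mem_nil, or_false] at hy
  obtain ⟨x, hx, rfl | rfl | rfl⟩ := hy
  · exact al_mem_alphabet
  · exact plain_subset_alphabet (hs y hx)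
  · exact be_mem_alphabet

theorem mem_alphabet_of_mem_f₁ {N : ℕ} {s : List Letter} (hs : ∀ x ∈ s, x ∈ plain N) {y : Letter}
    (hy : y ∈ f₁ s) : y ∈ alphabet N := by
  simp only [f₁, List.mem_flatMap, List.mem_cons, List.not_mem_nil, or_false] at hy
  obtain ⟨x, hx, rfl | rfl | rfl⟩ := hy
  · exact plain_subset_alphabet (hs y hx)
  · exact be_mem_alphabet
  · exact al_mem_alphabet

theorem mem_alphabet_of_mem_graphWord {k : ℕ} (hk : 1 ≤ k) {As : List (List (Fin n))}
    {y : Letter} (hy : y ∈ graphWord (n ^ k) As) : y ∈ alphabet (n ^ k) := by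
  rw [graphWord_eq, List.mem_append] at hy
  rcases hy with hy | hy
  · refine mem_alphabet_of_mem_f₀ (fun x hx => ?_) hy
    obtain ⟨A, -, hA⟩ := List.mem_flatMap.1 hx
    exact mem_plain_of_mem_cliqueBlock hk hA
  · simp only [List.mem_cons, List.not_mem_nil, or_false, or_self] at hy
    rw [hy]
    exact plain_subset_alphabet mu_mem_plain

/-- The symbols in the main chain, if letters are encoded by `code`, and `u` is the symbol for the
auxiliary chain. -/
def tokenSymbols (code : Letter → List ℕ) (u : ℕ) : Option Letter → List ℕ
  | none => [u]
  | some x => code x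

/-- The letters in the auxiliary chain: those of `f₀ (1 ⋯ N)`, unless there is no clique. -/
def auxSymbols (code : Letter → List ℕ) (N : ℕ) (As : List (List (Fin n))) : List ℕ :=
  if As = [] then [] else (f₀ (above N 1)).flatMap code

/-- The symbols of the main chain of a straight-line program for `w`. -/
def mainSymbols (code : Letter → List ℕ) (a N : ℕ) (As : List (List (Fin n))) : List ℕ :=
  (wordTokens As).flatMap (tokenSymbols code (a + (auxSymbols code N As).length - 1))

theorem exists_wordTokens_cons (As : List (List (Fin n))) :
    ∃ x r, (x = al ∨ x = mu) ∧ wordTokens As = some x :: (r ++ [some mu]) := by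
  cases As with
  | nil => exact ⟨mu, [], .inr rfl, rfl⟩
  | cons A As =>
    exact ⟨al, some mu :: some be :: ((gadgetTokens A ++ (spread gam ++
      (gadgetTokens A ++ spread mu))) ++ (As.flatMap blockTokens ++ [some mu])), .inl rfl, by
      simp [wordTokens, blockTokens, spread]⟩

/-- The letters of the string that belongs to a token in `wordTokens` are letters of `w`. -/
theorem mem_alphabet_of_mem_wordTokens {k : ℕ} (hk : 1 ≤ k) {As : List (List (Fin n))}
    {x : Letter} (hx : some x ∈ wordTokens As) : x ∈ alphabet (n ^ k) := by
  apply mem_alphabet_of_mem_graphWord hk (As := As)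
  rw [← flatMap_wordTokens]
  exact List.mem_flatMap.2 ⟨_, hx, by simp [tokenWord]⟩

/-- The chains for `w`, with every letter `x` spelled out as the letters `τ c` for `c` in `code x`,
form a straight-line program if every letter `τ c` is used after the beginning of a chain. This
covers both the string itself, where `code x` is a single number, and its version over a binary
alphabet. -/
theorem isSLP_graphWord {T : Type*} {k : ℕ} (hn : 1 ≤ n) (hk : 1 ≤ k) (τ : ℕ → T) (a : ℕ)
    (code : Letter → List ℕ) (As : List (List (Fin n)))
    (hcode : ∀ x ∈ alphabet (n ^ k), code x ≠ [])
    (hlt : ∀ x, x ∈ alphabet (n ^ k) → (As = [] → x = mu) → ∀ c ∈ code x, c < a)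
    (hletters : ∀ c < a, c ∈ (auxSymbols code (n ^ k) As).tail ∨
      c ∈ (mainSymbols code a (n ^ k) As).tail)
    (its : List (ℕ × ℕ))
    (hits : its = chainItems a (auxSymbols code (n ^ k) As) (mainSymbols code a (n ^ k) As))
    (start : Fin its.length) (hstart : (start : ℕ) + 1 = its.length)
    (rules : Finset (ContextFreeRule T (Fin its.length)))
    (hrules : ∀ r, r ∈ rules ↔ ∃ v, r = slpRule (itemRhs τ its) v) :
    IsSLP ⟨_, start, rules⟩ ((graphWord (n ^ k) As).flatMap fun x => (code x).map τ) := by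
  have hN : 1 ≤ n ^ k := Nat.one_le_pow _ _ hn
  set N := n ^ k with hNdef
  set us := auxSymbols code N As with hus
  set u := a + us.length - 1 with hu
  have hnil : As = [] → ∀ t ∈ wordTokens As, t = some mu := by
    rintro rfl; simp [wordTokens]
  have hus_ne : As ≠ [] → us ≠ [] := by
    intro h
    rw [hus, auxSymbols, if_neg h, above_eq_cons hN]
    simp only [f₀, List.flatMap_cons, ne_eq, List.cons_append, List.append_eq_nil_iff]
    exact fun h' => hcode al al_mem_alphabet h'.1
  have hus_lt : ∀ c ∈ us, c < a := by
    intro c hc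
    rw [hus, auxSymbols] at hc
    split_ifs at hc with h
    · simp at hc
    · obtain ⟨x, hx, hc⟩ := List.mem_flatMap.1 hc
      exact hlt x (mem_alphabet_of_mem_f₀ (fun y hy => mem_plain_of_mem_above le_rfl hy) hx)
        (fun h' => absurd h' h) c hc
  have hsome : ∀ x, some x ∈ wordTokens As → ∀ c ∈ code x, c < a := fun x hx =>
    hlt x (mem_alphabet_of_mem_wordTokens hk hx) fun h => by simpa using hnil h _ hx
  -- Expanding the symbols of the main chain gives the encoded string.
  have htext : (mainSymbols code a N As).flatMap (symbolWord τ a us) =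
      (graphWord N As).flatMap fun x => (code x).map τ := by
    rw [← flatMap_wordTokens, mainSymbols, List.flatMap_assoc, List.flatMap_assoc,
      List.flatMap_def, List.flatMap_def]
    congr 1
    refine List.map_congr_left fun t ht => ?_
    cases t with
    | none =>
      have h : As ≠ [] := fun h => by simpa using hnil h _ ht
      have h' : ¬ u < a := by have := List.length_pos_iff.2 (hus_ne h); omega
      simp only [tokenSymbols, ← hus, ← hu, tokenWord, List.flatMap_singleton, symbolWord,
        if_neg h']
      rw [hus, auxSymbols, if_neg h, List.map_flatMap]
    | some x =>
      have h : ∀ l : List ℕ, (∀ c ∈ l, c < a) → l.flatMap (symbolWord τ a us) = l.map τ := by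
        intro l hl
        induction l with
        | nil => rfl
        | cons c l ih =>
          rw [List.flatMap_cons, ih fun d hd => hl d (by simp [hd]), symbolWord,
            if_pos (hl c (by simp))]
          rfl
      simp only [tokenSymbols, tokenWord, List.flatMap_singleton]
      exact h _ (hsome x ht)
  obtain ⟨x₀, r, hx₀, hr⟩ := exists_wordTokens_cons As
  have hx₀' : some x₀ ∈ wordTokens As := by simp [hr]
  obtain ⟨c₀, l₀, hcl⟩ := List.exists_cons_of_ne_nil
    (hcode x₀ (mem_alphabet_of_mem_wordTokens hk hx₀'))
  have hmain : mainSymbols code a N As =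
      c₀ :: (l₀ ++ (r ++ [some mu]).flatMap (tokenSymbols code u)) := by
    rw [mainSymbols, hr, List.flatMap_cons]
    simp [tokenSymbols, hcl, ← hus, ← hu]
  rw [← htext]
  refine isSLP_chain τ a us (mainSymbols code a N As) (by simp [hmain]) hus_lt ?_ ?_ hletters ?_
    its hits start hstart rules hrules
  · intro x hx
    rw [hmain] at hx
    obtain rfl : c₀ = x := by simpa using hx
    exact hsome x₀ hx₀' c₀ (by simp [hcl])
  · intro c hc
    obtain ⟨t, ht, hc⟩ := List.mem_flatMap.1 hc
    cases t with
    | none => exact .inr ⟨hus_ne fun h => by simpa using hnil h _ ht,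
        by simpa [tokenSymbols] using hc⟩
    | some x => exact .inl (hsome x ht c hc)
  · intro h
    have hAs : As ≠ [] := by rintro rfl; exact h (by simp [hus, auxSymbols])
    have hnone : none ∈ wordTokens As := by
      obtain ⟨A, As', rfl⟩ := List.exists_cons_of_ne_nil hAs
      simp [wordTokens, blockTokens, gadgetTokens]
    have : none ∈ r ++ [some mu] := by
      rw [hr] at hnone; simpa using hnone
    rw [hmain, List.tail_cons]
    exact List.mem_append_right _ (List.mem_flatMap.2 ⟨_, this, List.mem_singleton.2 rfl⟩)

/-! ### Bounds on sizes -/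

theorem IsCliqueList.length_of_mem {G : SimpleGraph (Fin n)} {k : ℕ} {As : List (List (Fin n))}
    (hAs : IsCliqueList G k As) {A : List (Fin n)} (hA : A ∈ As) : A.length = 2 * k := by
  have h1 := (hAs.2.2 A.toFinset).1 (List.mem_map.2 ⟨A, hA, rfl⟩)
  rw [← List.toFinset_card_of_nodup (hAs.1 A hA)]
  exact h1.card_eq

theorem card_cliques_le (G : SimpleGraph (Fin n)) (k : ℕ) : (cliques G k).card ≤ n ^ k := by
  have h : cliques G k ⊆ Finset.powersetCard k Finset.univ := by
    intro S hS
    simp only [cliques, Finset.mem_filter, Finset.mem_univ, true_and] at hS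
    exact Finset.mem_powersetCard.2 ⟨Finset.subset_univ _, hS.card_eq⟩
  refine (Finset.card_le_card h).trans ?_
  rw [Finset.card_powersetCard, Finset.card_univ, Fintype.card_fin]
  exact Nat.choose_le_pow n k

theorem IsCliqueList.length_le {G : SimpleGraph (Fin n)} {k : ℕ} {As : List (List (Fin n))}
    (hAs : IsCliqueList G k As) : As.length ≤ (n ^ k) ^ 2 := by
  have h1 : (As.map List.toFinset).toFinset = cliques G (2 * k) := by
    ext S
    simp only [List.mem_toFinset, hAs.2.2 S, cliques, Finset.mem_filter, Finset.mem_univ, true_and]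
  rw [← pow_mul, mul_comm k 2, ← List.length_map (f := List.toFinset),
    ← List.toFinset_card_of_nodup hAs.2.1, h1]
  exact card_cliques_le G _

/-- If all blocks have length at most `L`, then the rules of the straight-line program for `w`
number `O(N² L)`. -/
theorem length_chainItems_graphWord_le {G : SimpleGraph (Fin n)} {k : ℕ} (hn : 1 ≤ n)
    (hk : 1 ≤ k) {As : List (List (Fin n))} (hAs : IsCliqueList G k As) {code : Letter → List ℕ}
    {L : ℕ} (hL : 1 ≤ L) (hcode : ∀ x ∈ alphabet (n ^ k), (code x).length ≤ L) (a : ℕ) :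
    (chainItems a (auxSymbols code (n ^ k) As) (mainSymbols code a (n ^ k) As)).length ≤
      a + (28 + 40 * k) * ((n ^ k) ^ 2 * L) := by
  have hN : 1 ≤ n ^ k := Nat.one_le_pow _ _ hn
  have hflat : ∀ {S : Type} (l : List S) (g : S → List ℕ), (∀ x ∈ l, (g x).length ≤ L) →
      (l.flatMap g).length ≤ l.length * L := by
    intro S l g h
    induction l with
    | nil => simp
    | cons x l ih =>
      have h1 := h x (by simp)
      have h2 := ih fun y hy => h y (by simp [hy])
      rw [List.flatMap_cons, List.length_append, List.length_cons]
      linarith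
  have hus : (auxSymbols code (n ^ k) As).length ≤ 3 * n ^ k * L := by
    rw [auxSymbols]
    split_ifs
    · simp
    · refine (hflat _ _ fun x hx => hcode x (mem_alphabet_of_mem_f₀
        (fun y hy => mem_plain_of_mem_above le_rfl hy) hx)).trans (le_of_eq ?_)
      rw [length_f₀, above, List.length_map, List.length_range', Nat.add_sub_cancel]
  have htok : (wordTokens As).length ≤ (n ^ k) ^ 2 * (23 + 40 * k) + 2 := by
    have : (As.flatMap blockTokens).length ≤ As.length * (23 + 40 * k) := by
      rw [List.length_flatMap]
      refine (List.sum_le_card_nsmul _ (23 + 40 * k) ?_).trans (by simp)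
      intro x hx
      obtain ⟨A, hA, rfl⟩ := List.mem_map.1 hx
      rw [length_blockTokens, hAs.length_of_mem hA]
      linarith
    rw [wordTokens, List.length_append]
    have h2 := Nat.mul_le_mul_right (23 + 40 * k) hAs.length_le
    simp only [List.length_cons, List.length_nil]
    omega
  have hms : (mainSymbols code a (n ^ k) As).length ≤ ((n ^ k) ^ 2 * (23 + 40 * k) + 2) * L := by
    refine (hflat _ _ ?_).trans (Nat.mul_le_mul_right _ htok)
    rintro (_ | x) hx
    · simpa [tokenSymbols] using hL
    · exact hcode x (mem_alphabet_of_mem_wordTokens hk hx)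
  rw [length_chainItems]
  generalize n ^ k = N at *
  have h1 : N * L ≤ N ^ 2 * L := Nat.mul_le_mul_right _ (by nlinarith)
  have h2 : L ≤ N ^ 2 * L := Nat.le_mul_of_pos_left _ (by positivity)
  nlinarith

theorem IsPiece.length_le {G : SimpleGraph (Fin n)} {k : ℕ} {ι : Finset (Fin n) → ℕ}
    (hι : IsCliqueNumbering G k ι) {u : List Letter} (hu : IsPiece G k ι u) :
    u.length ≤ 2 * n ^ k + 3 := by
  cases hu with
  | opening hB => have := hι.le hB; simp [below]; omega
  | closing hB => have := hι.one_le hB; simp [above]; omega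
  | vertex hB => have := hι.le hB; have := hι.one_le hB; simp [above, below]; omega
  | bridge hB hC =>
    have := hι.one_le hB; have := hι.le hC; have := hι.one_le hC; simp [above, below]; omega

theorem length_le_of_mem_graphDict {G : SimpleGraph (Fin n)} {k : ℕ} {ι : Finset (Fin n) → ℕ}
    (hn : 1 ≤ n) (hι : IsCliqueNumbering G k ι) {d : List Letter} (hd : d ∈ graphDict G k ι) :
    d.length ≤ 15 * n ^ k := by
  have hN : 1 ≤ n ^ k := Nat.one_le_pow _ _ hn
  rcases mem_graphDict.1 hd with ⟨u, hu, rfl⟩ | ⟨x, -, rfl⟩ | ⟨x, -, rfl⟩ | rfl | rfl | rfl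
  · have h1 := hu.length_le hι
    rw [length_f₁]
    omega
  all_goals simp only [List.length_cons, List.length_nil]; omega

theorem mem_alphabet_of_mem_graphDict {G : SimpleGraph (Fin n)} {k : ℕ}
    {ι : Finset (Fin n) → ℕ} (hk : 1 ≤ k) (hι : IsCliqueNumbering G k ι) {d : List Letter}
    (hd : d ∈ graphDict G k ι) {y : Letter} (hy : y ∈ d) : y ∈ alphabet (n ^ k) := by
  have hp : ∀ x ∈ plain (n ^ k), x ∈ alphabet (n ^ k) := fun x hx => plain_subset_alphabet hx
  have hd' : dollar ∈ alphabet (n ^ k) := hp _ dollar_mem_plain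
  have hm : mu ∈ alphabet (n ^ k) := hp _ mu_mem_plain
  have ha : al ∈ alphabet (n ^ k) := al_mem_alphabet
  have hb : be ∈ alphabet (n ^ k) := be_mem_alphabet
  rcases mem_graphDict.1 hd with ⟨u, hu, rfl⟩ | ⟨x, hx, rfl⟩ | ⟨x, hx, rfl⟩ | rfl | rfl | rfl
  · exact mem_alphabet_of_mem_f₁ (fun x hx => (hu.mem_plain hk hι hx).1) hy
  · have := hp x hx
    simp only [List.mem_cons, List.not_mem_nil, or_false] at hy
    rcases hy with rfl | rfl | rfl <;> assumption
  · have := hp x hx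
    simp only [List.mem_cons, List.not_mem_nil, or_false] at hy
    rcases hy with rfl | rfl | rfl <;> assumption
  all_goals
    simp only [List.mem_cons, List.not_mem_nil, or_false] at hy
    rcases hy with rfl | rfl | rfl | rfl <;> assumption

theorem card_graphDict_le (G : SimpleGraph (Fin n)) {k : ℕ} (hn : 1 ≤ n) (hk : 1 ≤ k)
    (ι : Finset (Fin n) → ℕ) : (graphDict G k ι).card ≤ 17 * (n ^ k) ^ 2 := by
  have hN : 1 ≤ n ^ k := Nat.one_le_pow _ _ hn
  have hnN : n ≤ n ^ k := Nat.le_self_pow (by omega) n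
  have hc := card_cliques_le G k
  have hS : ((Finset.Icc 1 (n ^ k)).image num ∪ {dollar, hash, gam, mu}).card ≤ n ^ k + 4 := by
    refine (Finset.card_union_le _ _).trans (add_le_add ?_ ?_)
    · exact Finset.card_image_le.trans (by simp)
    · exact Finset.card_le_four
  simp only [graphDict]
  have h1 : ((cliques G k) ×ˢ (Finset.univ : Finset (Fin n))).card ≤ n ^ k * n ^ k := by
    rw [Finset.card_product, Finset.card_univ, Fintype.card_fin]
    exact Nat.mul_le_mul hc hnN
  have h2 : ((cliques G k) ×ˢ (cliques G k)).card ≤ n ^ k * n ^ k := by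
    rw [Finset.card_product]
    exact Nat.mul_le_mul hc hc
  have h3 : ∀ x y z : List Letter, ({x, y, z} : Finset (List Letter)).card ≤ 3 :=
    fun _ _ _ => Finset.card_le_three
  refine (Finset.card_union_le _ _).trans ((add_le_add ((Finset.card_union_le _ _).trans (add_le_add
    ((Finset.card_union_le _ _).trans (add_le_add ((Finset.card_union_le _ _).trans (add_le_add
    ((Finset.card_union_le _ _).trans (add_le_add ((Finset.card_union_le _ _).trans (add_le_add
    (Finset.card_image_le.trans hc) (Finset.card_image_le.trans hc)))
    (Finset.card_image_le.trans ((Finset.card_filter_le _ _).trans h1))))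
    (Finset.card_image_le.trans ((Finset.card_filter_le _ _).trans h2))))
    (Finset.card_image_le.trans hS))) (Finset.card_image_le.trans hS))) (h3 _ _ _)).trans ?_)
  nlinarith

/-- The position of a letter in the alphabet. -/
def letterIndex : Letter → ℕ
  | al => 0
  | mu => 1
  | dollar => 2
  | Letter.hash => 3
  | gam => 4
  | be => 5
  | num i => i + 5

/-- The letter at a position of the alphabet. -/
def letterOf : ℕ → Letter
  | 0 => al
  | 1 => mu
  | 2 => dollar
  | 3 => hash
  | 4 => gam
  | 5 => be
  | i + 6 => num (i + 1)

theorem letterOf_letterIndex {N : ℕ} {x : Letter} (hx : x ∈ alphabet N) :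
    letterOf (letterIndex x) = x := by
  cases x with
  | num i =>
    have hi : 1 ≤ i := by simp [alphabet] at hx; exact hx.1
    obtain ⟨j, rfl⟩ := Nat.exists_eq_add_of_le' hi
    rfl
  | _ => rfl

theorem letterIndex_lt {N : ℕ} {x : Letter} (hx : x ∈ alphabet N) : letterIndex x < N + 6 := by
  cases x with
  | num i =>
    have hi : i ≤ N := by simp [alphabet] at hx; exact hx.2
    simp only [letterIndex]; omega
  | _ => simp only [letterIndex]; omega

/-- A nonterminal of a straight-line program has to be used, so the letters are those of the whole
alphabet if there is a `2k`-clique, and only `μ` otherwise. -/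
theorem exists_slp_graphWord {G : SimpleGraph (Fin n)} {k : ℕ} (hn : 1 ≤ n) (hk : 1 ≤ k)
    {As : List (List (Fin n))} (hAs : IsCliqueList G k As) :
    ∃ g : ContextFreeGrammar Letter, IsSLP g (graphWord (n ^ k) As) ∧
      grammarSize g ≤ (70 + 80 * k) * (n ^ k) ^ 2 := by
  have hN : 1 ≤ n ^ k := Nat.one_le_pow _ _ hn
  have hNN : n ^ k ≤ (n ^ k) ^ 2 := Nat.le_self_pow (by norm_num) _
  have build : ∀ (a : ℕ) (code : Letter → List ℕ) (τ : ℕ → Letter), a ≤ n ^ k + 6 →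
      (∀ x, (code x).length = 1) →
      (∀ x ∈ graphWord (n ^ k) As, (code x).map τ = [x]) →
      (∀ x, x ∈ alphabet (n ^ k) → (As = [] → x = mu) → ∀ c ∈ code x, c < a) →
      (∀ c < a, c ∈ (auxSymbols code (n ^ k) As).tail ∨
        c ∈ (mainSymbols code a (n ^ k) As).tail) →
      ∃ g : ContextFreeGrammar Letter, IsSLP g (graphWord (n ^ k) As) ∧
        grammarSize g ≤ (70 + 80 * k) * (n ^ k) ^ 2 := by
    intro a code τ ha h1 h2 h3 h4
    set its := chainItems a (auxSymbols code (n ^ k) As) (mainSymbols code a (n ^ k) As) with hits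
    have hpos : 0 < its.length := by
      obtain ⟨x, r, -, hr⟩ := exists_wordTokens_cons As
      rw [hits, length_chainItems, mainSymbols, hr, List.flatMap_cons, List.length_append]
      have := h1 x
      simp only [tokenSymbols]
      omega
    have hle := length_chainItems_graphWord_le hn hk hAs le_rfl (fun x _ => (h1 x).le) a
    rw [← hits] at hle
    refine ⟨⟨Fin its.length, ⟨its.length - 1, by omega⟩,
      Finset.univ.image (slpRule (itemRhs τ its))⟩, ?_, ?_⟩
    · have := isSLP_graphWord hn hk τ a code As
        (fun x _ h => by have := h1 x; rw [h] at this; simp at this) h3 h4 its hits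
        ⟨its.length - 1, by omega⟩ (by simp only; omega)
        (Finset.univ.image (slpRule (itemRhs τ its))) (by simp [eq_comm])
      convert this using 1
      have h5 : (graphWord (n ^ k) As).flatMap (fun x => (code x).map τ) =
          (graphWord (n ^ k) As).flatMap (fun x => [x]) := by
        rw [List.flatMap_def, List.flatMap_def]
        congr 1
        exact List.map_congr_left h2
      rw [h5]; simp
    · refine (grammarSize_le _ _ (itemRhs τ its) (by simp [eq_comm])).trans ?_
      nlinarith
  by_cases hnil : As = []
  · -- The string is `μ μ`, and no other letter may have a rule.
    subst hnil
    refine build 1 (fun _ => [0]) (fun _ => mu) (by omega) (fun _ => rfl) ?_ (by simp) ?_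
    · simp [graphWord]
    · intro c hc
      obtain rfl : c = 0 := by omega
      exact .inr (by simp [mainSymbols, wordTokens, tokenSymbols])
  · refine build (n ^ k + 6) (fun x => [letterIndex x]) letterOf le_rfl (fun _ => rfl) ?_ ?_ ?_
    · intro x hx
      simpa using letterOf_letterIndex (mem_alphabet_of_mem_graphWord hk hx)
    · intro x hx _ c hc
      rw [List.mem_singleton.1 hc]
      exact letterIndex_lt hx
    · intro c hc
      obtain ⟨A, As', rfl⟩ := List.exists_cons_of_ne_nil hnil
      have hA := hAs.length_of_mem (A := A) (by simp)
      obtain ⟨v, A', rfl⟩ := List.exists_cons_of_ne_nil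
        (List.ne_nil_of_length_pos (l := A) (by omega))
      by_cases hc6 : c < 6
      · right
        simp only [mainSymbols, wordTokens, blockTokens, gadgetTokens, spread, List.flatMap_cons,
          List.cons_append, List.flatMap_append, tokenSymbols, letterIndex, List.tail_cons,
          List.nil_append]
        interval_cases c <;> simp
      · left
        rw [auxSymbols, if_neg (by simp), above_eq_cons hN]
        have h5 : num (c - 5) ∈ above (n ^ k) 1 := by
          simp only [above, List.mem_map, List.mem_range'_1]
          exact ⟨c - 5, by omega, rfl⟩
        rw [above_eq_cons hN] at h5
        simp only [f₀, List.flatMap_cons, List.cons_append, List.nil_append, List.tail_cons,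
          List.mem_cons, List.mem_flatMap]
        rcases List.mem_cons.1 h5 with h5 | h5
        · left
          simp only [num.injEq] at h5
          simp only [letterIndex]; omega
        · right; right
          exact ⟨num (c - 5), ⟨_, h5, by simp⟩, by simp [letterIndex]; omega⟩

end GraphSLP

/-! ### Running programs of the word RAM -/

/-- The program `p` leads from `s` to `s'` in at most `T` steps and writes only values up to `W`. -/
def Runs (W : ℕ) (p : Prog) (s : Store) (T : ℕ) (s' : Store) : Prop :=
  ∃ t ≤ T, Exec W p s t s'

section Runs

variable {W : ℕ}

theorem Runs.const {s s' : Store} {x c : ℕ} (h : c ≤ W) (hs : s.setReg x c = s') :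
    Runs W (.const x c) s 1 s' :=
  ⟨1, le_rfl, hs ▸ .const s x c h⟩

theorem Runs.op {s s' : Store} {o : Op} {x y z v : ℕ} (hv : o.eval (s.reg y) (s.reg z) = v)
    (h : v ≤ W) (hs : s.setReg x v = s') : Runs W (.op o x y z) s 1 s' := by
  subst hv hs
  exact ⟨1, le_rfl, .op s o x y z h⟩

theorem Runs.load {s s' : Store} {x a y v : ℕ} (hv : s.arr a (s.reg y) = v)
    (h : v ≤ W) (hs : s.setReg x v = s') : Runs W (.load x a y) s 1 s' := by
  subst hv hs
  exact ⟨1, le_rfl, .load s x a y h⟩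

theorem Runs.store {s s' : Store} {a y x i v : ℕ} (hi : s.reg y = i) (hv : s.reg x = v)
    (h : v ≤ W) (hs : s.setArr a i v = s') : Runs W (.store a y x) s 1 s' := by
  subst hi hv hs
  exact ⟨1, le_rfl, .store s a y x h⟩

theorem Runs.seq {p q : Prog} {s₁ s₂ s₃ : Store} {t₁ t₂ T : ℕ} (h₁ : Runs W p s₁ t₁ s₂)
    (h₂ : Runs W q s₂ t₂ s₃) (hT : t₁ + t₂ ≤ T) : Runs W (.seq p q) s₁ T s₃ := by
  obtain ⟨t, ht, h⟩ := h₁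
  obtain ⟨t', ht', h'⟩ := h₂
  exact ⟨t + t', by omega, .seq h h'⟩

theorem Runs.ite_true {x : ℕ} {p q : Prog} {s s' : Store} {t T : ℕ} (hx : s.reg x ≠ 0)
    (h : Runs W p s t s') (hT : t + 1 ≤ T) : Runs W (.ite x p q) s T s' := by
  obtain ⟨t, ht, h⟩ := h
  exact ⟨t + 1, by omega, .ite_true hx h⟩

theorem Runs.ite_false {x : ℕ} {p q : Prog} {s s' : Store} {t T : ℕ} (hx : s.reg x = 0)
    (h : Runs W q s t s') (hT : t + 1 ≤ T) : Runs W (.ite x p q) s T s' := by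
  obtain ⟨t, ht, h⟩ := h
  exact ⟨t + 1, by omega, .ite_false hx h⟩

/-- A loop that counts register `x` down: `S j` is the store when `j` rounds remain. -/
theorem Runs.countdown {x : ℕ} {body : Prog} (S : ℕ → Store) (c : ℕ → ℕ) :
    ∀ b : ℕ, (∀ j ≤ b, (S j).reg x = j) → (∀ j < b, Runs W body (S (j + 1)) (c j) (S j)) →
      Runs W (.loop x body) (S b) (∑ j ∈ Finset.range b, (c j + 1) + 1) (S 0) := by
  intro b
  induction b with
  | zero => intro h _; exact ⟨1, by simp, .loop_false (h 0 le_rfl)⟩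
  | succ b ih =>
    intro h hb
    obtain ⟨t, ht, h₁⟩ := hb b (by omega)
    obtain ⟨t', ht', h₂⟩ := ih (fun j hj => h j (by omega)) fun j hj => hb j (by omega)
    refine ⟨t + t' + 1, ?_, .loop_true (by rw [h _ le_rfl]; omega) h₁ h₂⟩
    rw [Finset.sum_range_succ]
    omega

theorem Exec.mono {W W' : ℕ} (hW : W ≤ W') {p : Prog} {s s' : Store} {t : ℕ}
    (h : Exec W p s t s') : Exec W' p s t s' := by
  induction h with
  | const s x c h => exact .const s x c (h.trans hW)
  | op s o x y z h => exact .op s o x y z (h.trans hW)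
  | load s x a y h => exact .load s x a y (h.trans hW)
  | store s a y x h => exact .store s a y x (h.trans hW)
  | seq _ _ ih₁ ih₂ => exact .seq ih₁ ih₂
  | ite_true hx _ ih => exact .ite_true hx ih
  | ite_false hx _ ih => exact .ite_false hx ih
  | loop_false hx => exact .loop_false hx
  | loop_true hx _ _ ih₁ ih₂ => exact .loop_true hx ih₁ ih₂

end Runs

/-! ### The layout of the store -/

/-- The register of a variable. -/
def varReg (x : ℕ) : ℕ := 2 * x + 6

/-- The register of a temporary value. -/
def tmpReg (d : ℕ) : ℕ := 2 * d + 7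

/-- A store, divided into the registers `0, …, 5`, the variables, the temporary values, and the
arrays. -/
def layout (R env tmp : ℕ → ℕ) (A : ℕ → ℕ → ℕ) : Store where
  reg r := if r < 6 then R r else if r % 2 = 0 then env (r / 2 - 3) else tmp (r / 2 - 3)
  arr := A

section Layout

variable {R env tmp : ℕ → ℕ} {A : ℕ → ℕ → ℕ}

theorem layout_reg {i : ℕ} (h : i < 6) : (layout R env tmp A).reg i = R i := by
  simp [layout, h]

theorem layout_varReg (x : ℕ) : (layout R env tmp A).reg (varReg x) = env x := by
  have h1 : ¬ 2 * x + 6 < 6 := by omega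
  have h2 : (2 * x + 6) % 2 = 0 := by omega
  have h3 : (2 * x + 6) / 2 - 3 = x := by omega
  simp only [layout, varReg, h1, h2, h3, if_true, if_false]

theorem layout_tmpReg (d : ℕ) : (layout R env tmp A).reg (tmpReg d) = tmp d := by
  have h1 : ¬ 2 * d + 7 < 6 := by omega
  have h2 : ¬ (2 * d + 7) % 2 = 0 := by omega
  have h3 : (2 * d + 7) / 2 - 3 = d := by omega
  simp only [layout, tmpReg, h1, h2, h3, if_false]

theorem layout_arr : (layout R env tmp A).arr = A := rfl

theorem layout_setReg {i v : ℕ} (h : i < 6) :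
    (layout R env tmp A).setReg i v = layout (Function.update R i v) env tmp A := by
  refine Store.ext (funext fun r => ?_) rfl
  by_cases hr : r = i
  · subst hr; simp [layout, Store.setReg, h]
  · simp [layout, Store.setReg, Function.update_of_ne hr]

theorem layout_setVar {x v : ℕ} :
    (layout R env tmp A).setReg (varReg x) v = layout R (Function.update env x v) tmp A := by
  refine Store.ext (funext fun r => ?_) rfl
  by_cases hr : r = varReg x
  · subst hr
    rw [layout_varReg]
    simp [Store.setReg]
  · simp only [Store.setReg, Function.update_of_ne hr, layout]
    split_ifs with h1 h2
    · rfl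
    · rw [Function.update_of_ne]
      simp only [varReg] at hr; omega
    · rfl

theorem layout_setTmp {d v : ℕ} :
    (layout R env tmp A).setReg (tmpReg d) v = layout R env (Function.update tmp d v) A := by
  refine Store.ext (funext fun r => ?_) rfl
  by_cases hr : r = tmpReg d
  · subst hr
    rw [layout_tmpReg]
    simp [Store.setReg]
  · simp only [Store.setReg, Function.update_of_ne hr, layout]
    split_ifs with h1 h2
    · rfl
    · rfl
    · rw [Function.update_of_ne]
      simp only [tmpReg] at hr; omega

theorem layout_setArr {a i v : ℕ} : (layout R env tmp A).setArr a i v =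
    layout R env tmp (Function.update A a (Function.update (A a) i v)) := rfl

end Layout

/-! ### Expressions -/

/-- Arithmetic expressions over the variables; `adj e` is the entry with index `e` of the adjacency
matrix, which is kept in array `5`. -/
inductive Expr
  | const (c : ℕ)
  | var (x : ℕ)
  | adj (e : Expr)
  | op (o : Op) (a b : Expr)

namespace Expr

/-- The value of an expression, if `E` is the adjacency matrix. -/
def eval (E env : ℕ → ℕ) : Expr → ℕ
  | const c => c
  | var x => env x
  | adj e => E (e.eval E env)
  | op o a b => o.eval (a.eval E env) (b.eval E env)

/-- The time to evaluate an expression. -/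
def cost : Expr → ℕ
  | const _ => 1
  | var _ => 1
  | adj e => e.cost + 1
  | op _ a b => a.cost + b.cost + 2

/-- The program that writes the value of an expression into temporary register `d`, using only
temporary registers from `d` on. -/
def compile : Expr → ℕ → Prog
  | const c, d => .const (tmpReg d) c
  | var x, d => .op .add (tmpReg d) (varReg x) 1
  | adj e, d => .seq (e.compile d) (.load (tmpReg d) 5 (tmpReg d))
  | op o a b, d => .seq (a.compile d) (.seq (b.compile (d + 1))
      (.seq (.op o (tmpReg d) (tmpReg d) (tmpReg (d + 1))) (.const (tmpReg (d + 1)) 0)))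

/-- All operations in the expression yield values that are polynomial in their arguments. -/
def Tame : Expr → Prop
  | const _ => True
  | var _ => True
  | adj e => e.Tame
  | op o a b => (∀ x y, o.eval x y ≤ (x + 1) * (y + 1)) ∧ a.Tame ∧ b.Tame

/-- The values in a tame expression are polynomially bounded, with a degree that depends only on the
expression. -/
theorem runs : ∀ e : Expr, e.Tame → ∀ m, ∃ D, ∀ M, 2 ≤ M → ∀ (R env : ℕ → ℕ) (A : ℕ → ℕ → ℕ),
    R 1 = 0 → (∀ i, A 5 i ≤ 1) → (∀ x, env x ≤ M ^ m) → e.eval (A 5) env ≤ M ^ D ∧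
      ∀ W, M ^ D ≤ W → ∀ d tmp, (∀ j > d, tmp j = 0) →
        Runs W (e.compile d) (layout R env tmp A) e.cost
          (layout R env (Function.update tmp d (e.eval (A 5) env)) A) := by
  intro e
  induction e with
  | const c =>
    intro _ m
    refine ⟨c, fun M hM R env A hR hA henv => ?_⟩
    have h : c ≤ M ^ c := (Nat.lt_two_pow_self (n := c)).le.trans (Nat.pow_le_pow_left hM c)
    exact ⟨h, fun W hW d tmp _ => .const (h.trans hW) layout_setTmp⟩
  | var x =>
    intro _ m
    refine ⟨m, fun M hM R env A hR hA henv => ⟨henv x, fun W hW d tmp _ =>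
      .op ?_ ((henv x).trans hW) layout_setTmp⟩⟩
    rw [layout_varReg, layout_reg (by norm_num), hR]
    rfl
  | adj e ih =>
    intro he m
    obtain ⟨D, hD⟩ := ih he m
    refine ⟨D, fun M hM R env A hR hA henv => ?_⟩
    obtain ⟨h1, h2⟩ := hD M hM R env A hR hA henv
    have h3 : A 5 (e.eval (A 5) env) ≤ M ^ D := (hA _).trans (Nat.one_le_pow _ _ (by omega))
    refine ⟨h3, fun W hW d tmp htmp => (h2 W hW d tmp htmp).seq
      (Runs.load (v := A 5 (e.eval (A 5) env)) ?_ (h3.trans hW) ?_) le_rfl⟩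
    · rw [layout_tmpReg, layout_arr, Function.update_self]
    · rw [layout_setTmp, Function.update_idem]; rfl
  | op o a b iha ihb =>
    intro he m
    obtain ⟨Da, ha⟩ := iha he.2.1 m
    obtain ⟨Db, hb⟩ := ihb he.2.2 m
    refine ⟨(Da + 1) + (Db + 1), fun M hM R env A hR hA henv => ?_⟩
    obtain ⟨a1, a2⟩ := ha M hM R env A hR hA henv
    obtain ⟨b1, b2⟩ := hb M hM R env A hR hA henv
    have pos : ∀ D, 1 ≤ M ^ D := fun D => Nat.one_le_pow _ _ (by omega)
    have hsucc : ∀ D x, x ≤ M ^ D → x + 1 ≤ M ^ (D + 1) := fun D x hx => by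
      have := pos D
      rw [pow_succ]; nlinarith
    have h3 : (op o a b).eval (A 5) env ≤ M ^ ((Da + 1) + (Db + 1)) := by
      rw [pow_add]
      exact (he.1 _ _).trans (Nat.mul_le_mul (hsucc _ _ a1) (hsucc _ _ b1))
    refine ⟨h3, fun W hW d tmp htmp => ?_⟩
    have hle : ∀ D, D ≤ (Da + 1) + (Db + 1) → M ^ D ≤ W := fun D hD =>
      (Nat.pow_le_pow_right (by omega) hD).trans hW
    have hfin : Function.update (Function.update (Function.update (Function.update tmp d
        (a.eval (A 5) env)) (d + 1) (b.eval (A 5) env)) d ((op o a b).eval (A 5) env)) (d + 1) 0 =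
        Function.update tmp d ((op o a b).eval (A 5) env) := by
      funext j
      have := htmp (d + 1) (by omega)
      simp only [Function.update_apply]
      split_ifs <;> first | rfl | omega | simp_all
    refine (a2 W (hle _ (by omega)) d tmp htmp).seq ((b2 W (hle _ (by omega)) (d + 1) _ ?_).seq
      ((Runs.op (v := (op o a b).eval (A 5) env) ?_ (h3.trans hW) layout_setTmp).seq
        (Runs.const (Nat.zero_le _) (layout_setTmp.trans (by rw [hfin]))) le_rfl) le_rfl) ?_
    · intro j hj
      rw [Function.update_of_ne (by omega), htmp j (by omega)]
    · rw [layout_tmpReg, layout_tmpReg, Function.update_of_ne (by omega), Function.update_self,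
        Function.update_self]
      rfl
    · simp only [cost]; omega

end Expr

/-! ### Programs that write output -/

/-- An event of output: a letter of the dictionary, the length of a word of the dictionary, or an
item of the straight-line program. -/
inductive Event
  | chr (v : ℕ)
  | len (v : ℕ)
  | sym (β x : ℕ)

/-- The letters in the output. -/
def chars (o : List Event) : List ℕ := o.filterMap fun | .chr v => some v | _ => none

/-- The lengths in the output. -/
def lens (o : List Event) : List ℕ := o.filterMap fun | .len v => some v | _ => none

/-- The items in the output. -/
def items (o : List Event) : List (ℕ × ℕ) := o.filterMap fun | .sym β x => some (β, x) | _ => none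

/-- The fixed registers: three counters for the output, the constants `0`, and `1`. -/
def regsOf (o : List Event) : ℕ → ℕ
  | 0 => (items o).length
  | 2 => (lens o).length
  | 3 => (chars o).length
  | 4 => 1
  | _ => 0

/-- The arrays: the output in its final form, and the adjacency matrix. -/
def arrsOf (E : ℕ → ℕ) (o : List Event) : ℕ → ℕ → ℕ
  | 0 => fun i => ((items o)[i]?).elim 0 fun p => if i ≤ p.1 then 0 else 1
  | 1 => fun i => ((items o)[i]?).elim 0 fun p => if i ≤ p.1 then p.2 else i - 1
  | 2 => fun i => ((items o)[i]?).elim 0 fun p => if i ≤ p.1 then 0 else p.2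
  | 3 => fun i => (lens o).getD i 0
  | 4 => fun i => (chars o).getD i 0
  | 5 => E
  | _ => fun _ => 0

theorem update_getD_append {l : List ℕ} {v : ℕ} :
    Function.update (fun i => l.getD i 0) l.length v = fun i => (l ++ [v]).getD i 0 := by
  funext i
  by_cases hi : i = l.length
  · subst hi; simp
  · rw [Function.update_of_ne hi]
    rcases Nat.lt_or_gt_of_ne hi with h | h
    · simp [List.getD, List.getElem?_append_left h]
    · rw [List.getD_eq_default _ _ (by omega), List.getD_eq_default _ _ (by simp; omega)]

theorem update_elim_append {α : Type*} {l : List α} {p : α} (f : ℕ → α → ℕ) :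
    Function.update (fun i => (l[i]?).elim 0 (f i)) l.length (f l.length p) =
      fun i => ((l ++ [p])[i]?).elim 0 (f i) := by
  funext i
  by_cases hi : i = l.length
  · subst hi; simp
  · rw [Function.update_of_ne hi]
    rcases Nat.lt_or_gt_of_ne hi with h | h
    · simp [List.getElem?_append_left h]
    · rw [List.getElem?_eq_none (by omega), List.getElem?_eq_none (by simp; omega)]

theorem update_regsOf_chr (o : List Event) (v : ℕ) :
    Function.update (regsOf o) 3 ((chars o).length + 1) = regsOf (o ++ [.chr v]) := by
  funext i
  match i with
  | 0 | 1 | 2 | 3 | 4 | i + 5 => simp [regsOf, chars, lens, items]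

theorem update_arrsOf_chr (E : ℕ → ℕ) (o : List Event) (v : ℕ) :
    Function.update (arrsOf E o) 4 (Function.update (arrsOf E o 4) (chars o).length v) =
      arrsOf E (o ++ [.chr v]) := by
  have h1 : chars (o ++ [.chr v]) = chars o ++ [v] := by simp [chars]
  have h2 : lens (o ++ [.chr v]) = lens o := by simp [lens]
  have h3 : items (o ++ [.chr v]) = items o := by simp [items]
  funext a
  match a with
  | 0 | 1 | 2 | 3 | 5 | a + 6 => simp [arrsOf, h2, h3]
  | 4 =>
    rw [Function.update_self]
    simp only [arrsOf, h1]
    exact update_getD_append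

theorem update_regsOf_len (o : List Event) (v : ℕ) :
    Function.update (regsOf o) 2 ((lens o).length + 1) = regsOf (o ++ [.len v]) := by
  funext i
  match i with
  | 0 | 1 | 2 | 3 | 4 | i + 5 => simp [regsOf, chars, lens, items]

theorem update_arrsOf_len (E : ℕ → ℕ) (o : List Event) (v : ℕ) :
    Function.update (arrsOf E o) 3 (Function.update (arrsOf E o 3) (lens o).length v) =
      arrsOf E (o ++ [.len v]) := by
  have h1 : chars (o ++ [.len v]) = chars o := by simp [chars]
  have h2 : lens (o ++ [.len v]) = lens o ++ [v] := by simp [lens]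
  have h3 : items (o ++ [.len v]) = items o := by simp [items]
  funext a
  match a with
  | 0 | 1 | 2 | 4 | 5 | a + 6 => simp [arrsOf, h1, h3]
  | 3 =>
    rw [Function.update_self]
    simp only [arrsOf, h2]
    exact update_getD_append

theorem update_regsOf_sym (o : List Event) (β x : ℕ) :
    Function.update (regsOf o) 0 ((items o).length + 1) = regsOf (o ++ [.sym β x]) := by
  funext i
  match i with
  | 0 | 1 | 2 | 3 | 4 | i + 5 => simp [regsOf, chars, lens, items]

theorem items_append_sym (o : List Event) (β x : ℕ) :
    items (o ++ [.sym β x]) = items o ++ [(β, x)] := by simp [items]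

theorem arrsOf_sym_of_ge (E : ℕ → ℕ) (o : List Event) (β x : ℕ) (a : ℕ) (ha : 3 ≤ a) :
    arrsOf E (o ++ [.sym β x]) a = arrsOf E o a := by
  have h1 : chars (o ++ [.sym β x]) = chars o := by simp [chars]
  have h2 : lens (o ++ [.sym β x]) = lens o := by simp [lens]
  match a with
  | 3 | 4 | 5 | a + 6 => simp [arrsOf, h1, h2]

/-- A nonterminal at the beginning of a chain produces a letter. -/
theorem update_arrsOf_sym_base (E : ℕ → ℕ) (o : List Event) (β x : ℕ)
    (h : (items o).length ≤ β) :
    Function.update (arrsOf E o) 1 (Function.update (arrsOf E o 1) (items o).length x) =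
      arrsOf E (o ++ [.sym β x]) := by
  have hz : ∀ f : ℕ → ℕ × ℕ → ℕ, f (items o).length (β, x) = 0 →
      (fun i => ((items o)[i]?).elim 0 (f i)) =
        fun i => ((items o ++ [(β, x)])[i]?).elim 0 (f i) := by
    intro f hf
    rw [← update_elim_append, hf]
    funext i
    by_cases hi : i = (items o).length
    · subst hi; simp
    · rw [Function.update_of_ne hi]
  funext a
  match a with
  | 0 =>
    simp only [ne_eq, zero_ne_one, not_false_eq_true, Function.update_of_ne, arrsOf,
      items_append_sym]
    exact hz (fun i p => if i ≤ p.1 then 0 else 1) (by simp [h])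
  | 1 =>
    rw [Function.update_self]
    simp only [arrsOf, items_append_sym]
    rw [← update_elim_append (fun i (p : ℕ × ℕ) => if i ≤ p.1 then p.2 else i - 1), if_pos h]
  | 2 =>
    simp only [ne_eq, OfNat.ofNat_ne_one, not_false_eq_true, Function.update_of_ne, arrsOf,
      items_append_sym]
    exact hz (fun i p => if i ≤ p.1 then 0 else p.2) (by simp [h])
  | a + 3 =>
    rw [arrsOf_sym_of_ge _ _ _ _ _ (by omega), Function.update_of_ne (by omega)]

/-- A later nonterminal of a chain produces its predecessor and a symbol. -/
theorem update_arrsOf_sym_step (E : ℕ → ℕ) (o : List Event) (β x : ℕ)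
    (h : β < (items o).length) (A : ℕ → ℕ → ℕ)
    (hA : A = Function.update (arrsOf E o) 0 (Function.update (arrsOf E o 0) (items o).length 1))
    (B : ℕ → ℕ → ℕ)
    (hB : B = Function.update A 1
      (Function.update (A 1) (items o).length ((items o).length - 1))) :
    Function.update B 2 (Function.update (B 2) (items o).length x) =
      arrsOf E (o ++ [.sym β x]) := by
  have h' : ¬ (items o).length ≤ β := by omega
  funext a
  match a with
  | 0 =>
    have : B 0 = Function.update (arrsOf E o 0) (items o).length 1 := by simp [hB, hA]
    rw [Function.update_of_ne (by norm_num), this]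
    simp only [arrsOf, items_append_sym]
    rw [← update_elim_append (fun i (p : ℕ × ℕ) => if i ≤ p.1 then 0 else 1), if_neg h']
  | 1 =>
    have : B 1 = Function.update (arrsOf E o 1) (items o).length ((items o).length - 1) := by
      simp [hB, hA]
    rw [Function.update_of_ne (by norm_num), this]
    simp only [arrsOf, items_append_sym]
    rw [← update_elim_append (fun i (p : ℕ × ℕ) => if i ≤ p.1 then p.2 else i - 1), if_neg h']
  | 2 =>
    have : B 2 = arrsOf E o 2 := by simp [hB, hA]
    rw [Function.update_self, this]
    simp only [arrsOf, items_append_sym]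
    rw [← update_elim_append (fun i (p : ℕ × ℕ) => if i ≤ p.1 then 0 else p.2), if_neg h']
  | a + 3 =>
    rw [arrsOf_sym_of_ge _ _ _ _ _ (by omega)]
    simp [hB, hA]

/-- The store between two commands: all temporary registers are zero. -/
def st (E env : ℕ → ℕ) (o : List Event) : Store :=
  layout (regsOf o) env (fun _ => 0) (arrsOf E o)

/-- Programs with output. `loop x b p` runs `p` with `x = b - 1, …, 1, 0`; `sum x b e p` runs `p`
with `x = ∑ j < b, e[x := j]`. Variables are zero outside of the commands that bind them. -/
inductive Cmd
  | skip
  | seq (p q : Cmd)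
  | chr (e : Expr)
  | len (e : Expr)
  | sym (β x : Expr)
  | ite (c : Expr) (p q : Cmd)
  | loop (x : ℕ) (b : Expr) (p : Cmd)
  | sum (x : ℕ) (b e : Expr) (p : Cmd)

namespace Cmd

/-- The output of a program. -/
def out (E : ℕ → ℕ) : Cmd → (ℕ → ℕ) → List Event
  | skip, _ => []
  | seq p q, env => p.out E env ++ q.out E env
  | chr e, env => [.chr (e.eval E env)]
  | len e, env => [.len (e.eval E env)]
  | sym β x, env => [.sym (β.eval E env) (x.eval E env)]
  | ite c p q, env => if c.eval E env ≠ 0 then p.out E env else q.out E env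
  | loop x b p, env =>
    (List.range (b.eval E env)).reverse.flatMap fun j => p.out E (Function.update env x j)
  | sum x b e p, env =>
    p.out E (Function.update env x
      (∑ j ∈ Finset.range (b.eval E env), e.eval E (Function.update env x j)))

/-- A bound for the running time of a program. -/
def time (E : ℕ → ℕ) : Cmd → (ℕ → ℕ) → ℕ
  | skip, _ => 1
  | seq p q, env => p.time E env + q.time E env
  | chr e, _ => e.cost + 3
  | len e, _ => e.cost + 3
  | sym β x, _ => β.cost + x.cost + 9
  | ite c p q, env => c.cost + 2 + if c.eval E env ≠ 0 then p.time E env else q.time E env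
  | loop x b p, env => b.cost + 3 +
    ∑ j ∈ Finset.range (b.eval E env), (p.time E (Function.update env x j) + 2)
  | sum x b e p, env => b.cost + 6 + b.eval E env * (e.cost + 4) +
    p.time E (Function.update env x
      (∑ j ∈ Finset.range (b.eval E env), e.eval E (Function.update env x j)))

/-- The translation into a program for the word RAM. -/
def compile : Cmd → Prog
  | skip => .const (tmpReg 0) 0
  | seq p q => .seq p.compile q.compile
  | chr e => .seq (e.compile 0) (.seq (.store 4 3 (tmpReg 0))
      (.seq (.op .add 3 3 4) (.const (tmpReg 0) 0)))
  | len e => .seq (e.compile 0) (.seq (.store 3 2 (tmpReg 0))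
      (.seq (.op .add 2 2 4) (.const (tmpReg 0) 0)))
  | sym β x => .seq (β.compile 0) (.seq (x.compile 1) (.seq (.op .sub (tmpReg 0) 0 (tmpReg 0))
      (.seq (.ite (tmpReg 0)
          (.seq (.store 0 0 4) (.seq (.op .sub (tmpReg 0) 0 4)
            (.seq (.store 1 0 (tmpReg 0)) (.store 2 0 (tmpReg 1)))))
          (.store 1 0 (tmpReg 1)))
        (.seq (.op .add 0 0 4) (.seq (.const (tmpReg 0) 0) (.const (tmpReg 1) 0))))))
  | ite c p q => .seq (c.compile 0) 
      (.ite (tmpReg 0) (.seq (.const (tmpReg 0) 0) p.compile) q.compile)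
  | loop x b p => .seq (b.compile 0) (.seq (.op .add (varReg x) (tmpReg 0) 1)
      (.seq (.const (tmpReg 0) 0)
        (.loop (varReg x) (.seq (.op .sub (varReg x) (varReg x) 4) p.compile))))
  | sum x b e p => .seq (b.compile 0) (.seq (.op .add (varReg x) (tmpReg 0) 1)
      (.seq (.const (tmpReg 0) 0)
        (.seq (.loop (varReg x) (.seq (.op .sub (varReg x) (varReg x) 4)
            (.seq (e.compile 1) (.seq (.op .add (tmpReg 0) (tmpReg 0) (tmpReg 1))
              (.const (tmpReg 1) 0)))))
          (.seq (.op .add (varReg x) (tmpReg 0) 1) (.seq (.const (tmpReg 0) 0)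
            (.seq p.compile (.const (varReg x) 0)))))))

/-- All expressions are tame, and a variable is bound only where all variables from it on are
unused; all variables from `d` on are unused outside. -/
def Tame : Cmd → ℕ → Prop
  | skip, _ => True
  | seq p q, d => p.Tame d ∧ q.Tame d
  | chr e, _ => e.Tame
  | len e, _ => e.Tame
  | sym β x, _ => β.Tame ∧ x.Tame
  | ite c p q, d => c.Tame ∧ p.Tame d ∧ q.Tame d
  | loop x b p, d => d ≤ x ∧ b.Tame ∧ p.Tame (x + 1)
  | sum x b e p, d => d ≤ x ∧ b.Tame ∧ e.Tame ∧ p.Tame (x + 1)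

/-- Every event takes time, so the running time bounds the counters of the output. -/
theorem length_out_le (E : ℕ → ℕ) : ∀ (p : Cmd) (env : ℕ → ℕ),
    (p.out E env).length ≤ p.time E env := by
  intro p
  induction p with
  | skip => intro env; simp [out]
  | seq p q ihp ihq =>
    intro env
    have := ihp env
    have := ihq env
    simp only [out, time, List.length_append]; omega
  | chr e => intro env; simp only [out, time, List.length_singleton]; omega
  | len e => intro env; simp only [out, time, List.length_singleton]; omega
  | sym β x => intro env; simp only [out, time, List.length_singleton]; omega
  | ite c p q ihp ihq =>
    intro env
    have := ihp env
    have := ihq env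
    simp only [out, time]
    split_ifs <;> omega
  | loop x b p ih =>
    intro env
    simp only [out, time, List.length_flatMap, List.map_reverse, List.sum_reverse]
    have h : ∀ f : ℕ → ℕ, ((List.range (b.eval E env)).map f).sum =
        ∑ j ∈ Finset.range (b.eval E env), f j := fun f => rfl
    rw [h]
    have := Finset.sum_le_sum (s := Finset.range (b.eval E env)) fun j _ =>
      (ih (Function.update env x j)).trans (Nat.le_add_right _ 2)
    omega
  | sum x b e p ih =>
    intro env
    have := ih (Function.update env x
      (∑ j ∈ Finset.range (b.eval E env), e.eval E (Function.update env x j)))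
    simp only [out, time]
    omega

theorem length_chars_le (o : List Event) : (chars o).length ≤ o.length :=
  List.length_filterMap_le _ _

theorem length_lens_le (o : List Event) : (lens o).length ≤ o.length :=
  List.length_filterMap_le _ _

theorem length_items_le (o : List Event) : (items o).length ≤ o.length :=
  List.length_filterMap_le _ _

theorem update_zero_zero (d : ℕ) :
    Function.update (fun _ : ℕ => 0) d 0 = fun _ => 0 := by
  funext j; simp [Function.update_apply]

theorem update_update_zero (d v : ℕ) :
    Function.update (Function.update (fun _ : ℕ => 0) d v) d 0 = fun _ => 0 := by
  rw [Function.update_idem, update_zero_zero]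

/-- The translation of `p` writes the output of `p` in the time that is claimed, if all variables
are at most `M ^ m` and those from `d` on are zero. The words have to hold the numbers up to `M ^ D`
and the size of the output. -/
def Sound (p : Cmd) (d m D : ℕ) : Prop :=
  ∀ M, 2 ≤ M → ∀ W, M ^ D ≤ W → ∀ (E env : ℕ → ℕ) (o : List Event), (∀ i, E i ≤ 1) →
    (∀ x, env x ≤ M ^ m) → (∀ y, d ≤ y → env y = 0) → (o ++ p.out E env).length ≤ W →
    Runs W p.compile (st E env o) (p.time E env) (st E env (o ++ p.out E env))

/-- By induction on the program, for all bounds on the variables at the same time: a variable that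
is bound by a loop or a sum is only bounded by a higher power of `M`. -/
theorem exists_sound : ∀ (p : Cmd) (d : ℕ), p.Tame d → ∀ m, ∃ D, p.Sound d m D := by
  intro p
  induction p with
  | skip =>
    intro d _ m
    refine ⟨0, fun M hM W hW E env o hE henv hd ho => Runs.const (Nat.zero_le _) ?_⟩
    rw [st, layout_setTmp, update_zero_zero]
    simp [out, st]
  | seq p q ihp ihq =>
    intro d h m
    obtain ⟨D₁, h₁⟩ := ihp d h.1 m
    obtain ⟨D₂, h₂⟩ := ihq d h.2 m
    refine ⟨D₁ + D₂, fun M hM W hW E env o hE henv hd ho => ?_⟩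
    have hle : ∀ D, D ≤ D₁ + D₂ → M ^ D ≤ W := fun D hD =>
      (Nat.pow_le_pow_right (by omega) hD).trans hW
    simp only [out, ← List.append_assoc] at ho ⊢
    exact (h₁ M hM W (hle _ (by omega)) E env o hE henv hd
      (by simp only [List.length_append] at ho ⊢; omega)).seq
      (h₂ M hM W (hle _ (by omega)) E env _ hE henv hd ho) le_rfl
  | chr e =>
    intro d h m
    obtain ⟨D, h⟩ := e.runs h m
    refine ⟨D, fun M hM W hW E env o hE henv hd ho => ?_⟩
    obtain ⟨h₁, h₂⟩ := h M hM (regsOf o) env (arrsOf E o) rfl hE henv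
    have h0 := length_chars_le o
    simp only [out, List.length_append, List.length_singleton] at ho
    refine (h₂ W hW 0 (fun _ => 0) (by simp)).seq
      ((Runs.store (i := (chars o).length) (v := e.eval E env) ?_ ?_ (h₁.trans hW)
        layout_setArr).seq
      ((Runs.op (v := (chars o).length + 1) ?_ (by omega) (layout_setReg (by norm_num))).seq
        (Runs.const (Nat.zero_le _) ?_) le_rfl) le_rfl) ?_
    · rw [layout_reg (by norm_num)]; rfl
    · rw [layout_tmpReg, Function.update_self]; rfl
    · rw [layout_reg (by norm_num), layout_reg (by norm_num)]; rfl
    · rw [layout_setTmp, update_update_zero, update_regsOf_chr o (e.eval E env),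
        update_arrsOf_chr]
      rfl
    · simp only [time]; omega
  | len e =>
    intro d h m
    obtain ⟨D, h⟩ := e.runs h m
    refine ⟨D, fun M hM W hW E env o hE henv hd ho => ?_⟩
    obtain ⟨h₁, h₂⟩ := h M hM (regsOf o) env (arrsOf E o) rfl hE henv
    have h0 := length_lens_le o
    simp only [out, List.length_append, List.length_singleton] at ho
    refine (h₂ W hW 0 (fun _ => 0) (by simp)).seq
      ((Runs.store (i := (lens o).length) (v := e.eval E env) ?_ ?_ (h₁.trans hW)
        layout_setArr).seq
      ((Runs.op (v := (lens o).length + 1) ?_ (by omega) (layout_setReg (by norm_num))).seq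
        (Runs.const (Nat.zero_le _) ?_) le_rfl) le_rfl) ?_
    · rw [layout_reg (by norm_num)]; rfl
    · rw [layout_tmpReg, Function.update_self]; rfl
    · rw [layout_reg (by norm_num), layout_reg (by norm_num)]; rfl
    · rw [layout_setTmp, update_update_zero, update_regsOf_len o (e.eval E env),
        update_arrsOf_len]
      rfl
    · simp only [time]; omega
  | sym β x =>
    intro d h m
    obtain ⟨D₁, h₁⟩ := β.runs h.1 m
    obtain ⟨D₂, h₂⟩ := x.runs h.2 m
    refine ⟨D₁ + D₂, fun M hM W hW E env o hE henv hd ho => ?_⟩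
    have hle : ∀ D, D ≤ D₁ + D₂ → M ^ D ≤ W := fun D hD =>
      (Nat.pow_le_pow_right (by omega) hD).trans hW
    obtain ⟨b₁, b₂⟩ := h₁ M hM (regsOf o) env (arrsOf E o) rfl hE henv
    obtain ⟨x₁, x₂⟩ := h₂ M hM (regsOf o) env (arrsOf E o) rfl hE henv
    have h0 := length_items_le o
    simp only [out, List.length_append, List.length_singleton] at ho ⊢
    change β.eval E env ≤ _ at b₁
    change x.eval E env ≤ _ at x₁
    have hxW : x.eval E env ≤ W := x₁.trans (hle _ (by omega))
    change ∀ W, _ → ∀ d tmp, _ → Runs W (β.compile d) _ _ (layout (regsOf o) env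
      (Function.update tmp d (β.eval E env)) (arrsOf E o)) at b₂
    change ∀ W, _ → ∀ d tmp, _ → Runs W (x.compile d) _ _ (layout (regsOf o) env
      (Function.update tmp d (x.eval E env)) (arrsOf E o)) at x₂
    generalize β.eval E env = bv at *
    generalize x.eval E env = xv at *
    set r := (items o).length with hr
    -- The branch that fills in the rule.
    have hbranch : ∃ tv, Runs W (.ite (tmpReg 0)
          (.seq (.store 0 0 4) (.seq (.op .sub (tmpReg 0) 0 4)
            (.seq (.store 1 0 (tmpReg 0)) (.store 2 0 (tmpReg 1)))))
          (.store 1 0 (tmpReg 1)))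
        (layout (regsOf o) env (Function.update (Function.update (fun _ => 0) 1 xv) 0 (r - bv))
          (arrsOf E o)) 5
        (layout (regsOf o) env (Function.update (Function.update (fun _ => 0) 1 xv) 0 tv)
          (arrsOf E (o ++ [.sym bv xv]))) := by
      by_cases hc : r ≤ bv
      · refine ⟨r - bv, Runs.ite_false (by rw [layout_tmpReg, Function.update_self]; omega)
          (Runs.store (i := r) (v := xv) ?_ ?_ hxW ?_) (by norm_num)⟩
        · rw [layout_reg (by norm_num)]; rfl
        · rw [layout_tmpReg, Function.update_of_ne (by norm_num), Function.update_self]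
        · rw [layout_setArr, update_arrsOf_sym_base E o bv xv hc]
      · refine ⟨r - 1, Runs.ite_true (by rw [layout_tmpReg, Function.update_self]; omega)
          ((Runs.store (i := r) (v := 1) ?_ ?_ (by omega) layout_setArr).seq
          ((Runs.op (v := r - 1) ?_ (by omega) layout_setTmp).seq
          ((Runs.store (i := r) (v := r - 1) ?_ ?_ (by omega) layout_setArr).seq
          (Runs.store (i := r) (v := xv) ?_ ?_ hxW (layout_setArr.trans ?_))
          le_rfl) le_rfl) le_rfl) (by norm_num)⟩
        · rw [layout_reg (by norm_num)]; rfl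
        · rw [layout_reg (by norm_num)]; rfl
        · rw [layout_reg (by norm_num), layout_reg (by norm_num)]; rfl
        · rw [layout_reg (by norm_num)]; rfl
        · rw [layout_tmpReg, Function.update_self]
        · rw [layout_reg (by norm_num)]; rfl
        · rw [layout_tmpReg, Function.update_of_ne (by norm_num),
            Function.update_of_ne (by norm_num), Function.update_self]
        · rw [update_arrsOf_sym_step E o bv xv (by omega) _ rfl _ rfl, Function.update_idem]
    obtain ⟨tv, hbranch⟩ := hbranch
    refine (b₂ W (hle _ (by omega)) 0 (fun _ => 0) (by simp)).seq
      ((x₂ W (hle _ (by omega)) 1 _ ?_).seq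
      ((Runs.op (v := r - bv) ?_ (by omega) layout_setTmp).seq
      (Runs.seq (s₂ := layout (regsOf o) env (Function.update (Function.update (fun _ => 0) 1 xv)
        0 tv) (arrsOf E (o ++ [.sym bv xv]))) (t₁ := 5) ?_
      ((Runs.op (v := r + 1) ?_ (by omega) (layout_setReg (by norm_num))).seq
      ((Runs.const (Nat.zero_le _) layout_setTmp).seq
      (Runs.const (Nat.zero_le _) ?_) le_rfl) le_rfl) le_rfl) le_rfl) le_rfl) ?_
    · intro j hj; rw [Function.update_of_ne (by omega)]
    · rw [layout_reg (by norm_num), layout_tmpReg, Function.update_of_ne (by norm_num),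
        Function.update_self]
      rfl
    · convert hbranch using 2
      funext j
      simp only [Function.update_apply]
      split_ifs <;> rfl
    · rw [layout_reg (by norm_num), layout_reg (by norm_num)]; rfl
    · rw [layout_setTmp, hr, update_regsOf_sym o bv xv, st]
      congr 1
      funext j
      simp only [Function.update_apply]
      split_ifs <;> rfl
    · simp only [time]; omega
  | ite c p q ihp ihq =>
    intro d h m
    obtain ⟨Dc, hc⟩ := c.runs h.1 m
    obtain ⟨D₁, h₁⟩ := ihp d h.2.1 m
    obtain ⟨D₂, h₂⟩ := ihq d h.2.2 m
    refine ⟨Dc + D₁ + D₂, fun M hM W hW E env o hE henv hd ho => ?_⟩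
    have hle : ∀ D, D ≤ Dc + D₁ + D₂ → M ^ D ≤ W := fun D hD =>
      (Nat.pow_le_pow_right (by omega) hD).trans hW
    obtain ⟨-, c₂⟩ := hc M hM (regsOf o) env (arrsOf E o) rfl hE henv
    have c₃ := c₂ W (hle _ (by omega)) 0 (fun _ => 0) (by simp)
    change Runs W (c.compile 0) _ _ (layout (regsOf o) env
      (Function.update _ 0 (c.eval E env)) (arrsOf E o)) at c₃
    simp only [out, time] at ho ⊢
    by_cases hv : c.eval E env = 0
    · simp only [hv, ne_eq, not_true_eq_false, if_false] at ho ⊢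
      rw [hv, update_zero_zero] at c₃
      exact c₃.seq (Runs.ite_false (layout_tmpReg 0)
        (h₂ M hM W (hle _ (by omega)) E env o hE henv hd ho) le_rfl) (by omega)
    · simp only [hv, ne_eq, not_false_eq_true, if_true] at ho ⊢
      refine c₃.seq (Runs.ite_true (by rw [layout_tmpReg, Function.update_self]; exact hv)
        ((Runs.const (Nat.zero_le _) ?_).seq
          (h₁ M hM W (hle _ (by omega)) E env o hE henv hd ho) le_rfl) le_rfl) (by omega)
      rw [layout_setTmp, update_update_zero]; rfl
  | loop x b p ih =>
    intro d h m
    obtain ⟨Db, hb⟩ := b.runs h.2.1 m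
    obtain ⟨Dp, hp⟩ := ih (x + 1) h.2.2 (m + Db)
    refine ⟨Db + Dp, fun M hM W hW E env o hE henv hd ho => ?_⟩
    have hle : ∀ D, D ≤ Db + Dp → M ^ D ≤ W := fun D hD =>
      (Nat.pow_le_pow_right (by omega) hD).trans hW
    have hmono : ∀ {D D'}, D ≤ D' → M ^ D ≤ M ^ D' := fun hD => Nat.pow_le_pow_right (by omega) hD
    obtain ⟨b₁, b₂⟩ := hb M hM (regsOf o) env (arrsOf E o) rfl hE henv
    have b₃ := b₂ W (hle _ (by omega)) 0 (fun _ => 0) (by simp)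
    change Runs W (b.compile 0) _ _ (layout (regsOf o) env
      (Function.update _ 0 (b.eval E env)) (arrsOf E o)) at b₃
    change b.eval E env ≤ _ at b₁
    simp only [out, time] at ho ⊢
    generalize b.eval E env = bv at *
    have hbW : bv ≤ W := b₁.trans (hle _ (by omega))
    set f : ℕ → List Event := fun j => p.out E (Function.update env x j) with hf
    -- The store when the variable has the value `j`.
    set S : ℕ → Store := fun j => st E (Function.update env x j)
      (o ++ (List.range' j (bv - j)).reverse.flatMap f) with hS
    have hstep : ∀ j < bv, (List.range' j (bv - j)).reverse.flatMap f =
        (List.range' (j + 1) (bv - (j + 1))).reverse.flatMap f ++ f j := by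
      intro j hj
      rw [show bv - j = (bv - (j + 1)) + 1 by omega, List.range'_succ, List.reverse_cons,
        List.flatMap_append, List.flatMap_singleton]
    have hlen : ∀ j ≤ bv, (o ++ (List.range' j (bv - j)).reverse.flatMap f).length ≤ W := by
      intro j
      induction j with
      | zero => intro _; rwa [Nat.sub_zero, ← List.range_eq_range']
      | succ j ihj =>
        intro hj
        refine le_trans ?_ (ihj (by omega))
        rw [hstep j (by omega)]
        simp only [List.length_append]; omega
    have hloop := Runs.countdown (W := W) (x := varReg x)
      (body := .seq (.op .sub (varReg x) (varReg x) 4) p.compile) S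
      (fun j => p.time E (Function.update env x j) + 1) bv
      (fun j _ => by simp only [hS, st]; rw [layout_varReg, Function.update_self]) (by
        intro j hj
        refine Runs.seq (s₂ := st E (Function.update env x j)
          (o ++ (List.range' (j + 1) (bv - (j + 1))).reverse.flatMap f)) (t₁ := 1)
          (t₂ := p.time E (Function.update env x j))
          (Runs.op (v := j) ?_ (by omega) ?_) ?_ (by omega)
        · simp only [hS, st]
          rw [layout_varReg, layout_reg (by norm_num), Function.update_self]; rfl
        · simp only [hS, st]
          rw [layout_setVar, Function.update_idem]
        · have := hp M hM W (hle _ (by omega)) E (Function.update env x j)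
            (o ++ (List.range' (j + 1) (bv - (j + 1))).reverse.flatMap f) hE ?_ ?_ ?_
          · simp only [hS]
            rw [hstep j hj, ← List.append_assoc]
            exact this
          · intro y
            by_cases hy : y = x
            · subst hy
              rw [Function.update_self]
              exact (le_trans (by omega) b₁).trans (hmono (by omega))
            · rw [Function.update_of_ne hy]
              exact (henv y).trans (hmono (by omega))
          · intro y hy
            rw [Function.update_of_ne (by omega)]
            exact hd y (by have := h.1; omega)
          · rw [List.append_assoc, ← hstep j hj]
            exact hlen j hj.le)
    have hS0 : S 0 = st E env (o ++ (List.range bv).reverse.flatMap f) := by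
      simp only [hS]
      rw [Nat.sub_zero, ← List.range_eq_range', show Function.update env x 0 = env from
        Function.update_eq_self_iff.2 (hd x h.1).symm]
    rw [← hS0]
    refine b₃.seq ((Runs.op (v := bv) ?_ hbW layout_setVar).seq
      ((Runs.const (Nat.zero_le _) ?_).seq hloop le_rfl) le_rfl) ?_
    · rw [layout_tmpReg, layout_reg (by norm_num), Function.update_self]; rfl
    · rw [layout_setTmp, update_update_zero]; simp [hS, st]
    · have : ∀ j, p.time E (Function.update env x j) + 1 + 1 =
          p.time E (Function.update env x j) + 2 := fun j => rfl
      simp only [this]; omega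
  | sum x b e p ih =>
    intro d h m
    obtain ⟨Db, hb⟩ := b.runs h.2.1 m
    obtain ⟨De, he⟩ := e.runs h.2.2.1 (m + Db)
    obtain ⟨Dp, hp⟩ := ih (x + 1) h.2.2.2 (m + (Db + De))
    refine ⟨Db + De + Dp, fun M hM W hW E env o hE henv hd ho => ?_⟩
    have hle : ∀ D, D ≤ Db + De + Dp → M ^ D ≤ W := fun D hD =>
      (Nat.pow_le_pow_right (by omega) hD).trans hW
    have hmono : ∀ {D D'}, D ≤ D' → M ^ D ≤ M ^ D' := fun hD => Nat.pow_le_pow_right (by omega) hD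
    obtain ⟨b₁, b₂⟩ := hb M hM (regsOf o) env (arrsOf E o) rfl hE henv
    have b₃ := b₂ W (hle _ (by omega)) 0 (fun _ => 0) (by simp)
    change Runs W (b.compile 0) _ _ (layout (regsOf o) env
      (Function.update _ 0 (b.eval E env)) (arrsOf E o)) at b₃
    change b.eval E env ≤ _ at b₁
    simp only [out, time] at ho ⊢
    generalize b.eval E env = bv at *
    have hbW : bv ≤ W := b₁.trans (hle _ (by omega))
    set g : ℕ → ℕ := fun j => e.eval E (Function.update env x j) with hg
    have he' := fun j (hj : j < bv) => he M hM (regsOf o) (Function.update env x j) (arrsOf E o)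
      rfl hE (by
        intro y
        by_cases hy : y = x
        · subst hy
          rw [Function.update_self]
          exact (le_trans (by omega) b₁).trans (hmono (by omega))
        · rw [Function.update_of_ne hy]
          exact (henv y).trans (hmono (by omega)))
    have hsum : ∑ j ∈ Finset.range bv, g j ≤ M ^ (Db + De) := by
      refine (Finset.sum_le_card_nsmul _ _ (M ^ De) fun j hj =>
        (he' j (Finset.mem_range.1 hj)).1).trans ?_
      rw [Finset.card_range, smul_eq_mul, pow_add]
      exact Nat.mul_le_mul_right _ b₁
    have hIco : ∀ j < bv, ∑ i ∈ Finset.Ico j bv, g i = ∑ i ∈ Finset.Ico (j + 1) bv, g i + g j :=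
      fun j hj => by rw [Finset.sum_eq_sum_Ico_succ_bot hj, add_comm]
    have hpart : ∀ j, ∑ i ∈ Finset.Ico j bv, g i ≤ M ^ (Db + De) := fun j => by
      refine (Finset.sum_le_sum_of_subset ?_).trans hsum
      intro i hi
      exact Finset.mem_range.2 (Finset.mem_Ico.1 hi).2
    set S : ℕ → Store := fun j => layout (regsOf o) (Function.update env x j)
      (Function.update (fun _ => 0) 0 (∑ i ∈ Finset.Ico j bv, g i)) (arrsOf E o) with hS
    have hloop := Runs.countdown (W := W) (x := varReg x)
      (body := .seq (.op .sub (varReg x) (varReg x) 4)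
            (.seq (e.compile 1) (.seq (.op .add (tmpReg 0) (tmpReg 0) (tmpReg 1))
              (.const (tmpReg 1) 0)))) S
      (fun j => e.cost + 3) bv
      (fun j _ => by simp only [hS]; rw [layout_varReg, Function.update_self]) (by
        intro j hj
        refine Runs.seq (s₂ := layout (regsOf o) (Function.update env x j)
            (Function.update (fun _ => 0) 0 (∑ i ∈ Finset.Ico (j + 1) bv, g i)) (arrsOf E o))
          (Runs.op (v := j) ?_ (by omega) ?_)
          (((he' j hj).2 W (hle _ (by omega)) 1 _ ?_).seq
            ((Runs.op (v := ∑ i ∈ Finset.Ico j bv, g i) ?_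
              ((hpart j).trans (hle _ (by omega))) layout_setTmp).seq
            (Runs.const (Nat.zero_le _) ?_) le_rfl) le_rfl) (by omega)
        · simp only [hS]
          rw [layout_varReg, layout_reg (by norm_num), Function.update_self]; rfl
        · simp only [hS]
          rw [layout_setVar, Function.update_idem]
        · intro i hi; rw [Function.update_of_ne (by omega)]
        · rw [layout_tmpReg, layout_tmpReg, Function.update_of_ne (by norm_num),
            Function.update_self, Function.update_self, hIco j hj]
          rfl
        · rw [layout_setTmp]
          simp only [hS]
          congr 1
          funext i
          simp only [Function.update_apply]
          split_ifs <;> first | rfl | omega)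
    have hvW : ∑ j ∈ Finset.range bv, g j ≤ W := hsum.trans (hle _ (by omega))
    generalize hv : ∑ j ∈ Finset.range bv, g j = v at *
    have hS0 : S 0 = layout (regsOf o) (Function.update env x 0)
        (Function.update (fun _ => 0) 0 v) (arrsOf E o) := by
      simp only [hS]; rw [← hv, Finset.range_eq_Ico]
    rw [hS0] at hloop
    have hp' := hp M hM W (hle _ (by omega)) E (Function.update env x v) o hE (by
        intro y
        by_cases hy : y = x
        · subst hy
          rw [Function.update_self]
          exact hsum.trans (hmono (by omega))
        · rw [Function.update_of_ne hy]
          exact (henv y).trans (hmono (by omega)))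
      (fun y hy => by
        rw [Function.update_of_ne (by omega)]
        exact hd y (by have := h.1; omega)) ho
    refine b₃.seq ((Runs.op (v := bv) ?_ hbW layout_setVar).seq
      ((Runs.const (Nat.zero_le _) ?_).seq (hloop.seq ((Runs.op (v := v) ?_ hvW layout_setVar).seq
        ((Runs.const (Nat.zero_le _) ?_).seq (hp'.seq (Runs.const (Nat.zero_le _) ?_) le_rfl)
        le_rfl) le_rfl) le_rfl) le_rfl) le_rfl) ?_
    · rw [layout_tmpReg, layout_reg (by norm_num), Function.update_self]; rfl
    · rw [layout_setTmp, update_update_zero]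
      simp [hS]
    · rw [layout_tmpReg, layout_reg (by norm_num), Function.update_self]; rfl
    · rw [layout_setTmp, update_update_zero, Function.update_idem]; rfl
    · rw [st, layout_setVar, Function.update_idem, show Function.update env x 0 = env from
        Function.update_eq_self_iff.2 (hd x h.1).symm]
      rfl
    · simp only [Finset.sum_const, Finset.card_range, smul_eq_mul]
      rw [show e.cost + 3 + 1 = e.cost + 4 from rfl]
      omega

end Cmd

/-! ### Cliques as numbers -/

section Tuples

variable {n : ℕ}

/-- The adjacency matrix of a graph, row by row. -/
def adjFun (G : SimpleGraph (Fin n)) (i : ℕ) : ℕ :=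
  if ∃ u v : Fin n, i = u * n + v ∧ G.Adj u v then 1 else 0

theorem adjFun_le_one (G : SimpleGraph (Fin n)) (i : ℕ) : adjFun G i ≤ 1 := by
  rw [adjFun]; split_ifs <;> omega

theorem adjFun_ne_zero (G : SimpleGraph (Fin n)) (u v : Fin n) :
    adjFun G (u * n + v) ≠ 0 ↔ G.Adj u v := by
  have hn : 0 < n := u.pos
  rw [adjFun]
  constructor
  · intro h
    split_ifs at h with h'
    · obtain ⟨u', v', h1, h2⟩ := h'
      have h3 : (u : ℕ) = u' := by
        have := congrArg (· / n) h1
        simpa [mul_comm _ n, Nat.mul_add_div hn, Nat.div_eq_of_lt v.2,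
          Nat.div_eq_of_lt v'.2] using this
      have h4 : (v : ℕ) = v' := by rw [h3] at h1; omega
      rwa [Fin.ext h3, Fin.ext h4]
    · exact absurd rfl h
  · intro h
    rw [if_pos ⟨u, v, rfl, h⟩]
    norm_num

theorem adjFun_of_ge (G : SimpleGraph (Fin n)) {i : ℕ} (h : n * n ≤ i) : adjFun G i = 0 := by
  rw [adjFun, if_neg]
  rintro ⟨u, v, rfl, -⟩
  have h1 : (u : ℕ) + 1 ≤ n := u.2
  have h2 := Nat.mul_le_mul_right n h1
  have := v.2
  rw [add_mul] at h2
  omega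

/-- The digit `i` of `b` in base `n`. -/
def digit (n b i : ℕ) : ℕ := b / n ^ i % n

/-- The last `m` digits of `b` in base `n` increase and form a clique. -/
def IsCliqueIndex (G : SimpleGraph (Fin n)) (m b : ℕ) : Prop :=
  ∀ j < m, ∀ i < j, digit n b i < digit n b j ∧ adjFun G (digit n b i * n + digit n b j) ≠ 0

/-- The tuple of the last `m` digits of `b` in base `n`. -/
def digitTuple (hn : 0 < n) (m b : ℕ) (i : Fin m) : Fin n := ⟨digit n b i, Nat.mod_lt _ hn⟩

/-- The set of the last `m` digits of `b` in base `n`. -/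
def digitSet (hn : 0 < n) (m b : ℕ) : Finset (Fin n) := Finset.univ.image (digitTuple hn m b)

theorem isCliqueIndex_iff (G : SimpleGraph (Fin n)) (hn : 0 < n) {m b : ℕ} :
    IsCliqueIndex G m b ↔ ∀ i j : Fin m, i < j →
      digitTuple hn m b i < digitTuple hn m b j ∧
        G.Adj (digitTuple hn m b i) (digitTuple hn m b j) := by
  constructor
  · intro h i j hij
    obtain ⟨h1, h2⟩ := h j j.2 i hij
    exact ⟨h1, (adjFun_ne_zero G _ _).1 h2⟩
  · intro h j hj i hi
    obtain ⟨h1, h2⟩ := h ⟨i, hi.trans hj⟩ ⟨j, hj⟩ hi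
    exact ⟨h1, (adjFun_ne_zero G _ _).2 h2⟩

theorem digitTuple_eq (hn : 0 < n) {m b : ℕ} (hb : b < n ^ m) :
    digitTuple hn m b = finFunctionFinEquiv.symm ⟨b, hb⟩ := rfl

theorem IsCliqueIndex.strictMono {G : SimpleGraph (Fin n)} {m b : ℕ} (h : IsCliqueIndex G m b)
    (hn : 0 < n) : StrictMono (digitTuple hn m b) :=
  fun i j hij => ((isCliqueIndex_iff G hn).1 h i j hij).1

theorem IsCliqueIndex.isNClique {G : SimpleGraph (Fin n)} {m b : ℕ} (h : IsCliqueIndex G m b)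
    (hn : 0 < n) : G.IsNClique m (digitSet hn m b) := by
  have hinj := (h.strictMono hn).injective
  rw [SimpleGraph.isNClique_iff, digitSet, Finset.card_image_of_injective _ hinj,
    Finset.card_univ, Fintype.card_fin]
  refine ⟨?_, rfl⟩
  intro x hx y hy hxy
  simp only [Finset.coe_image, Finset.coe_univ, Set.image_univ, Set.mem_range] at hx hy
  obtain ⟨i, rfl⟩ := hx
  obtain ⟨j, rfl⟩ := hy
  rcases lt_trichotomy i j with hij | rfl | hij
  · exact ((isCliqueIndex_iff G hn).1 h i j hij).2
  · exact absurd rfl hxy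
  · exact ((isCliqueIndex_iff G hn).1 h j i hij).2.symm

theorem exists_cliqueIndex {G : SimpleGraph (Fin n)} {m : ℕ} (hn : 0 < n) {S : Finset (Fin n)}
    (hS : G.IsNClique m S) : ∃ b < n ^ m, IsCliqueIndex G m b ∧ digitSet hn m b = S := by
  have hc := hS.card_eq
  set f : Fin m → Fin n := fun i => S.orderEmbOfFin hc i with hf
  have hb := (finFunctionFinEquiv f).2
  have ht : digitTuple hn m (finFunctionFinEquiv f : Fin (n ^ m)) = f := by
    rw [digitTuple_eq hn hb]
    exact finFunctionFinEquiv.symm_apply_apply f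
  refine ⟨(finFunctionFinEquiv f : Fin (n ^ m)), hb, ?_, ?_⟩
  · rw [isCliqueIndex_iff G hn, ht]
    intro i j hij
    have hlt : f i < f j := (S.orderEmbOfFin hc).strictMono hij
    exact ⟨hlt, hS.1 (S.orderEmbOfFin_mem hc i) (S.orderEmbOfFin_mem hc j) hlt.ne⟩
  · rw [digitSet, ht]
    ext x
    simp [hf]

theorem digitSet_injOn {G : SimpleGraph (Fin n)} {m : ℕ} (hn : 0 < n) {b b' : ℕ}
    (hb : b < n ^ m) (hb' : b' < n ^ m) (h : IsCliqueIndex G m b) (h' : IsCliqueIndex G m b')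
    (hS : digitSet hn m b = digitSet hn m b') : b = b' := by
  have key : ∀ c, IsCliqueIndex G m c → digitSet hn m c = digitSet hn m b →
      digitTuple hn m c = (digitSet hn m b).orderEmbOfFin (h.isNClique hn).card_eq :=
    fun c hc hcS => Finset.orderEmbOfFin_unique _ (fun i => by
      rw [← hcS]; exact Finset.mem_image_of_mem _ (Finset.mem_univ i)) (hc.strictMono hn)
  have h1 := (key b h rfl).trans (key b' h' hS.symm).symm
  rw [digitTuple_eq hn hb, digitTuple_eq hn hb'] at h1
  exact congrArg Fin.val (finFunctionFinEquiv.symm.injective h1)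

/-- The number of a `k`-clique: one plus the number whose digits are its vertices. -/
def cliqueNumber (G : SimpleGraph (Fin n)) (hn : 0 < n) (k : ℕ) (S : Finset (Fin n)) : ℕ :=
  if h : G.IsNClique k S then (exists_cliqueIndex hn h).choose + 1 else 0

theorem cliqueNumber_digitSet {G : SimpleGraph (Fin n)} {hn : 0 < n} {k b : ℕ} (hb : b < n ^ k)
    (h : IsCliqueIndex G k b) : cliqueNumber G hn k (digitSet hn k b) = b + 1 := by
  rw [cliqueNumber, dif_pos (h.isNClique hn)]
  obtain ⟨h1, h2, h3⟩ := (exists_cliqueIndex hn (h.isNClique hn)).choose_spec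
  rw [digitSet_injOn hn h1 hb h2 h h3]

theorem isCliqueNumbering_cliqueNumber (G : SimpleGraph (Fin n)) (hn : 0 < n) (k : ℕ) :
    IsCliqueNumbering G k (cliqueNumber G hn k) := by
  constructor
  · intro B hB
    obtain ⟨b, hb, h, rfl⟩ := exists_cliqueIndex hn hB
    rw [cliqueNumber_digitSet hb h, Finset.mem_Icc]
    omega
  · intro B hB C hC hBC
    obtain ⟨b, hb, h, rfl⟩ := exists_cliqueIndex hn hB
    obtain ⟨c, hc, h', rfl⟩ := exists_cliqueIndex hn hC
    rw [cliqueNumber_digitSet hb h, cliqueNumber_digitSet hc h'] at hBC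
    rw [show b = c by omega]

/-- The indices of cliques, in decreasing order. -/
def cliqueIndices (G : SimpleGraph (Fin n)) (m : ℕ) : List ℕ :=
  (List.range (n ^ m)).reverse.filter fun b => IsCliqueIndex G m b

/-- The list of the vertices of the `2k`-cliques. -/
def cliqueLists (G : SimpleGraph (Fin n)) (hn : 0 < n) (k : ℕ) : List (List (Fin n)) :=
  (cliqueIndices G (2 * k)).map fun b => List.ofFn (digitTuple hn (2 * k) b)

theorem mem_cliqueIndices {G : SimpleGraph (Fin n)} {m b : ℕ} :
    b ∈ cliqueIndices G m ↔ b < n ^ m ∧ IsCliqueIndex G m b := by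
  simp [cliqueIndices]

theorem nodup_cliqueIndices (G : SimpleGraph (Fin n)) (m : ℕ) : (cliqueIndices G m).Nodup :=
  (List.nodup_reverse.2 List.nodup_range).filter _

theorem toFinset_ofFn_digitTuple (hn : 0 < n) (m b : ℕ) :
    (List.ofFn (digitTuple hn m b)).toFinset = digitSet hn m b := by
  ext x
  simp [digitSet, List.mem_ofFn]

theorem isCliqueList_cliqueLists (G : SimpleGraph (Fin n)) (hn : 0 < n) (k : ℕ) :
    IsCliqueList G k (cliqueLists G hn k) := by
  have hmap : (cliqueLists G hn k).map List.toFinset =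
      (cliqueIndices G (2 * k)).map (digitSet hn (2 * k)) := by
    rw [cliqueLists, List.map_map]
    exact List.map_congr_left fun b _ => toFinset_ofFn_digitTuple hn _ b
  refine ⟨?_, ?_, ?_⟩
  · intro A hA
    obtain ⟨b, hb, rfl⟩ := List.mem_map.1 hA
    exact List.nodup_ofFn.2 ((mem_cliqueIndices.1 hb).2.strictMono hn).injective
  · rw [hmap]
    refine (nodup_cliqueIndices G (2 * k)).map_on fun b hb c hc h => ?_
    obtain ⟨hb, hb'⟩ := mem_cliqueIndices.1 hb
    obtain ⟨hc, hc'⟩ := mem_cliqueIndices.1 hc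
    exact digitSet_injOn hn hb hc hb' hc' h
  · intro S
    rw [hmap, List.mem_map]
    constructor
    · rintro ⟨b, hb, rfl⟩
      exact (mem_cliqueIndices.1 hb).2.isNClique hn
    · intro hS
      obtain ⟨b, hb, h, rfl⟩ := exists_cliqueIndex hn hS
      exact ⟨b, mem_cliqueIndices.2 ⟨hb, h⟩, rfl⟩

end Tuples

/-! ### Expressions for cliques -/

namespace Expr

/-- The power `n ^ i`; variable `0` holds `n`. -/
def npow : ℕ → Expr
  | 0 => const 1
  | i + 1 => op .mul (npow i) (var 0)

/-- The digit `i` of `e` in base `n`. -/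
def digit (e : Expr) (i : ℕ) : Expr := op .mod (op .div e (npow i)) (var 0)

/-- The product of a list of expressions; it is nonzero if all factors are. -/
def all (l : List Expr) : Expr := l.foldr (op .mul) (const 1)

/-- The entry of the adjacency matrix for two vertices. -/
def adjacent (u v : Expr) : Expr := adj (op .add (op .mul u (var 0)) v)

/-- An expression that is nonzero if the last `m` digits of `e` increase and form a clique. -/
def isClique (m : ℕ) (e : Expr) : Expr :=
  all ((List.range m).flatMap fun j => (List.range j).map fun i =>
    op .mul (op .sub (e.digit j) (e.digit i)) (adjacent (e.digit i) (e.digit j)))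

/-- An expression that is nonzero if the vertex `v` is adjacent to the last `k` digits of `e`. -/
def joinsVertex (k : ℕ) (e v : Expr) : Expr :=
  all ((List.range k).map fun i => adjacent v (e.digit i))

/-- An expression that is nonzero if the last `k` digits of `e` are adjacent to those of `f`. -/
def joins (k : ℕ) (e f : Expr) : Expr :=
  all ((List.range k).flatMap fun i => (List.range k).map fun j =>
    adjacent (e.digit i) (f.digit j))

variable {E env : ℕ → ℕ} {n : ℕ}

theorem eval_npow (h : env 0 = n) (i : ℕ) : (npow i).eval E env = n ^ i := by
  induction i with
  | zero => rfl
  | succ i ih => simp only [npow, eval, Op.eval, ih, h, pow_succ]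

theorem eval_digit (h : env 0 = n) (e : Expr) (i : ℕ) :
    (e.digit i).eval E env = WordBreak.digit n (e.eval E env) i := by
  simp only [digit, eval, Op.eval, eval_npow h, h, WordBreak.digit]

theorem eval_all_ne_zero (l : List Expr) :
    (all l).eval E env ≠ 0 ↔ ∀ e ∈ l, e.eval E env ≠ 0 := by
  induction l with
  | nil => simp [all, eval]
  | cons e l ih =>
    have : (all (e :: l)).eval E env = e.eval E env * (all l).eval E env := rfl
    rw [this, mul_ne_zero_iff, ih]
    simp

theorem eval_adjacent (h : env 0 = n) (u v : Expr) :
    (adjacent u v).eval E env = E (u.eval E env * n + v.eval E env) := by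
  simp only [adjacent, eval, Op.eval, h]

theorem eval_isClique {G : SimpleGraph (Fin n)} (h : env 0 = n) (m : ℕ) (e : Expr) :
    (isClique m e).eval (adjFun G) env ≠ 0 ↔ IsCliqueIndex G m (e.eval (adjFun G) env) := by
  simp only [isClique, eval_all_ne_zero, List.mem_flatMap, List.mem_map, List.mem_range,
    IsCliqueIndex]
  constructor
  · intro H j hj i hi
    have := H _ ⟨j, hj, i, hi, rfl⟩
    simp only [eval, Op.eval, eval_adjacent h, eval_digit h, mul_ne_zero_iff] at this
    exact ⟨by omega, this.2⟩
  · rintro H _ ⟨j, hj, i, hi, rfl⟩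
    simp only [eval, Op.eval, eval_adjacent h, eval_digit h, mul_ne_zero_iff]
    exact ⟨by have := (H j hj i hi).1; omega, (H j hj i hi).2⟩

theorem eval_joinsVertex (h : env 0 = n) (k : ℕ) (e v : Expr) :
    (joinsVertex k e v).eval E env ≠ 0 ↔ ∀ i < k,
      E (v.eval E env * n + WordBreak.digit n (e.eval E env) i) ≠ 0 := by
  simp only [joinsVertex, eval_all_ne_zero, List.mem_map, List.mem_range,
    forall_exists_index, and_imp, forall_apply_eq_imp_iff₂, eval_adjacent h, eval_digit h]

theorem eval_joins (h : env 0 = n) (k : ℕ) (e f : Expr) :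
    (joins k e f).eval E env ≠ 0 ↔ ∀ i < k, ∀ j < k,
      E (WordBreak.digit n (e.eval E env) i * n + WordBreak.digit n (f.eval E env) j) ≠ 0 := by
  simp only [joins, eval_all_ne_zero, List.mem_flatMap, List.mem_map, List.mem_range]
  constructor
  · intro H i hi j hj
    have := H _ ⟨i, hi, j, hj, rfl⟩
    rwa [eval_adjacent h, eval_digit h, eval_digit h] at this
  · rintro H _ ⟨i, hi, j, hj, rfl⟩
    rw [eval_adjacent h, eval_digit h, eval_digit h]
    exact H i hi j hj

theorem tame_add (x y : ℕ) : Op.add.eval x y ≤ (x + 1) * (y + 1) := by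
  simp only [Op.eval]; nlinarith

theorem tame_sub (x y : ℕ) : Op.sub.eval x y ≤ (x + 1) * (y + 1) :=
  (Nat.sub_le x y).trans (by nlinarith)

theorem tame_mul (x y : ℕ) : Op.mul.eval x y ≤ (x + 1) * (y + 1) := by
  simp only [Op.eval]; nlinarith

theorem tame_div (x y : ℕ) : Op.div.eval x y ≤ (x + 1) * (y + 1) :=
  (Nat.div_le_self x y).trans (by nlinarith)

theorem tame_mod (x y : ℕ) : Op.mod.eval x y ≤ (x + 1) * (y + 1) :=
  (Nat.mod_le x y).trans (by nlinarith)

theorem tame_shr (x y : ℕ) : Op.shr.eval x y ≤ (x + 1) * (y + 1) := by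
  simp only [Op.eval, Nat.shiftRight_eq_div_pow]
  exact (Nat.div_le_self x _).trans (by nlinarith)

theorem tame_npow : ∀ i, (npow i).Tame
  | 0 => trivial
  | i + 1 => ⟨tame_mul, tame_npow i, trivial⟩

theorem Tame.digit {e : Expr} (he : e.Tame) (i : ℕ) : (e.digit i).Tame :=
  ⟨tame_mod, ⟨tame_div, he, tame_npow i⟩, trivial⟩

theorem Tame.adjacent {u v : Expr} (hu : u.Tame) (hv : v.Tame) : (adjacent u v).Tame :=
  ⟨tame_add, ⟨tame_mul, hu, trivial⟩, hv⟩

theorem tame_all {l : List Expr} (h : ∀ e ∈ l, e.Tame) : (all l).Tame := by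
  induction l with
  | nil => trivial
  | cons e l ih => exact ⟨tame_mul, h e (by simp), ih fun f hf => h f (by simp [hf])⟩

theorem Tame.isClique {e : Expr} (he : e.Tame) (m : ℕ) : (isClique m e).Tame := by
  refine tame_all fun f hf => ?_
  simp only [List.mem_flatMap, List.mem_map] at hf
  obtain ⟨j, -, i, -, rfl⟩ := hf
  exact ⟨tame_mul, ⟨tame_sub, he.digit j, he.digit i⟩, (he.digit i).adjacent (he.digit j)⟩

theorem Tame.joinsVertex {e v : Expr} (he : e.Tame) (hv : v.Tame) (k : ℕ) :
    (joinsVertex k e v).Tame := by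
  refine tame_all fun f hf => ?_
  obtain ⟨i, -, rfl⟩ := List.mem_map.1 hf
  exact hv.adjacent (he.digit i)

theorem Tame.joins {e f : Expr} (he : e.Tame) (hf : f.Tame) (k : ℕ) : (joins k e f).Tame := by
  refine tame_all fun g hg => ?_
  simp only [List.mem_flatMap, List.mem_map] at hg
  obtain ⟨i, -, j, -, rfl⟩ := hg
  exact (he.digit i).adjacent (hf.digit j)

end Expr

/-! ### The program that writes the dictionary -/

/-- The last `L` binary digits of `c`, most significant digit first. -/
def bits (L c : ℕ) : List ℕ := (List.range L).reverse.map fun j => (c >>> j) % 2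

/-- The binary block of a letter. -/
def blockCode (L : ℕ) (x : Letter) : List ℕ := bits L (letterIndex x)

/-- The output for a word of the dictionary, without its length. -/
def encodeEvents (L : ℕ) (w : List Letter) : List Event := (w.flatMap (blockCode L)).map .chr

/-- The output for a word of the dictionary. -/
def wordEvents (L : ℕ) (w : List Letter) : List Event := encodeEvents L w ++ [.len (w.length * L)]

theorem encodeEvents_append (L : ℕ) (v w : List Letter) :
    encodeEvents L (v ++ w) = encodeEvents L v ++ encodeEvents L w := by
  simp [encodeEvents]

/-- Variable `0` holds `n`, variable `1` holds `n ^ k`, and variable `2` holds the length of the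
blocks. -/
structure Ctx (n k L : ℕ) (env : ℕ → ℕ) : Prop where
  zero : env 0 = n
  one : env 1 = n ^ k
  two : env 2 = L

theorem Ctx.update {n k L : ℕ} {env : ℕ → ℕ} (h : Ctx n k L env) {x : ℕ} (hx : 3 ≤ x) (v : ℕ) :
    Ctx n k L (Function.update env x v) := by
  constructor
  · rw [Function.update_of_ne (by omega), h.zero]
  · rw [Function.update_of_ne (by omega), h.one]
  · rw [Function.update_of_ne (by omega), h.two]

namespace Cmd

open WordBreak.Expr (const var op)

/-- Run a list of programs one after the other. -/
def seqs (l : List Cmd) : Cmd := l.foldr seq skip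

theorem out_seqs (E env : ℕ → ℕ) (l : List Cmd) :
    (seqs l).out E env = l.flatMap fun p => p.out E env := by
  induction l with
  | nil => rfl
  | cons p l ih => rw [List.flatMap_cons, ← ih]; rfl

theorem tame_seqs {l : List Cmd} {d : ℕ} (h : ∀ p ∈ l, p.Tame d) : (seqs l).Tame d := by
  induction l with
  | nil => trivial
  | cons p l ih => exact ⟨h p (by simp), ih fun q hq => h q (by simp [hq])⟩

/-- Write the binary block of the letter with index `e`, where `emit` writes a single bit. -/
def letter (emit : Expr → Cmd) (e : Expr) : Cmd :=
  loop 9 (var 2) (emit (op .mod (op .shr e (var 9)) (const 2)))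

theorem out_letter {E env : ℕ → ℕ} {L c : ℕ} (hL : env 2 = L) (emit : Expr → Cmd)
    (ev : ℕ → Event) (hemit : ∀ j e, (emit e).out E (Function.update env 9 j) =
      [ev (e.eval E (Function.update env 9 j))])
    (e : Expr) (he : ∀ j, e.eval E (Function.update env 9 j) = c) :
    (letter emit e).out E env = (bits L c).map ev := by
  simp only [letter, out, hemit, Expr.eval, Op.eval, he, Function.update_self, hL, bits,
    List.map_map]
  rw [List.flatMap_def]
  generalize (List.range L).reverse = l
  induction l with
  | nil => rfl
  | cons a l ih => simp only [List.map_cons, List.flatten_cons, ih]; rfl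

/-- Write the blocks of a letter, of `β`, and of `α`. -/
def spreadLetter (e : Expr) : Cmd :=
  seqs [letter chr e, letter chr (const 5), letter chr (const 0)]

theorem out_letter_chr {E env : ℕ → ℕ} {n k L : ℕ} (hc : Ctx n k L env) (x : Letter) (e : Expr)
    (he : ∀ j, e.eval E (Function.update env 9 j) = letterIndex x) :
    (letter chr e).out E env = encodeEvents L [x] := by
  rw [out_letter hc.two chr .chr (fun j e => rfl) e he]
  simp [encodeEvents, blockCode]

theorem out_spreadLetter {E env : ℕ → ℕ} {n k L : ℕ} (hc : Ctx n k L env) (x : Letter) (e : Expr)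
    (he : ∀ j, e.eval E (Function.update env 9 j) = letterIndex x) :
    (spreadLetter e).out E env = encodeEvents L (f₁ [x]) := by
  rw [spreadLetter, out_seqs]
  simp only [List.flatMap_cons, List.flatMap_nil, out_letter_chr hc x e he,
    out_letter_chr hc be (const 5) (fun _ => rfl), out_letter_chr hc al (const 0) (fun _ => rfl),
    List.append_nil]
  rw [← encodeEvents_append, ← encodeEvents_append]
  rfl

/-- Write the blocks of `f₁ (1 ⋯ b)`, where variable `x` holds `b`. -/
def spreadBelow (x : ℕ) : Cmd :=
  loop 7 (var x) (spreadLetter (op .add (op .sub (var x) (var 7)) (const 5)))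

/-- Write the blocks of `f₁ ((b + 1) ⋯ N)`, where variable `x` holds `b`. -/
def spreadAbove (x : ℕ) : Cmd :=
  loop 7 (op .sub (var 1) (var x)) (spreadLetter (op .add (op .sub (var 1) (var 7)) (const 5)))

theorem map_reverse_range_sub (s c : ℕ) :
    (List.range c).reverse.map (fun j => s + c - j) = List.range' (s + 1) c := by
  apply List.ext_getElem
  · simp
  · intro i h1 h2
    simp only [List.length_map, List.length_reverse, List.length_range] at h1
    simp only [List.getElem_map, List.getElem_reverse, List.length_range, List.getElem_range,
      List.getElem_range']
    omega

theorem flatMap_encodeEvents_f₁ (L : ℕ) (l : List ℕ) (g : ℕ → ℕ) :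
    (l.flatMap fun j => encodeEvents L (f₁ [num (g j)])) =
      encodeEvents L (f₁ ((l.map g).map num)) := by
  induction l with
  | nil => rfl
  | cons a l ih =>
    rw [List.flatMap_cons, ih, ← encodeEvents_append, ← f₁_append]
    rfl

theorem flatMap_congr_mem {α β : Type*} {l : List α} {f g : α → List β}
    (h : ∀ x ∈ l, f x = g x) : l.flatMap f = l.flatMap g := by
  rw [List.flatMap_def, List.flatMap_def, List.map_congr_left h]

theorem out_spreadBelow {E env : ℕ → ℕ} {n k L : ℕ} (hc : Ctx n k L env) {x b : ℕ} (hx : x < 7)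
    (hb : env x = b) : (spreadBelow x).out E env = encodeEvents L (f₁ (below (b + 1))) := by
  have h : ∀ j ∈ (List.range b).reverse, (spreadLetter (op .add (op .sub (var x) (var 7))
      (const 5))).out E (Function.update env 7 j) = encodeEvents L (f₁ [num (0 + b - j)]) := by
    intro j hj
    refine out_spreadLetter (hc.update (by norm_num) j) _ _ fun i => ?_
    simp only [Expr.eval, Op.eval, Function.update_of_ne (show x ≠ 9 by omega),
      Function.update_of_ne (show x ≠ 7 by omega), hb, letterIndex,
      Function.update_of_ne (show 7 ≠ 9 by omega), Function.update_self]
    omega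
  simp only [spreadBelow, out, Expr.eval, hb]
  rw [flatMap_congr_mem h, flatMap_encodeEvents_f₁, map_reverse_range_sub]
  rfl

theorem out_spreadAbove {E env : ℕ → ℕ} {n k L : ℕ} (hc : Ctx n k L env) {x b : ℕ}
    (hb : env x = b) (hbN : b ≤ n ^ k) :
    (spreadAbove x).out E env = encodeEvents L (f₁ (above (n ^ k) (b + 1))) := by
  have h : ∀ j ∈ (List.range (n ^ k - b)).reverse, (spreadLetter (op .add (op .sub (var 1)
      (var 7)) (const 5))).out E (Function.update env 7 j) =
      encodeEvents L (f₁ [num (b + (n ^ k - b) - j)]) := by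
    intro j hj
    refine out_spreadLetter (hc.update (by norm_num) j) _ _ fun i => ?_
    simp only [Expr.eval, Op.eval, Function.update_of_ne (show 1 ≠ 9 by omega),
      Function.update_of_ne (show 1 ≠ 7 by omega), hc.one, letterIndex,
      Function.update_of_ne (show 7 ≠ 9 by omega), Function.update_self]
    omega
  simp only [spreadAbove, out, Expr.eval, Op.eval, hb, hc.one]
  rw [flatMap_congr_mem h, flatMap_encodeEvents_f₁, map_reverse_range_sub, above,
    show n ^ k + 1 - (b + 1) = n ^ k - b by omega]

/-- Write a word, given by programs for its parts, and its length in blocks. -/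
def word (l : List Cmd) (e : Expr) : Cmd := seqs (l ++ [len (op .mul e (var 2))])

theorem out_word {E env : ℕ → ℕ} {n k L : ℕ} (hc : Ctx n k L env) (w : List Letter)
    (l : List Cmd) (e : Expr) (hl : (l.flatMap fun p => p.out E env) = encodeEvents L w)
    (he : e.eval E env = w.length) : (word l e).out E env = wordEvents L w := by
  rw [word, out_seqs, List.flatMap_append, hl, List.flatMap_singleton, wordEvents]
  simp only [out, Expr.eval, Op.eval, he, hc.two]

/-- Run `p` for all `b < e` with nonzero `c`. -/
def each (x : ℕ) (e c : Expr) (p : Cmd) : Cmd := loop x e (ite c p skip)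

/-- The output of `each` is computed by listing the objects `F b` for the indices with the property
`P` and writing each of them with `g`. -/
theorem out_each {α : Type*} {E env : ℕ → ℕ} {x m : ℕ} {e c : Expr} {p : Cmd}
    {P : ℕ → Prop} {F : ℕ → List α} {g : α → List Event} (he : e.eval E env = m)
    (hP : ∀ b < m, c.eval E (Function.update env x b) ≠ 0 ↔ P b)
    (hp : ∀ b < m, P b → p.out E (Function.update env x b) = (F b).flatMap g) :
    (each x e c p).out E env =
      ((List.range m).reverse.flatMap fun b => if P b then F b else []).flatMap g := by
  rw [List.flatMap_assoc]
  simp only [each, out, he]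
  refine flatMap_congr_mem fun b hb => ?_
  have hb' : b < m := by simpa using hb
  by_cases h : P b
  · rw [if_pos ((hP b hb').2 h), if_pos h, hp b hb' h]
  · rw [if_neg (fun h' => h ((hP b hb').1 h')), if_neg h]; rfl

/-- Write the words that open a clique. -/
def openingCmd (k : ℕ) : Cmd := each 5 (var 1) (.isClique k (var 5))
  (word [spreadLetter (const 2), spreadBelow 5] (op .mul (const 3) (op .add (var 5) (const 1))))

/-- Write the words that close a clique. -/
def closingCmd (k : ℕ) : Cmd := each 5 (var 1) (.isClique k (var 5))
  (word [spreadAbove 5] (op .mul (const 3) (op .sub (var 1) (var 5))))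

/-- Write the words that pass a vertex. -/
def vertexCmd (k : ℕ) : Cmd := each 5 (var 1) (.isClique k (var 5))
  (each 6 (var 0) (.joinsVertex k (var 5) (var 6))
    (word [spreadAbove 5, spreadLetter (const 3), spreadLetter (op .add (var 6) (const 6)),
      spreadLetter (const 3), spreadBelow 5] (op .mul (const 3) (op .add (var 1) (const 3)))))

/-- Write the words that pass from one clique to another. -/
def bridgeCmd (k : ℕ) : Cmd := each 5 (var 1) (.isClique k (var 5))
  (each 6 (var 1) (op .mul (.isClique k (var 6)) (.joins k (var 5) (var 6)))
    (word [spreadAbove 5, spreadLetter (const 2), spreadLetter (const 4), spreadLetter (const 2),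
      spreadBelow 6]
      (op .mul (const 3) (op .add (op .sub (var 1) (var 5)) (op .add (const 3) (var 6))))))

/-- Write a word with the given indices of letters. -/
def shortWord (l : List Expr) : Cmd := word (l.map (letter chr)) (const l.length)

/-- Write the words with at most four letters. -/
def shortCmd : Cmd :=
  seqs ([2, 3, 4, 1].map (fun c => shortWord [const 0, const c, const 5]) ++
    loop 5 (var 1) (shortWord [const 0, op .add (var 5) (const 6), const 5]) ::
    ([2, 3, 4, 1].map (fun c => shortWord [const 5, const 0, const c]) ++
    loop 5 (var 1) (shortWord [const 5, const 0, op .add (var 5) (const 6)]) ::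
    [shortWord [const 0, const 1, const 5, const 0], shortWord [const 2, const 5, const 0, const 1],
      shortWord [const 5, const 1, const 1]]))

/-- Write the dictionary. -/
def dictCmd (k : ℕ) : Cmd :=
  seqs [openingCmd k, closingCmd k, vertexCmd k, bridgeCmd k, shortCmd]

end Cmd

section DictList

variable {n : ℕ} (G : SimpleGraph (Fin n)) (k : ℕ)

/-- The vertex `i` is adjacent to the last `k` digits of `b`. -/
def JoinsVertex (b i : ℕ) : Prop := ∀ j < k, adjFun G (i * n + digit n b j) ≠ 0

/-- The last `k` digits of `c` form a clique, and they are adjacent to those of `b`. -/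
def Joins (b c : ℕ) : Prop := IsCliqueIndex G k c ∧
  ∀ i < k, ∀ j < k, adjFun G (digit n b i * n + digit n c j) ≠ 0

/-- The words that open a clique. -/
def openingWords : List (List Letter) :=
  (List.range (n ^ k)).reverse.flatMap fun b =>
    if IsCliqueIndex G k b then [f₁ (dollar :: below (b + 1))] else []

/-- The words that close a clique. -/
def closingWords : List (List Letter) :=
  (List.range (n ^ k)).reverse.flatMap fun b =>
    if IsCliqueIndex G k b then [f₁ (above (n ^ k) (b + 1))] else []

/-- The words that pass a vertex. -/
def vertexWords : List (List Letter) :=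
  (List.range (n ^ k)).reverse.flatMap fun b => if IsCliqueIndex G k b then
    (List.range n).reverse.flatMap fun i => if JoinsVertex G k b i then
      [f₁ (above (n ^ k) (b + 1) ++ hash :: num (i + 1) :: hash :: below (b + 1))] else [] else []

/-- The words that pass from one clique to another. -/
def bridgeWords : List (List Letter) :=
  (List.range (n ^ k)).reverse.flatMap fun b => if IsCliqueIndex G k b then
    (List.range (n ^ k)).reverse.flatMap fun c => if Joins G k b c then
      [f₁ (above (n ^ k) (b + 1) ++ dollar :: gam :: dollar :: below (c + 1))] else [] else []

/-- The letters other than `α` and `β`, as a list. -/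
def plainList (N : ℕ) : List Letter :=
  [dollar, hash, gam, mu] ++ (List.range N).reverse.map fun j => num (j + 1)

/-- The words with at most four letters. -/
def shortWords (N : ℕ) : List (List Letter) :=
  (plainList N).map (fun x => [al, x, be]) ++ ((plainList N).map (fun x => [be, al, x]) ++
    [[al, mu, be, al], [dollar, be, al, mu], [be, mu, mu]])

/-- The dictionary, in the order in which it is written. -/
def dictList : List (List Letter) :=
  openingWords G k ++ (closingWords G k ++ (vertexWords G k ++ (bridgeWords G k ++
    shortWords (n ^ k))))

end DictList

namespace Cmd

open WordBreak.Expr (const var op)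

section Out

variable {n k L : ℕ} {G : SimpleGraph (Fin n)} {env : ℕ → ℕ}

theorem eval_isClique_var (hc : Ctx n k L env) (m x : ℕ) :
    (Expr.isClique m (var x)).eval (adjFun G) env ≠ 0 ↔ IsCliqueIndex G m (env x) :=
  Expr.eval_isClique hc.zero m (var x)

theorem out_openingCmd (hc : Ctx n k L env) :
    (openingCmd k).out (adjFun G) env = (openingWords G k).flatMap (wordEvents L) := by
  refine out_each hc.one (fun b _ => ?_) fun b hb _ => ?_
  · rw [eval_isClique_var (hc.update (by norm_num) b), Function.update_self]
  · have hc' := hc.update (x := 5) (by norm_num) b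
    rw [List.flatMap_singleton]
    refine out_word hc' _ _ _ ?_ ?_
    · simp only [List.flatMap_cons, List.flatMap_nil, List.append_nil,
        out_spreadLetter hc' dollar (const 2) (fun _ => rfl),
        out_spreadBelow hc' (x := 5) (b := b) (by norm_num) (Function.update_self ..),
        ← encodeEvents_append, ← f₁_append]
      rfl
    · simp [Expr.eval, Op.eval, length_f₁, below]

theorem out_closingCmd (hc : Ctx n k L env) :
    (closingCmd k).out (adjFun G) env = (closingWords G k).flatMap (wordEvents L) := by
  refine out_each hc.one (fun b _ => ?_) fun b hb _ => ?_
  · rw [eval_isClique_var (hc.update (by norm_num) b), Function.update_self]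
  · have hc' := hc.update (x := 5) (by norm_num) b
    rw [List.flatMap_singleton]
    refine out_word hc' _ _ _ ?_ ?_
    · simp only [List.flatMap_cons, List.flatMap_nil, List.append_nil,
        out_spreadAbove hc' (x := 5) (b := b) (Function.update_self ..) hb.le]
    · simp [Expr.eval, Op.eval, length_f₁, above, hc.one]

theorem out_vertexCmd (hc : Ctx n k L env) :
    (vertexCmd k).out (adjFun G) env = (vertexWords G k).flatMap (wordEvents L) := by
  refine out_each hc.one (fun b _ => ?_) fun b hb _ => ?_
  · rw [eval_isClique_var (hc.update (by norm_num) b), Function.update_self]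
  · have hc' := hc.update (x := 5) (by norm_num) b
    refine out_each hc'.zero (fun i _ => ?_) fun i _ _ => ?_
    · rw [Expr.eval_joinsVertex (hc'.update (x := 6) (by norm_num) i).zero]
      rfl
    · have hc'' := hc'.update (x := 6) (by norm_num) i
      have h5 : Function.update (Function.update env 5 b) 6 i 5 = b := by simp
      have hi := out_spreadLetter (E := adjFun G) hc'' (num (i + 1)) (op .add (var 6) (const 6))
        (fun _ => by simp [Expr.eval, Op.eval, letterIndex])
      rw [List.flatMap_singleton]
      refine out_word hc'' _ _ _ ?_ ?_
      · simp only [List.flatMap_cons, List.flatMap_nil, List.append_nil,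
          out_spreadAbove hc'' (x := 5) (b := b) h5 hb.le,
          out_spreadLetter hc'' hash (const 3) (fun _ => rfl), hi,
          out_spreadBelow hc'' (x := 5) (b := b) (by norm_num) h5,
          ← encodeEvents_append, ← f₁_append]
        rfl
      · simp [Expr.eval, Op.eval, length_f₁, above, below, hc.one]
        omega

theorem out_bridgeCmd (hc : Ctx n k L env) :
    (bridgeCmd k).out (adjFun G) env = (bridgeWords G k).flatMap (wordEvents L) := by
  refine out_each hc.one (fun b _ => ?_) fun b hb _ => ?_
  · rw [eval_isClique_var (hc.update (by norm_num) b), Function.update_self]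
  · have hc' := hc.update (x := 5) (by norm_num) b
    refine out_each hc'.one (fun c _ => ?_) fun c _ _ => ?_
    · have hc'' := hc'.update (x := 6) (by norm_num) c
      rw [show ∀ e f : Expr, ((op .mul e f).eval (adjFun G)
        (Function.update (Function.update env 5 b) 6 c) ≠ 0) =
        (e.eval (adjFun G) (Function.update (Function.update env 5 b) 6 c) *
          f.eval (adjFun G) (Function.update (Function.update env 5 b) 6 c) ≠ 0) from
        fun _ _ => rfl, mul_ne_zero_iff, eval_isClique_var hc'', Expr.eval_joins hc''.zero,
        Function.update_self]
      rfl
    · have hc'' := hc'.update (x := 6) (by norm_num) c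
      have h5 : Function.update (Function.update env 5 b) 6 c 5 = b := by simp
      rw [List.flatMap_singleton]
      refine out_word hc'' _ _ _ ?_ ?_
      · simp only [List.flatMap_cons, List.flatMap_nil, List.append_nil,
          out_spreadAbove hc'' (x := 5) (b := b) h5 hb.le,
          out_spreadLetter hc'' dollar (const 2) (fun _ => rfl),
          out_spreadLetter hc'' gam (const 4) (fun _ => rfl),
          out_spreadBelow hc'' (x := 6) (b := c) (by norm_num) (Function.update_self ..),
          ← encodeEvents_append, ← f₁_append]
        rfl
      · simp [Expr.eval, Op.eval, length_f₁, above, below, hc.one]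
        omega

theorem out_shortWord (hc : Ctx n k L env) (l : List (Expr × Letter))
    (h : ∀ p ∈ l, ∀ j, p.1.eval (adjFun G) (Function.update env 9 j) = letterIndex p.2) :
    (shortWord (l.map Prod.fst)).out (adjFun G) env = wordEvents L (l.map Prod.snd) := by
  refine out_word hc _ _ _ ?_ (by simp [Expr.eval])
  induction l with
  | nil => rfl
  | cons p l ih =>
    rw [List.map_cons, List.map_cons, List.flatMap_cons, ih fun q hq => h q (by simp [hq]),
      out_letter_chr hc p.2 p.1 (h p (by simp)), ← encodeEvents_append]
    rfl

theorem out_shortCmd (hc : Ctx n k L env) :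
    shortCmd.out (adjFun G) env = (shortWords (n ^ k)).flatMap (wordEvents L) := by
  have h3 : ∀ (e₁ e₂ e₃ : Expr) (x y z : Letter) (env : ℕ → ℕ), Ctx n k L env →
      (∀ j, e₁.eval (adjFun G) (Function.update env 9 j) = letterIndex x) →
      (∀ j, e₂.eval (adjFun G) (Function.update env 9 j) = letterIndex y) →
      (∀ j, e₃.eval (adjFun G) (Function.update env 9 j) = letterIndex z) →
      (shortWord [e₁, e₂, e₃]).out (adjFun G) env = wordEvents L [x, y, z] :=
    fun e₁ e₂ e₃ x y z env hc h₁ h₂ h₃ =>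
      out_shortWord hc [(e₁, x), (e₂, y), (e₃, z)] (by simpa using ⟨h₁, h₂, h₃⟩)
  have h4 : ∀ x y z w : Letter, (shortWord [const (letterIndex x), const (letterIndex y),
      const (letterIndex z), const (letterIndex w)]).out (adjFun G) env =
        wordEvents L [x, y, z, w] := fun x y z w =>
      out_shortWord hc [(_, x), (_, y), (_, z), (_, w)] (by simp [Expr.eval])
  have hfix : ∀ x y z : Letter, (shortWord [const (letterIndex x), const (letterIndex y),
      const (letterIndex z)]).out (adjFun G) env = wordEvents L [x, y, z] := fun x y z =>
    h3 _ _ _ x y z env hc (fun _ => rfl) (fun _ => rfl) fun _ => rfl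
  have hloop : ∀ (g : Letter → List Letter) (p : Cmd), (∀ j, p.out (adjFun G)
      (Function.update env 5 j) = wordEvents L (g (num (j + 1)))) →
      (loop 5 (var 1) p).out (adjFun G) env =
        (((List.range (n ^ k)).reverse.map fun j => num (j + 1)).map g).flatMap (wordEvents L) := by
    intro g p hp
    simp only [out, Expr.eval, hc.one, hp, List.map_map, List.flatMap_map]
    rfl
  have e1 := hloop (fun x => [al, x, be])
    (shortWord [const 0, op .add (var 5) (const 6), const 5]) fun j =>
    h3 _ _ _ al (num (j + 1)) be _ (hc.update (by norm_num) j) (fun _ => rfl)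
      (fun _ => by simp [Expr.eval, Op.eval, letterIndex]) fun _ => rfl
  have e2 := hloop (fun x => [be, al, x])
    (shortWord [const 5, const 0, op .add (var 5) (const 6)]) fun j =>
    h3 _ _ _ be al (num (j + 1)) _ (hc.update (by norm_num) j) (fun _ => rfl) (fun _ => rfl)
      fun _ => by simp [Expr.eval, Op.eval, letterIndex]
  simp only [shortCmd, out_seqs, shortWords, plainList, List.flatMap_append, List.flatMap_cons,
    List.map_cons, List.map_nil, List.cons_append, List.nil_append,
    List.flatMap_nil, e1, e2, ← hfix, ← h4, letterIndex, List.append_nil]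

theorem out_dictCmd (hc : Ctx n k L env) :
    (dictCmd k).out (adjFun G) env = (dictList G k).flatMap (wordEvents L) := by
  simp only [dictCmd, out_seqs, List.flatMap_cons, List.flatMap_nil, List.append_nil, dictList,
    List.flatMap_append, out_openingCmd hc, out_closingCmd hc, out_vertexCmd hc, out_bridgeCmd hc,
    out_shortCmd hc]

end Out

end Cmd

/-! ### The list of the dictionary -/

section DictList

variable {n : ℕ} {G : SimpleGraph (Fin n)} {k : ℕ}

/-- The condition for vertex pieces in terms of sets; `i ∉ B` holds automatically, as graphs have no
loops. -/
theorem joinsVertex_iff (hn : 0 < n) {b : ℕ} (i : Fin n) :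
    JoinsVertex G k b i ↔ ∀ v ∈ digitSet hn k b, G.Adj i v := by
  simp only [digitSet, Finset.mem_image, Finset.mem_univ, true_and, forall_exists_index,
    forall_apply_eq_imp_iff]
  constructor
  · intro h j
    exact (adjFun_ne_zero G i _).1 (h j j.2)
  · intro h j hj
    exact (adjFun_ne_zero G i (digitTuple hn k b ⟨j, hj⟩)).2 (h ⟨j, hj⟩)

/-- The condition for bridges in terms of sets; disjointness holds automatically, as graphs have no
loops. -/
theorem joins_iff (hn : 0 < n) {b c : ℕ} :
    Joins G k b c ↔ IsCliqueIndex G k c ∧ IsBiClique G (digitSet hn k b) (digitSet hn k c) := by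
  have key : (∀ u ∈ digitSet hn k b, ∀ v ∈ digitSet hn k c, G.Adj u v) ↔
      ∀ i < k, ∀ j < k, adjFun G (digit n b i * n + digit n c j) ≠ 0 := by
    simp only [digitSet, Finset.mem_image, Finset.mem_univ, true_and, forall_exists_index,
      forall_apply_eq_imp_iff]
    constructor
    · intro h i hi j hj
      exact (adjFun_ne_zero G (digitTuple hn k b ⟨i, hi⟩) (digitTuple hn k c ⟨j, hj⟩)).2 (h _ _)
    · intro h i j
      exact (adjFun_ne_zero G _ _).1 (h i i.2 j j.2)
  rw [Joins, ← key, IsBiClique]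
  refine and_congr_right fun _ => (and_iff_right_of_imp fun h => ?_).symm
  exact Finset.disjoint_left.2 fun u hu hu' => G.irrefl (h u hu u hu')

theorem mem_plainList {N : ℕ} {x : Letter} : x ∈ plainList N ↔ x ∈ plain N := by
  simp only [plainList, plain, List.mem_append, List.mem_cons, List.mem_map, List.mem_reverse,
    List.mem_range, Finset.mem_union, Finset.mem_image, Finset.mem_Icc, Finset.mem_insert,
    Finset.mem_singleton, List.not_mem_nil, or_false]
  rw [or_comm]
  refine or_congr_left ⟨?_, ?_⟩
  · rintro ⟨j, hj, rfl⟩; exact ⟨j + 1, by omega, rfl⟩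
  · rintro ⟨j, hj, rfl⟩; exact ⟨j - 1, by omega, by rw [Nat.sub_add_cancel hj.1]⟩

theorem mem_ite_nil {α : Type*} {p : Prop} {a : α} {l : List α} :
    (a ∈ if p then l else []) ↔ p ∧ a ∈ l := by
  split_ifs with h <;> simp [h]

theorem mem_openingWords {w : List Letter} : w ∈ openingWords G k ↔
    ∃ b < n ^ k, IsCliqueIndex G k b ∧ w = f₁ (dollar :: below (b + 1)) := by
  simp [openingWords]

theorem mem_closingWords {w : List Letter} : w ∈ closingWords G k ↔
    ∃ b < n ^ k, IsCliqueIndex G k b ∧ w = f₁ (above (n ^ k) (b + 1)) := by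
  simp [closingWords]

theorem mem_vertexWords {w : List Letter} : w ∈ vertexWords G k ↔
    ∃ b < n ^ k, IsCliqueIndex G k b ∧ ∃ i < n, JoinsVertex G k b i ∧
      w = f₁ (above (n ^ k) (b + 1) ++ hash :: num (i + 1) :: hash :: below (b + 1)) := by
  simp [vertexWords]

theorem mem_bridgeWords {w : List Letter} : w ∈ bridgeWords G k ↔
    ∃ b < n ^ k, IsCliqueIndex G k b ∧ ∃ c < n ^ k, Joins G k b c ∧
      w = f₁ (above (n ^ k) (b + 1) ++ dollar :: gam :: dollar :: below (c + 1)) := by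
  simp [bridgeWords]

/-- The words that are written are those of the dictionary, for the numbering of the cliques by
their digits. -/
theorem mem_dictList (hn : 0 < n) {w : List Letter} :
    w ∈ dictList G k ↔ w ∈ graphDict G k (cliqueNumber G hn k) := by
  have num_eq : ∀ {b}, b < n ^ k → IsCliqueIndex G k b →
      cliqueNumber G hn k (digitSet hn k b) = b + 1 := fun hb h => cliqueNumber_digitSet hb h
  rw [mem_graphDict]
  simp only [dictList, List.mem_append, mem_openingWords, mem_closingWords, mem_vertexWords,
    mem_bridgeWords, shortWords, List.mem_map, mem_plainList, List.mem_cons, List.not_mem_nil,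
    or_false, ← or_assoc]
  refine or_congr (or_congr (or_congr (or_congr (or_congr ?_ ?_) ?_) Iff.rfl) Iff.rfl) Iff.rfl
  · constructor
    · rintro (((⟨b, hb, h, rfl⟩ | ⟨b, hb, h, rfl⟩) | ⟨b, hb, h, i, hi, hj, rfl⟩) |
        ⟨b, hb, h, c, hc, hj, rfl⟩)
      · exact ⟨_, .opening (h.isNClique hn), by rw [num_eq hb h]⟩
      · exact ⟨_, .closing (h.isNClique hn), by rw [num_eq hb h]⟩
      · have hadj := (joinsVertex_iff hn ⟨i, hi⟩).1 hj
        exact ⟨_, .vertex (v := ⟨i, hi⟩) (h.isNClique hn)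
          (fun hv => G.irrefl (hadj _ hv)) hadj, by rw [num_eq hb h]; rfl⟩
      · obtain ⟨h', hbc⟩ := (joins_iff hn).1 hj
        exact ⟨_, .bridge (h.isNClique hn) (h'.isNClique hn) hbc, by rw [num_eq hb h, num_eq hc h']⟩
    · rintro ⟨u, hu, rfl⟩
      cases hu with
      | opening hB =>
        obtain ⟨b, hb, h, rfl⟩ := exists_cliqueIndex hn hB
        exact .inl (.inl (.inl ⟨b, hb, h, by rw [num_eq hb h]⟩))
      | closing hB =>
        obtain ⟨b, hb, h, rfl⟩ := exists_cliqueIndex hn hB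
        exact .inl (.inl (.inr ⟨b, hb, h, by rw [num_eq hb h]⟩))
      | @vertex B v hB hv hadj =>
        obtain ⟨b, hb, h, rfl⟩ := exists_cliqueIndex hn hB
        exact .inl (.inr ⟨b, hb, h, v, v.2, (joinsVertex_iff hn v).2 hadj, by
          rw [num_eq hb h]; rfl⟩)
      | bridge hB hC hBC =>
        obtain ⟨b, hb, h, rfl⟩ := exists_cliqueIndex hn hB
        obtain ⟨c, hc, h', rfl⟩ := exists_cliqueIndex hn hC
        exact .inr ⟨b, hb, h, c, hc, (joins_iff hn).2 ⟨h', hBC⟩, by rw [num_eq hb h, num_eq hc h']⟩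
  · exact exists_congr fun x => and_congr_right fun _ => eq_comm
  · exact exists_congr fun x => and_congr_right fun _ => eq_comm

/-- A list of lists has no duplicates if the index of the list can be read off from its elements by
a function `key`. -/
theorem nodup_flatMap_ite {α : Type*} {m : ℕ} {P : ℕ → Prop} {F : ℕ → List α} (key : α → ℕ)
    (hF : ∀ b < m, P b → (F b).Nodup) (hkey : ∀ b < m, P b → ∀ w ∈ F b, key w = b) :
    ((List.range m).reverse.flatMap fun b => if P b then F b else []).Nodup := by
  rw [List.nodup_flatMap]
  refine ⟨fun b hb => ?_, ?_⟩
  · split_ifs with h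
    · exact hF b (by simpa using hb) h
    · exact List.nodup_nil
  · refine List.Pairwise.imp_of_mem ?_ (List.nodup_reverse.2 List.nodup_range)
    intro a b ha hb hab
    simp only [Function.onFun, List.disjoint_left, mem_ite_nil, not_and]
    intro w hw hb' hw'
    exact hab ((hkey a (by simpa using ha) hw.1 w hw.2).symm.trans
      (hkey b (by simpa using hb) hb' w hw'))

/-- The position of the first occurrence of a letter in a spread-out word. It recovers the number of
the clique with which a piece begins. -/
theorem idxOf_f₁_append {x : Letter} {u v : List Letter} (hx : x ∉ u) (h1 : x ≠ be)
    (h2 : x ≠ al) : (f₁ (u ++ x :: v)).idxOf x = 3 * u.length := by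
  have h : x ∉ f₁ u := by
    simp only [f₁, List.mem_flatMap, not_exists, not_and, List.mem_cons, List.not_mem_nil,
      or_false, not_or]
    exact fun y hy => ⟨fun h => hx (h ▸ hy), h1, h2⟩
  rw [f₁_append, List.idxOf_append_of_notMem h, length_f₁]
  simp [f₁]

theorem notMem_below {B : ℕ} {x : Letter} (hx : ∀ i, x ≠ num i) : x ∉ below B := fun h => by
  obtain ⟨i, -, -, rfl⟩ := exists_num_of_mem_below h; exact hx i rfl

theorem notMem_above {N B : ℕ} {x : Letter} (hx : ∀ i, x ≠ num i) : x ∉ above N B := fun h => by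
  obtain ⟨i, -, -, rfl⟩ := exists_num_of_mem_above h; exact hx i rfl

theorem length_below (b : ℕ) : (below (b + 1)).length = b := by simp [below]

theorem length_above (N b : ℕ) : (above N (b + 1)).length = N - b := by simp [above]

theorem nodup_openingWords : (openingWords G k).Nodup := by
  refine nodup_flatMap_ite (fun w => w.length / 3 - 1) (fun _ _ _ => List.nodup_singleton _) ?_
  intro b _ _ w hw
  rw [List.mem_singleton.1 hw, length_f₁, List.length_cons, length_below]
  omega

theorem nodup_closingWords : (closingWords G k).Nodup := by
  refine nodup_flatMap_ite (fun w => n ^ k - w.length / 3) (fun _ _ _ => List.nodup_singleton _) ?_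
  intro b _ _ w hw
  rw [List.mem_singleton.1 hw, length_f₁, length_above]
  omega

theorem nodup_vertexWords : (vertexWords G k).Nodup := by
  refine nodup_flatMap_ite (fun w => n ^ k - w.idxOf hash / 3) (fun b hb _ => ?_) ?_
  · refine nodup_flatMap_ite
      (fun w => letterIndex ((w.drop (f₁ (above (n ^ k) (b + 1))).length).getD 3 al) - 6)
      (fun _ _ _ => List.nodup_singleton _) ?_
    intro i _ _ w hw
    rw [List.mem_singleton.1 hw, f₁_append, List.drop_left]
    simp [f₁, letterIndex]
  · intro b hb _ w hw
    simp only [List.mem_flatMap, mem_ite_nil, List.mem_singleton] at hw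
    obtain ⟨i, -, -, rfl⟩ := hw
    rw [idxOf_f₁_append (notMem_above (by simp)) (by simp) (by simp), length_above]
    omega

theorem nodup_bridgeWords : (bridgeWords G k).Nodup := by
  refine nodup_flatMap_ite (fun w => n ^ k - w.idxOf dollar / 3) (fun b hb _ => ?_) ?_
  · refine nodup_flatMap_ite (fun w => w.length / 3 - 3 - (n ^ k - b))
      (fun _ _ _ => List.nodup_singleton _) ?_
    intro c _ _ w hw
    rw [List.mem_singleton.1 hw, length_f₁]
    simp only [List.length_append, List.length_cons, length_above, length_below]
    omega
  · intro b hb _ w hw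
    simp only [List.mem_flatMap, mem_ite_nil, List.mem_singleton] at hw
    obtain ⟨i, -, -, rfl⟩ := hw
    rw [idxOf_f₁_append (notMem_above (by simp)) (by simp) (by simp), length_above]
    omega

theorem nodup_plainList (N : ℕ) : (plainList N).Nodup := by
  refine List.Nodup.append (by simp) ?_ ?_
  · refine (List.nodup_reverse.2 List.nodup_range).map fun a b h => ?_
    simpa using h
  · intro x hx hx'
    obtain ⟨j, -, rfl⟩ := List.mem_map.1 hx'
    simp at hx

/-- The family of the dictionary to which a word belongs. -/
def kind : List Letter → ℕ
  | dollar :: w => if mu ∈ w then 7 else 1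
  | num _ :: w => if gam ∈ w then 4 else if hash ∈ w then 3 else 2
  | [al, _, be] => 5
  | be :: al :: _ => 6
  | _ => 7

theorem nodup_append_of_kind {l₁ l₂ : List (List Letter)} (c : ℕ) (h₁ : l₁.Nodup) (h₂ : l₂.Nodup)
    (hl : ∀ w ∈ l₁, kind w = c) (hr : ∀ w ∈ l₂, c < kind w) : (l₁ ++ l₂).Nodup :=
  h₁.append h₂ fun w hw hw' => (hr w hw').ne' (hl w hw)

theorem mem_f₁ {x : Letter} {u : List Letter} (h1 : x ≠ be) (h2 : x ≠ al) :
    x ∈ f₁ u ↔ x ∈ u := by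
  simp only [f₁, List.mem_flatMap, List.mem_cons, List.not_mem_nil, or_false, h1, h2]
  exact ⟨fun ⟨y, hy, h⟩ => h ▸ hy, fun h => ⟨x, h, rfl⟩⟩

theorem kind_f₁_num {i : ℕ} {u : List Letter} : kind (f₁ (num i :: u)) =
    if gam ∈ u then 4 else if hash ∈ u then 3 else 2 := by
  have h : f₁ (num i :: u) = num i :: be :: al :: f₁ u := rfl
  rw [h, kind]
  simp [mem_f₁]

/-- The dictionary is written without repetitions, as the format of an instance demands. -/
theorem nodup_dictList : (dictList G k).Nodup := by
  have k1 : ∀ w ∈ openingWords G k, kind w = 1 := by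
    intro w hw
    obtain ⟨b, -, -, rfl⟩ := mem_openingWords.1 hw
    have h : f₁ (dollar :: below (b + 1)) = dollar :: be :: al :: f₁ (below (b + 1)) := rfl
    rw [h, kind]
    simp [mem_f₁, notMem_below]
  have k2 : ∀ w ∈ closingWords G k, kind w = 2 := by
    intro w hw
    obtain ⟨b, hb, -, rfl⟩ := mem_closingWords.1 hw
    rw [above_eq_cons (by omega), kind_f₁_num]
    simp [notMem_above]
  have k3 : ∀ w ∈ vertexWords G k, kind w = 3 := by
    intro w hw
    obtain ⟨b, hb, -, i, -, -, rfl⟩ := mem_vertexWords.1 hw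
    rw [above_eq_cons (by omega), List.cons_append, kind_f₁_num]
    simp [notMem_above, notMem_below]
  have k4 : ∀ w ∈ bridgeWords G k, kind w = 4 := by
    intro w hw
    obtain ⟨b, hb, -, c, -, -, rfl⟩ := mem_bridgeWords.1 hw
    rw [above_eq_cons (by omega), List.cons_append, kind_f₁_num]
    simp
  have k5 : ∀ w ∈ (plainList (n ^ k)).map (fun x => [al, x, be]), kind w = 5 := by
    intro w hw
    obtain ⟨x, -, rfl⟩ := List.mem_map.1 hw
    rfl
  have k6 : ∀ w ∈ (plainList (n ^ k)).map (fun x => [be, al, x]), kind w = 6 := by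
    intro w hw
    obtain ⟨x, -, rfl⟩ := List.mem_map.1 hw
    rfl
  have k7 : ∀ w ∈ [[al, mu, be, al], [dollar, be, al, mu], [be, mu, mu]], kind w = 7 := by
    simp [kind]
  have h6 : ∀ w ∈ shortWords (n ^ k), 4 < kind w := by
    intro w hw
    simp only [shortWords, List.mem_append] at hw
    rcases hw with h | h | h
    · rw [k5 w h]; norm_num
    · rw [k6 w h]; norm_num
    · rw [k7 w h]; norm_num
  have h5 : ∀ w ∈ bridgeWords G k ++ shortWords (n ^ k), 3 < kind w := by
    intro w hw
    rcases List.mem_append.1 hw with h | h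
    · rw [k4 w h]; norm_num
    · exact lt_trans (by norm_num) (h6 w h)
  have h4 : ∀ w ∈ vertexWords G k ++ (bridgeWords G k ++ shortWords (n ^ k)), 2 < kind w := by
    intro w hw
    rcases List.mem_append.1 hw with h | h
    · rw [k3 w h]; norm_num
    · exact lt_trans (by norm_num) (h5 w h)
  have hs : (shortWords (n ^ k)).Nodup := by
    refine nodup_append_of_kind 5 ((nodup_plainList _).map fun x y h => ?_)
      (nodup_append_of_kind 6 ((nodup_plainList _).map fun x y h => ?_) (by simp) k6 ?_) k5 ?_
    · simpa using h
    · simpa using h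
    · intro w hw; rw [k7 w hw]; norm_num
    · intro w hw
      rcases List.mem_append.1 hw with h | h
      · rw [k6 w h]; norm_num
      · rw [k7 w h]; norm_num
  refine nodup_append_of_kind 1 nodup_openingWords (nodup_append_of_kind 2 nodup_closingWords
    (nodup_append_of_kind 3 nodup_vertexWords (nodup_append_of_kind 4 nodup_bridgeWords hs k4 h6)
      k3 h5) k2 h4) k1 ?_
  intro w hw
  rcases List.mem_append.1 hw with h | h
  · rw [k2 w h]; norm_num
  · exact lt_trans (by norm_num) (h4 w h)

end DictList

/-! ### Block codes -/

theorem length_bits (L c : ℕ) : (bits L c).length = L := by simp [bits]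

theorem bits_lt_two {L c x : ℕ} (h : x ∈ bits L c) : x < 2 := by
  simp only [bits, List.mem_map] at h
  obtain ⟨j, -, rfl⟩ := h
  exact Nat.mod_lt _ (by norm_num)

theorem bits_injOn (L : ℕ) {c d : ℕ} (hc : c < 2 ^ L) (hd : d < 2 ^ L) (h : bits L c = bits L d) :
    c = d := by
  rw [bits, bits, List.map_inj_left] at h
  refine Nat.eq_of_testBit_eq fun j => ?_
  by_cases hj : j < L
  · have := h j (by simpa using hj)
    rw [Nat.shiftRight_eq_div_pow, Nat.shiftRight_eq_div_pow] at this
    rw [Nat.testBit_eq_decide_div_mod_eq, Nat.testBit_eq_decide_div_mod_eq, this]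
  · have hle : 2 ^ L ≤ 2 ^ j := Nat.pow_le_pow_right (by norm_num) (by omega)
    rw [Nat.testBit_lt_two_pow (by omega), Nat.testBit_lt_two_pow (by omega)]

theorem isBlockCode_blockCode {N L : ℕ} (h : N + 6 ≤ 2 ^ L) :
    IsBlockCode (alphabet N) L (blockCode L) := by
  refine ⟨fun x _ => length_bits L _, fun x hx y hy hxy => ?_⟩
  have h1 := letterIndex_lt hx
  have h2 := letterIndex_lt hy
  rw [← letterOf_letterIndex hx, ← letterOf_letterIndex hy,
    bits_injOn L (by omega) (by omega) hxy]

theorem IsBlockCode.flatMap_injOn {S : Finset Letter} {L : ℕ} {code : Letter → List ℕ}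
    (h : IsBlockCode S L code) (hL : 1 ≤ L) : ∀ {u v : List Letter}, (∀ x ∈ u, x ∈ S) →
      (∀ x ∈ v, x ∈ S) → u.flatMap code = v.flatMap code → u = v := by
  intro u
  induction u with
  | nil =>
    intro v _ hv huv
    cases v with
    | nil => rfl
    | cons y v =>
      have h1 := congrArg List.length huv
      have h2 := h.1 y (hv y (by simp))
      rw [List.flatMap_cons, List.length_append, List.flatMap_nil, List.length_nil] at h1
      omega
  | cons x u ih =>
    intro v hu hv huv
    cases v with
    | nil =>
      have h1 := congrArg List.length huv
      have h2 := h.1 x (hu x (by simp))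
      rw [List.flatMap_cons, List.length_append, List.flatMap_nil, List.length_nil] at h1
      omega
    | cons y v =>
      rw [List.flatMap_cons, List.flatMap_cons] at huv
      obtain ⟨h1, h2⟩ := List.append_inj huv
        (by rw [h.1 x (hu x (by simp)), h.1 y (hv y (by simp))])
      rw [h.2 (hu x (by simp)) (hv y (by simp)) h1,
        ih (fun z hz => hu z (by simp [hz])) (fun z hz => hv z (by simp [hz])) h2]

/-- Coding letters as blocks does not affect whether a word is a concatenation of words of a
dictionary. -/
theorem IsBlockCode.factorizable_iff {S : Finset Letter} {L : ℕ} {code : Letter → List ℕ}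
    (h : IsBlockCode S L code) (hL : 1 ≤ L) {D : Set (List Letter)} {w : List Letter}
    (hD : ∀ d ∈ D, ∀ x ∈ d, x ∈ S) (hw : ∀ x ∈ w, x ∈ S) :
    Factorizable ((fun d => d.flatMap code) '' D) (w.flatMap code) ↔ Factorizable D w := by
  have flat : ∀ ds : List (List Letter),
      (ds.map fun d => d.flatMap code).flatten = ds.flatten.flatMap code := by
    intro ds
    induction ds with
    | nil => rfl
    | cons d ds ih => rw [List.map_cons, List.flatten_cons, ih, List.flatten_cons,
        List.flatMap_append]
  constructor
  · rintro ⟨fs, hfs, hw'⟩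
    obtain ⟨ds, hds, rfl⟩ : ∃ ds : List (List Letter), (∀ d ∈ ds, d ∈ D) ∧
        ds.map (fun d => d.flatMap code) = fs := by
      clear hw'
      induction fs with
      | nil => exact ⟨[], by simp, rfl⟩
      | cons f fs ih =>
        obtain ⟨d, hd, rfl⟩ := hfs f (by simp)
        obtain ⟨ds, hds, rfl⟩ := ih fun g hg => hfs g (by simp [hg])
        exact ⟨d :: ds, by simpa using ⟨hd, hds⟩, rfl⟩
    refine ⟨ds, hds, h.flatMap_injOn hL ?_ hw (by rw [← flat, hw'])⟩
    intro x hx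
    obtain ⟨d, hd, hx⟩ := List.mem_flatten.1 hx
    exact hD d (hds d hd) x hx
  · rintro ⟨ds, hds, rfl⟩
    refine ⟨ds.map fun d => d.flatMap code, ?_, flat ds⟩
    intro f hf
    obtain ⟨d, hd, rfl⟩ := List.mem_map.1 hf
    exact ⟨d, hds d hd, rfl⟩

/-! ### The program that writes the straight-line program -/

namespace Cmd

open WordBreak.Expr (const var op)

/-- Write an item for every bit of the letter with index `e`, or the item for the auxiliary
chain. Variable `4` holds the position at which the main chain starts. -/
def token : Option Expr → Cmd
  | none => sym (var 4) (op .sub (var 4) (const 1))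
  | some e => letter (sym (var 4)) e

/-- The expression denotes the letter, whatever the value of the counter for the bits. -/
def Denotes (E env : ℕ → ℕ) : Option Expr → Option Letter → Prop
  | none, none => True
  | some e, some x => ∀ j, e.eval E (Function.update env 9 j) = letterIndex x
  | _, _ => False

theorem out_tokens {E env : ℕ → ℕ} {n k L a : ℕ} (hc : Ctx n k L env) (ha : env 4 = a)
    {es : List (Option Expr)} {ts : List (Option Letter)}
    (h : List.Forall₂ (Denotes E env) es ts) :
    (seqs (es.map token)).out E env =
      (ts.flatMap (tokenSymbols (blockCode L) (a - 1))).map (Event.sym a) := by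
  rw [out_seqs]
  induction h with
  | nil => rfl
  | @cons e t es ts het h ih =>
    rw [List.map_cons, List.flatMap_cons, List.flatMap_cons, List.map_append, ih]
    congr 1
    match e, t, het with
    | none, none, _ => simp [token, out, Expr.eval, Op.eval, tokenSymbols, ha]
    | some e, some x, het =>
      rw [token, out_letter hc.two _ (Event.sym a) _ e het, tokenSymbols, blockCode]
      intro j e'
      simp only [out, Expr.eval, Function.update_of_ne (show 4 ≠ 9 by norm_num), ha]

/-- The tokens for `α x β`. -/
def spreadExprs (e : Expr) : List (Option Expr) := [some (const 0), some e, some (const 5)]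

/-- The tokens for `f₀ (w_A)`, where the `m` elements of `A` are the digits of variable `5`. -/
def gadgetExprs (m : ℕ) : List (Option Expr) :=
  spreadExprs (const 2) ++ none :: (((List.range m).flatMap fun i =>
    spreadExprs (const 3) ++ (spreadExprs (op .add ((var 5).digit i) (const 6)) ++
      (spreadExprs (const 3) ++ [none]))) ++ spreadExprs (const 2))

/-- The tokens for the part of `w` that belongs to a clique. -/
def blockExprs (m : ℕ) : List (Option Expr) :=
  spreadExprs (const 1) ++ (gadgetExprs m ++ (spreadExprs (const 4) ++
    (gadgetExprs m ++ spreadExprs (const 1))))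

theorem denotes_spread {E env : ℕ → ℕ} {e : Expr} {x : Letter}
    (h : ∀ j, e.eval E (Function.update env 9 j) = letterIndex x) :
    List.Forall₂ (Denotes E env) (spreadExprs e) (spread x) :=
  .cons (fun _ => rfl) (.cons h (.cons (fun _ => rfl) .nil))

theorem denotes_gadget {E env : ℕ → ℕ} {n k L b : ℕ} (hc : Ctx n k L env) (hb : env 5 = b)
    (hn : 0 < n) (m : ℕ) :
    List.Forall₂ (Denotes E env) (gadgetExprs m)
      (gadgetTokens (List.ofFn (digitTuple hn m b))) := by
  have h2 := denotes_spread (E := E) (env := env) (x := dollar) (e := const 2) fun _ => rfl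
  have h3 := denotes_spread (E := E) (env := env) (x := hash) (e := const 3) fun _ => rfl
  have hnone : Denotes E env none none := trivial
  rw [gadgetExprs, gadgetTokens, List.ofFn_eq_map, ← List.map_coe_finRange_eq_range,
    List.flatMap_map, List.flatMap_map]
  refine List.rel_append h2 (.cons hnone (List.rel_append ?_ h2))
  generalize List.finRange m = l
  induction l with
  | nil => exact .nil
  | cons i l ih =>
    rw [List.flatMap_cons, List.flatMap_cons]
    refine List.rel_append (List.rel_append h3 (List.rel_append (denotes_spread fun j => ?_)
      (List.rel_append h3 (.cons hnone .nil)))) ih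
    simp only [Expr.eval, Op.eval, Expr.eval_digit (hc.update (x := 9) (by norm_num) j).zero,
      Function.update_of_ne (show 5 ≠ 9 by norm_num), hb, vert, letterIndex]
    rfl

theorem denotes_block {E env : ℕ → ℕ} {n k L b : ℕ} (hc : Ctx n k L env) (hb : env 5 = b)
    (hn : 0 < n) (m : ℕ) :
    List.Forall₂ (Denotes E env) (blockExprs m) (blockTokens (List.ofFn (digitTuple hn m b))) := by
  have h1 := denotes_spread (E := E) (env := env) (x := mu) (e := const 1) fun _ => rfl
  have h4 := denotes_spread (E := E) (env := env) (x := gam) (e := const 4) fun _ => rfl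
  have hg := denotes_gadget (E := E) hc hb hn m
  exact List.rel_append h1 (List.rel_append hg (List.rel_append h4 (List.rel_append hg h1)))

/-- An expression with value `1` if there is a clique, and with value `0` otherwise; variable `3`
is nonzero if there is a clique. -/
def flag : Expr := op .sub (const 1) (op .sub (const 1) (var 3))

/-- Write the items of the auxiliary chain. -/
def auxCmd : Cmd := loop 5 (op .mul (var 1) flag) (seqs [letter (sym (const 2)) (const 0),
  letter (sym (const 2)) (op .add (op .sub (var 1) (var 5)) (const 5)),
  letter (sym (const 2)) (const 5)])

/-- Write the items of the straight-line program: the two letters, the auxiliary chain, and the main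
chain. -/
def slpCmd (k : ℕ) : Cmd :=
  seqs [sym (const 0) (const 0), sym (const 1) (const 1), auxCmd,
    each 5 (op .mul (var 1) (var 1)) (.isClique (2 * k) (var 5))
      (seqs ((blockExprs (2 * k)).map token)),
    seqs ([some (const 1), some (const 1)].map token)]

section Out

variable {n k L : ℕ} {G : SimpleGraph (Fin n)} {env : ℕ → ℕ}

theorem out_auxCmd {E : ℕ → ℕ} (hc : Ctx n k L env) {As : List (List (Fin n))}
    (h : env 3 ≠ 0 ↔ As ≠ []) :
    auxCmd.out E env = (auxSymbols (blockCode L) (n ^ k) As).map (Event.sym 2) := by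
  have hx : ∀ (j : ℕ) (x : Letter) (e : Expr), (∀ i, e.eval E
      (Function.update (Function.update env 5 j) 9 i) = letterIndex x) →
      (letter (sym (const 2)) e).out E (Function.update env 5 j) =
        (blockCode L x).map (Event.sym 2) := fun j x e he =>
    out_letter (hc.update (by norm_num) j).two _ (Event.sym 2) (fun _ _ => rfl) e he
  have hbody : ∀ j ∈ (List.range (n ^ k)).reverse,
      (seqs [letter (sym (const 2)) (const 0),
        letter (sym (const 2)) (op .add (op .sub (var 1) (var 5)) (const 5)),
        letter (sym (const 2)) (const 5)]).out E (Function.update env 5 j) =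
      ([al, num (0 + n ^ k - j), be].flatMap (blockCode L)).map (Event.sym 2) := by
    intro j _
    rw [out_seqs]
    simp only [List.flatMap_cons, List.flatMap_nil, hx j al (const 0) (fun _ => rfl),
      hx j be (const 5) (fun _ => rfl), List.append_nil, List.map_append]
    rw [hx j (num (0 + n ^ k - j))]
    intro i
    simp [Expr.eval, Op.eval, letterIndex, hc.one]
  by_cases hAs : As = []
  · have h3 : env 3 = 0 := by by_contra h'; exact h.1 h' hAs
    simp [auxCmd, out, Expr.eval, Op.eval, flag, h3, auxSymbols, hAs]
  · have h3 := h.2 hAs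
    have h4 : 1 - (1 - env 3) = 1 := by omega
    simp only [auxCmd, out, Expr.eval, Op.eval, flag, h4, auxSymbols, hAs, if_false, hc.one,
      mul_one]
    rw [flatMap_congr_mem hbody, ← List.map_flatMap, ← List.flatMap_assoc, above, f₀,
      ← map_reverse_range_sub, List.map_map, List.flatMap_map]
    rfl

theorem out_slpCmd (hn : 0 < n) (hc : Ctx n k L env)
    (h3 : env 3 ≠ 0 ↔ cliqueLists G hn k ≠ [])
    (h4 : env 4 = 2 + (auxSymbols (blockCode L) (n ^ k) (cliqueLists G hn k)).length) :
    (slpCmd k).out (adjFun G) env =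
      (chainItems 2 (auxSymbols (blockCode L) (n ^ k) (cliqueLists G hn k))
        (mainSymbols (blockCode L) 2 (n ^ k) (cliqueLists G hn k))).map
          fun p => Event.sym p.1 p.2 := by
  have hN : n ^ k * n ^ k = n ^ (2 * k) := by rw [two_mul, pow_add]
  have hend := out_tokens (E := adjFun G) hc h4 (es := [some (const 1), some (const 1)])
    (ts := [some mu, some mu]) (.cons (fun _ => rfl) (.cons (fun _ => rfl) .nil))
  have hblocks := out_each (α := ℕ) (E := adjFun G) (env := env) (x := 5)
    (e := op .mul (var 1) (var 1)) (c := .isClique (2 * k) (var 5))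
    (p := seqs ((blockExprs (2 * k)).map token)) (m := n ^ (2 * k))
    (P := fun b => IsCliqueIndex G (2 * k) b)
    (F := fun b => [b])
    (g := fun b => ((blockTokens (List.ofFn (digitTuple hn (2 * k) b))).flatMap
      (tokenSymbols (blockCode L) (env 4 - 1))).map (Event.sym (env 4)))
    (by simp only [Expr.eval, Op.eval, hc.one, hN])
    (fun b _ => by
      rw [eval_isClique_var (hc.update (by norm_num) b), Function.update_self])
    (fun b _ _ => by
      rw [List.flatMap_singleton]
      exact out_tokens (hc.update (by norm_num) b) (by simp)
        (denotes_block (hc.update (by norm_num) b) (Function.update_self ..) hn _))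
  have hfilter : ∀ l : List ℕ, (l.flatMap fun b => if IsCliqueIndex G (2 * k) b then [b] else []) =
      l.filter fun b => IsCliqueIndex G (2 * k) b := by
    intro l
    induction l with
    | nil => rfl
    | cons b l ih =>
      rw [List.flatMap_cons, ih, List.filter_cons]
      by_cases hb : IsCliqueIndex G (2 * k) b <;> simp [hb]
  rw [hfilter] at hblocks
  rw [slpCmd, out_seqs]
  simp only [List.flatMap_cons, List.flatMap_nil, List.append_nil, hblocks, hend,
    out_auxCmd hc h3, chainItems, mainSymbols, wordTokens, List.map_append, List.map_map,
    List.flatMap_append, ← h4]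
  rw [cliqueLists, List.flatMap_map, List.flatMap_assoc, List.map_flatMap]
  rfl

end Out

/-- Set the variables, write the straight-line program, and write the dictionary. A sum with a
single term is an assignment; variable `3` counts the `2k`-cliques. -/
def main (k : ℕ) : Cmd :=
  sum 1 (const 1) (.npow k) (sum 2 (op .add (var 1) (const 4))
    (op .sub (const 1) (op .sub (const 1)
      (op .shr (op .mul (const 16) (var 1)) (op .add (var 2) (const 1)))))
    (sum 3 (op .mul (var 1) (var 1)) (.isClique (2 * k) (var 3))
      (sum 4 (const 1) (op .add (const 2) (op .mul (op .mul (const 3) flag)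
        (op .mul (var 1) (var 2)))) (seq (slpCmd k) (dictCmd k)))))

end Cmd

/-- The length of the blocks, which leaves room for the six special letters. -/
def blockLength (N : ℕ) : ℕ := Nat.log 2 (16 * N)

theorem blockLength_eq {N : ℕ} (hN : 1 ≤ N) : blockLength N = Nat.log 2 N + 4 := by
  have h : 16 * N = N * 2 * 2 * 2 * 2 := by ring
  rw [blockLength, h, Nat.log_mul_base (by norm_num) (by omega),
    Nat.log_mul_base (by norm_num) (by omega), Nat.log_mul_base (by norm_num) (by omega),
    Nat.log_mul_base (by norm_num) (by omega)]

theorem add_six_le_two_pow_blockLength {N : ℕ} (hN : 1 ≤ N) : N + 6 ≤ 2 ^ blockLength N := by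
  have h : N < 2 ^ (Nat.log 2 N + 1) := Nat.lt_pow_succ_log_self (by norm_num) N
  rw [blockLength_eq hN, show Nat.log 2 N + 4 = Nat.log 2 N + 1 + 3 by ring, pow_add]
  omega

/-- The number of positive exponents `j` with `2 ^ j ≤ 16 N`. -/
theorem sum_eq_blockLength {N : ℕ} (hN : 1 ≤ N) :
    ∑ j ∈ Finset.range (N + 4), (1 - (1 - (16 * N) >>> (j + 1))) = blockLength N := by
  have hle : blockLength N ≤ N + 4 := by
    rw [blockLength_eq hN]
    have := Nat.log_lt_self 2 (show N ≠ 0 by omega)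
    omega
  have h : ∀ j, 1 - (1 - (16 * N) >>> (j + 1)) = if j < blockLength N then 1 else 0 := by
    intro j
    have hj : j < blockLength N ↔ 2 ^ (j + 1) ≤ 16 * N := by
      rw [blockLength, ← Nat.le_log_iff_pow_le (by norm_num) (by omega)]
      omega
    rw [Nat.shiftRight_eq_div_pow]
    split_ifs with h'
    · have := Nat.div_pos (hj.1 h') (by positivity)
      omega
    · rw [Nat.div_eq_of_lt (by rw [hj] at h'; omega)]
  simp only [h]
  rw [Finset.sum_ite, Finset.sum_const_zero, add_zero, Finset.sum_const, smul_eq_mul, mul_one]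
  rw [show (Finset.range (N + 4)).filter (fun j => j < blockLength N) =
    Finset.range (blockLength N) by ext j; simp; omega, Finset.card_range]

/-- The items of the straight-line program for a graph. -/
def slpItems {n : ℕ} (G : SimpleGraph (Fin n)) (hn : 0 < n) (k : ℕ) : List (ℕ × ℕ) :=
  chainItems 2 (auxSymbols (blockCode (blockLength (n ^ k))) (n ^ k) (cliqueLists G hn k))
    (mainSymbols (blockCode (blockLength (n ^ k))) 2 (n ^ k) (cliqueLists G hn k))

/-- The output of the whole program on a graph. -/
def output {n : ℕ} (G : SimpleGraph (Fin n)) (hn : 0 < n) (k : ℕ) : List Event :=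
  ((slpItems G hn k).map fun p => Event.sym p.1 p.2) ++
    (dictList G k).flatMap (wordEvents (blockLength (n ^ k)))

namespace Cmd

/-- The program that runs after the variables have been set has the expected values in its
variables. -/
theorem exists_main_env {n : ℕ} (G : SimpleGraph (Fin n)) (hn : 0 < n) (k : ℕ) {env : ℕ → ℕ}
    (henv : env 0 = n) : ∃ env', Ctx n k (blockLength (n ^ k)) env' ∧
      (env' 3 ≠ 0 ↔ cliqueLists G hn k ≠ []) ∧
      env' 4 = 2 + (auxSymbols (blockCode (blockLength (n ^ k))) (n ^ k)
        (cliqueLists G hn k)).length ∧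
      (main k).out (adjFun G) env = (slpCmd k).out (adjFun G) env' ++
        (dictCmd k).out (adjFun G) env' ∧
      (main k).time (adjFun G) env ≤ 19 * (n ^ k) ^ 2 * ((Expr.npow k).cost +
        ((Expr.var 3).isClique (2 * k)).cost + 30) +
        (slpCmd k).time (adjFun G) env' + (dictCmd k).time (adjFun G) env' := by
  have hN : 1 ≤ n ^ k := Nat.one_le_pow _ _ hn
  have hNN : n ^ k * n ^ k = n ^ (2 * k) := by rw [two_mul, pow_add]
  simp only [main, out, time, Expr.eval, Op.eval, Finset.sum_range_one, flag]
  rw [Expr.eval_npow (n := n) (by simp [henv])]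
  set env₁ := Function.update env 1 (n ^ k) with h₁
  have e1 : env₁ 1 = n ^ k := Function.update_self ..
  simp only [e1, Function.update_self, Function.update_of_ne (show 1 ≠ 2 by norm_num),
    sum_eq_blockLength hN]
  set env₂ := Function.update env₁ 2 (blockLength (n ^ k)) with h₂
  have hc₂ : Ctx n k (blockLength (n ^ k)) env₂ := ⟨by simp [h₂, h₁, henv], by simp [h₂, h₁],
    by simp [h₂]⟩
  set S := ∑ j ∈ Finset.range (n ^ k * n ^ k), ((Expr.var 3).isClique (2 * k)).eval (adjFun G)
    (Function.update env₂ 3 j) with hS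
  have hS0 : S ≠ 0 ↔ cliqueLists G hn k ≠ [] := by
    have h : ∀ j, ((Expr.var 3).isClique (2 * k)).eval (adjFun G) (Function.update env₂ 3 j) ≠ 0 ↔
        IsCliqueIndex G (2 * k) j := fun j => by
      rw [eval_isClique_var (hc₂.update (by norm_num) j), Function.update_self]
    rw [hS, Ne, Finset.sum_eq_zero_iff, cliqueLists, Ne, List.map_eq_nil_iff,
      List.eq_nil_iff_forall_not_mem, hNN]
    simp only [mem_cliqueIndices, Finset.mem_range, not_and, ← h, not_not]
  have hc₃ := hc₂.update (x := 3) (by norm_num) S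
  refine ⟨Function.update (Function.update env₂ 3 S) 4 _, hc₃.update (by norm_num) _, ?_, ?_, rfl,
    ?_⟩
  · rw [← hS0]; simp
  · simp only [Function.update_self, Function.update_of_ne (show 3 ≠ 4 by norm_num),
      Function.update_of_ne (show 1 ≠ 4 by norm_num),
      Function.update_of_ne (show 2 ≠ 4 by norm_num), hc₃.one, hc₃.two, auxSymbols]
    congr 1
    by_cases hAs : cliqueLists G hn k = []
    · have : S = 0 := by by_contra h; exact hS0.1 h hAs
      simp [hAs, this]
    · have h1 : 1 - (1 - S) = 1 := by have := hS0.2 hAs; omega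
      have h2 : ∀ u : List Letter, (u.flatMap (blockCode (blockLength (n ^ k)))).length =
          u.length * blockLength (n ^ k) := by
        intro u
        simp [List.length_flatMap, blockCode, length_bits]
      rw [if_neg hAs, h1, h2, length_f₀, above, List.length_map, List.length_range']
      rw [Nat.add_sub_cancel]
      ring
  · simp only [Expr.cost]
    generalize (Expr.npow k).cost = c₁
    generalize ((Expr.var 3).isClique (2 * k)).cost = c₂
    generalize slpCmd k = p
    generalize dictCmd k = q
    generalize p.time _ _ = t₁
    generalize q.time _ _ = t₂
    generalize n ^ k = N at *
    have hN2 : N ≤ N ^ 2 := Nat.le_self_pow (by norm_num) N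
    have hc₁ : c₁ ≤ N ^ 2 * c₁ := Nat.le_mul_of_pos_left _ (by omega)
    have h19 : 19 * N ^ 2 * (c₁ + c₂ + 30) =
        19 * (N ^ 2 * c₁) + 19 * (N ^ 2 * c₂) + 570 * N ^ 2 := by ring
    have hc₂ : N * N * (c₂ + 4) = N ^ 2 * c₂ + 4 * N ^ 2 := by ring
    rw [h19, hc₂]
    generalize N ^ 2 * c₁ = x at *
    generalize N ^ 2 * c₂ = y at *
    generalize N ^ 2 = z at *
    omega

theorem out_main {n : ℕ} (G : SimpleGraph (Fin n)) (hn : 0 < n) (k : ℕ) {env : ℕ → ℕ}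
    (henv : env 0 = n) : (main k).out (adjFun G) env = output G hn k := by
  obtain ⟨env', hc, h3, h4, hout, -⟩ := exists_main_env G hn k henv
  rw [hout, out_slpCmd hn hc h3 h4, out_dictCmd hc]
  rfl

end Cmd

/-! ### The running time -/

namespace Cmd

open WordBreak.Expr (const var op)

variable {E env : ℕ → ℕ} {n k L : ℕ}

theorem time_loop_le {x m C X : ℕ} {b : Expr} {p : Cmd} (hm : 1 ≤ m) (hX : 1 ≤ X)
    (hb : b.eval E env ≤ m)
    (hp : ∀ j < b.eval E env, p.time E (Function.update env x j) ≤ C * X) :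
    (loop x b p).time E env ≤ (b.cost + C + 5) * (m * X) := by
  have h1 : ∑ j ∈ Finset.range (b.eval E env), (p.time E (Function.update env x j) + 2) ≤
      m * (C * X + 2) := by
    refine (Finset.sum_le_card_nsmul _ _ (C * X + 2) fun j hj => ?_).trans ?_
    · have := hp j (Finset.mem_range.1 hj); omega
    · rw [Finset.card_range, smul_eq_mul]
      exact Nat.mul_le_mul_right _ hb
  have h2 : 1 ≤ m * X := Nat.mul_pos hm hX
  have h3 : m ≤ m * X := Nat.le_mul_of_pos_right _ hX
  have h4 : b.cost ≤ b.cost * (m * X) := Nat.le_mul_of_pos_right _ h2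
  have h5 : m * (C * X + 2) = C * (m * X) + 2 * m := by ring
  simp only [time, add_mul]
  omega

theorem time_each_le {x m C X : ℕ} {e c : Expr} {p : Cmd} (hm : 1 ≤ m) (hX : 1 ≤ X)
    (he : e.eval E env ≤ m)
    (hp : ∀ j < e.eval E env, p.time E (Function.update env x j) ≤ C * X) :
    (each x e c p).time E env ≤ (e.cost + c.cost + C + 8) * (m * X) := by
  have h := time_loop_le (x := x) (b := e) (p := ite c p skip) (C := c.cost + C + 3) hm hX he ?_
  · refine h.trans (Nat.mul_le_mul_right _ (by omega))
  · intro j hj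
    have h1 := hp j hj
    have h2 : c.cost ≤ c.cost * X := Nat.le_mul_of_pos_right _ hX
    simp only [time, add_mul]
    split_ifs <;> omega

theorem time_seqs_le {l : List Cmd} {C X : ℕ} (hX : 1 ≤ X) (h : ∀ p ∈ l, p.time E env ≤ C * X) :
    (seqs l).time E env ≤ (l.length * C + 1) * X := by
  induction l with
  | nil => simpa [seqs, time] using hX
  | cons p l ih =>
    have h1 := ih fun q hq => h q (by simp [hq])
    have h2 := h p (by simp)
    have h3 : (seqs (p :: l)).time E env = p.time E env + (seqs l).time E env := rfl
    have h4 : ((p :: l).length * C + 1) * X = C * X + (l.length * C + 1) * X := by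
      rw [List.length_cons]; ring
    omega

theorem time_letter_le {emit : Expr → Cmd} {c : ℕ} (hL : 1 ≤ L) (h2 : env 2 = L) (e : Expr)
    (hemit : ∀ e' j, (emit e').time E (Function.update env 9 j) ≤ e'.cost + c) :
    (letter emit e).time E env ≤ (e.cost + c + 12) * L := by
  have h := time_loop_le (E := E) (env := env) (x := 9) (b := var 2) (C := e.cost + c + 6) (m := L)
    (p := emit (op .mod (op .shr e (var 9)) (const 2))) hL le_rfl (by simp [Expr.eval, h2])
    fun j _ => (hemit _ j).trans (by simp only [Expr.cost]; omega)
  rw [mul_one] at h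
  exact h.trans (Nat.mul_le_mul_right _ (by simp only [Expr.cost]; omega))

theorem time_letter_chr_le (hL : 1 ≤ L) (h2 : env 2 = L) (e : Expr) :
    (letter chr e).time E env ≤ (e.cost + 15) * L :=
  time_letter_le hL h2 e fun _ _ => le_rfl

theorem time_spreadLetter_le (hL : 1 ≤ L) (h2 : env 2 = L) {e : Expr} (he : e.cost ≤ 10) :
    (spreadLetter e).time E env ≤ 76 * L := by
  refine (time_seqs_le (C := 25) hL fun p hp => ?_).trans le_rfl
  simp only [List.mem_cons, List.not_mem_nil, or_false] at hp
  rcases hp with rfl | rfl | rfl <;>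
    refine (time_letter_chr_le hL h2 _).trans (Nat.mul_le_mul_right _ ?_)
  · omega
  all_goals simp [Expr.cost]

theorem time_spreadBelow_le {N : ℕ} (hL : 1 ≤ L) (hN : 1 ≤ N) (h2 : env 2 = L) {x : ℕ}
    (hx : env x ≤ N) : (spreadBelow x).time E env ≤ 100 * (N * L) := by
  refine (time_loop_le hN hL (by exact hx) fun j _ => time_spreadLetter_le hL
    (by simp [h2]) ?_).trans (Nat.mul_le_mul_right _ ?_) <;> simp [Expr.cost]

theorem time_spreadAbove_le {N : ℕ} (hL : 1 ≤ L) (hN : 1 ≤ N) (h2 : env 2 = L) {x : ℕ}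
    (h1 : env 1 = N) : (spreadAbove x).time E env ≤ 100 * (N * L) := by
  refine (time_loop_le hN hL ?_ fun j _ => time_spreadLetter_le hL (by simp [h2]) ?_).trans
    (Nat.mul_le_mul_right _ ?_)
  · simp [Expr.eval, Op.eval, h1]
  all_goals simp [Expr.cost]

/-- The constants are crude: a dictionary word has at most five parts. -/
theorem time_word_le {X : ℕ} {l : List Cmd} {e : Expr} (hX : 1 ≤ X) (he : e.cost ≤ 50)
    (hl : l.length ≤ 5) (h : ∀ p ∈ l, p.time E env ≤ 100 * X) :
    (word l e).time E env ≤ 601 * X := by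
  refine (time_seqs_le (C := 100) hX fun p hp => ?_).trans (Nat.mul_le_mul_right _ ?_)
  · rcases List.mem_append.1 hp with hp | hp
    · exact h p hp
    · rw [List.mem_singleton.1 hp]
      simp only [time, Expr.cost]
      omega
  · simp only [List.length_append, List.length_singleton]; omega

/-- The bridges dominate: there are up to `N ^ 2` pairs of cliques, and for each of them `O(N)`
letters are written as blocks of length `L`. -/
theorem exists_time_dictCmd (k : ℕ) (hk : 1 ≤ k) : ∃ C, ∀ (n L : ℕ) (E env : ℕ → ℕ), 1 ≤ n →
    1 ≤ L → Ctx n k L env → (dictCmd k).time E env ≤ C * ((n ^ k) ^ 3 * L) := by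
  set c₁ := ((var 5).isClique k).cost with hc₁
  set c₂ := ((var 5).joinsVertex k (var 6)).cost with hc₂
  set c₃ := (op .mul ((var 6).isClique k) ((var 5).joins k (var 6))).cost with hc₃
  refine ⟨5 * (c₁ + c₂ + c₃ + 10000) + 1, fun n L E env hn hL hc => ?_⟩
  have hN : 1 ≤ n ^ k := Nat.one_le_pow _ _ hn
  have hnN : n ≤ n ^ k := Nat.le_self_pow (by omega) n
  obtain ⟨h0, h1, h2⟩ := hc
  set N := n ^ k
  have hX : 1 ≤ N * L := Nat.mul_pos hN hL
  have hX2 : 1 ≤ N * (N * L) := Nat.mul_pos hN hX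
  have hX3 : 1 ≤ N * (N * (N * L)) := Nat.mul_pos hN hX2
  have hL1 : L ≤ N * L := Nat.le_mul_of_pos_left _ hN
  have le1 : N * (N * L) ≤ N * (N * (N * L)) := Nat.le_mul_of_pos_left _ hN
  have hcube : N ^ 3 * L = N * (N * (N * L)) := by ring
  have letterL : ∀ env', env' 2 = L → ∀ e : Expr, e.cost ≤ 10 →
      (spreadLetter e).time E env' ≤ 100 * (N * L) := fun env' h e he =>
    (time_spreadLetter_le hL h he).trans (Nat.mul_le_mul (by norm_num) hL1)
  rw [hcube]
  refine time_seqs_le hX3 fun p hp => ?_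
  simp only [List.mem_cons, List.not_mem_nil, or_false] at hp
  rcases hp with rfl | rfl | rfl | rfl | rfl
  · refine (time_each_le (C := 601) hN hX (by exact h1.le) fun j hj =>
      time_word_le hX ?_ ?_ ?_).trans
      (Nat.mul_le_mul ?_ le1)
    · simp [Expr.cost]
    · simp
    · intro p hp
      simp only [List.mem_cons, List.not_mem_nil, or_false] at hp
      have hj' : j < N := h1 ▸ hj
      rcases hp with rfl | rfl
      · exact letterL _ (by simp [h2]) _ (by simp [Expr.cost])
      · exact time_spreadBelow_le hL hN (by simp [h2]) (by simp [hj'.le])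
    · simp only [Expr.cost]; omega
  · refine (time_each_le (C := 601) hN hX (by exact h1.le) fun j hj =>
      time_word_le hX ?_ ?_ ?_).trans
      (Nat.mul_le_mul ?_ le1)
    · simp [Expr.cost]
    · simp
    · intro p hp
      rw [List.mem_singleton.1 hp]
      exact time_spreadAbove_le hL hN (by simp [h2]) (by simp [h1])
    · simp only [Expr.cost]; omega
  · refine (time_each_le (C := 1 + c₂ + 601 + 8) hN hX2 (by exact h1.le) fun j hj =>
      time_each_le hN hX ?_ fun i hi => time_word_le hX ?_ ?_ ?_).trans (Nat.mul_le_mul_right _ ?_)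
    · simpa [Expr.eval, h0] using hnN
    · simp [Expr.cost]
    · simp
    · intro p hp
      simp only [List.mem_cons, List.not_mem_nil, or_false] at hp
      have hj' : j < N := h1 ▸ hj
      rcases hp with rfl | rfl | rfl | rfl | rfl
      · exact time_spreadAbove_le hL hN (by simp [h2]) (by simp [h1])
      · exact letterL _ (by simp [h2]) _ (by simp [Expr.cost])
      · exact letterL _ (by simp [h2]) _ (by simp [Expr.cost])
      · exact letterL _ (by simp [h2]) _ (by simp [Expr.cost])
      · exact time_spreadBelow_le hL hN (by simp [h2]) (by simp [hj'.le])
    · simp only [Expr.cost]; omega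
  · refine (time_each_le (C := 1 + c₃ + 601 + 8) hN hX2 (by exact h1.le) fun j hj =>
      time_each_le hN hX ?_ fun i hi => time_word_le hX ?_ ?_ ?_).trans (Nat.mul_le_mul_right _ ?_)
    · simp [Expr.eval, h1]
    · simp [Expr.cost]
    · simp
    · intro p hp
      simp only [List.mem_cons, List.not_mem_nil, or_false] at hp
      have hi' : i < N := by simpa [Expr.eval, h1] using hi
      rcases hp with rfl | rfl | rfl | rfl | rfl
      · exact time_spreadAbove_le hL hN (by simp [h2]) (by simp [h1])
      · exact letterL _ (by simp [h2]) _ (by simp [Expr.cost])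
      · exact letterL _ (by simp [h2]) _ (by simp [Expr.cost])
      · exact letterL _ (by simp [h2]) _ (by simp [Expr.cost])
      · exact time_spreadBelow_le hL hN (by simp [h2]) (by simp [hi'.le])
    · simp only [Expr.cost]; omega
  · have short : ∀ env', env' 2 = L → ∀ l : List Expr, l.length ≤ 5 → (∀ e ∈ l, e.cost ≤ 10) →
        (shortWord l).time E env' ≤ 601 * L := by
      intro env' h l hl he
      refine time_word_le hL (by simp [Expr.cost]) (by simpa using hl) fun p hp => ?_
      obtain ⟨e, he', rfl⟩ := List.mem_map.1 hp
      exact (time_letter_chr_le hL h e).trans (Nat.mul_le_mul_right _ (by have := he e he'; omega))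
    have hloop : ∀ l : List Expr, l.length ≤ 5 → (∀ e ∈ l, e.cost ≤ 10) →
        (loop 5 (var 1) (shortWord l)).time E env ≤ 607 * (N * L) := fun l hl he =>
      (time_loop_le hN hL (by exact h1.le) fun j _ => short _ (by simp [h2]) l hl he).trans
        (Nat.mul_le_mul_right _ (by simp [Expr.cost]))
    have hshort : ∀ l : List Expr, l.length ≤ 5 → (∀ e ∈ l, e.cost ≤ 10) →
        (shortWord l).time E env ≤ 607 * (N * L) := fun l hl he =>
      (short _ h2 l hl he).trans (Nat.mul_le_mul (by norm_num) hL1)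
    refine (time_seqs_le (C := 607) hX fun p hp => ?_).trans (Nat.mul_le_mul ?_ ?_)
    · simp only [List.map_cons, List.map_nil, List.cons_append, List.nil_append, List.mem_cons,
        List.not_mem_nil, or_false] at hp
      rcases hp with rfl | rfl | rfl | rfl | rfl | rfl | rfl | rfl | rfl | rfl | rfl | rfl | rfl
      all_goals first
        | exact hloop _ (by simp) (by simp [Expr.cost])
        | exact hshort _ (by simp) (by simp [Expr.cost])
    · simp only [List.map_cons, List.map_nil, List.cons_append, List.nil_append, List.length_cons,
        List.length_nil]
      omega
    · exact (Nat.le_mul_of_pos_left _ hN).trans le1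

/-- Each of the `N ^ 2` candidates for a `2k`-clique takes time `O(L)`, because the number of its
symbols is bounded, up to their coding as blocks of length `L`. -/
theorem exists_time_slpCmd (k : ℕ) : ∃ C, ∀ (n L : ℕ) (E env : ℕ → ℕ), 1 ≤ n →
    1 ≤ L → Ctx n k L env → (slpCmd k).time E env ≤ C * ((n ^ k) ^ 3 * L) := by
  have hbound : ∀ es : List (Option Expr), ∃ c, ∀ e ∈ es, ∀ e', e = some e' → e'.cost ≤ c := by
    intro es
    induction es with
    | nil => exact ⟨0, by simp⟩
    | cons e es ih =>
      obtain ⟨c, hc⟩ := ih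
      refine ⟨c + e.elim 0 Expr.cost, fun e₁ he₁ e' he' => ?_⟩
      rcases List.mem_cons.1 he₁ with rfl | h
      · subst he'; simp
      · have := hc e₁ h e' he'; omega
  obtain ⟨c₂, hc₂⟩ := hbound (blockExprs (2 * k))
  set l := (blockExprs (2 * k)).length with hl
  set c₁ := ((var 5).isClique (2 * k)).cost with hc₁
  refine ⟨5 * (c₁ + l * (c₂ + 30) + 1000) + 1, fun n L E env hn hL hc => ?_⟩
  have hN : 1 ≤ n ^ k := Nat.one_le_pow _ _ hn
  obtain ⟨-, h1, h2⟩ := hc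
  set N := n ^ k
  have hX3 : 1 ≤ N ^ 3 * L := Nat.mul_pos (Nat.pow_pos hN) hL
  have hle1 : L ≤ N ^ 3 * L := Nat.le_mul_of_pos_left _ (Nat.pow_pos hN)
  have hle2 : N * L ≤ N ^ 3 * L := Nat.mul_le_mul_right _ (Nat.le_self_pow (by norm_num) _)
  have hle3 : N * N * L ≤ N ^ 3 * L := Nat.mul_le_mul_right _ (by
    have := Nat.pow_le_pow_right hN (show 2 ≤ 3 by norm_num)
    rwa [pow_two] at this)
  have token_le : ∀ env', env' 2 = L → ∀ (e : Option Expr) (c : ℕ), (∀ e', e = some e' →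
      e'.cost ≤ c) → (token e).time E env' ≤ (c + 30) * L := by
    intro env' h e c he
    match e with
    | none =>
      refine le_trans ?_ (Nat.mul_le_mul (show 30 ≤ c + 30 by omega) hL)
      simp [token, time, Expr.cost]
    | some e =>
      refine (time_letter_le (c := 10) hL h e fun e' j => ?_).trans
        (Nat.mul_le_mul_right _ (by have := he e rfl; omega))
      simp only [time, Expr.cost]; omega
  refine time_seqs_le hX3 fun p hp => ?_
  simp only [List.mem_cons, List.not_mem_nil, or_false] at hp
  rcases hp with rfl | rfl | rfl | rfl | rfl
  · exact le_trans (by simp [time, Expr.cost]) (Nat.mul_le_mul (show 11 ≤ _ by omega) hX3)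
  · exact le_trans (by simp [time, Expr.cost]) (Nat.mul_le_mul (show 11 ≤ _ by omega) hX3)
  · refine (time_loop_le (C := 130) hN hL ?_ fun j hj => (time_seqs_le (C := 43) hL ?_).trans
      (by simp)).trans (Nat.mul_le_mul ?_ hle2)
    · simp only [Expr.eval, Op.eval, flag, h1]
      exact (Nat.mul_le_mul_left N (Nat.sub_le 1 _)).trans (by omega)
    · intro p hp
      simp only [List.mem_cons, List.not_mem_nil, or_false] at hp
      rcases hp with rfl | rfl | rfl
      all_goals
        refine (time_letter_le (c := 10) hL (by simp [h2]) _ fun e' j => ?_).trans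
          (Nat.mul_le_mul_right _ (by simp [Expr.cost]))
        simp only [time, Expr.cost]; omega
    · simp only [flag, Expr.cost]; omega
  · refine (time_each_le (C := l * (c₂ + 30) + 1) (Nat.mul_pos hN hN) hL ?_ fun j hj =>
      (time_seqs_le (C := c₂ + 30) hL fun p hp => ?_).trans (by rw [List.length_map])).trans
        (Nat.mul_le_mul ?_ hle3)
    · simp [Expr.eval, Op.eval, h1]
    · obtain ⟨e, he, rfl⟩ := List.mem_map.1 hp
      exact token_le _ (by simp [h2]) e c₂ (hc₂ e he)
    · simp only [Expr.cost]; omega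
  · refine (time_seqs_le (C := 31) hL fun p hp => ?_).trans (Nat.mul_le_mul ?_ hle1)
    · obtain ⟨e, he, rfl⟩ := List.mem_map.1 hp
      refine token_le _ h2 e 1 fun e' he' => ?_
      subst he'
      simp only [List.mem_cons, List.not_mem_nil, or_false, or_self, Option.some.injEq] at he
      rw [he, Expr.cost]
    · simp

theorem exists_time_main (k : ℕ) (hk : 1 ≤ k) : ∃ C, ∀ (n : ℕ) (G : SimpleGraph (Fin n))
    (env : ℕ → ℕ), 1 ≤ n → env 0 = n →
      (main k).time (adjFun G) env ≤ C * ((n ^ k) ^ 3 * blockLength (n ^ k)) := by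
  obtain ⟨C₁, h₁⟩ := exists_time_slpCmd k
  obtain ⟨C₂, h₂⟩ := exists_time_dictCmd k hk
  refine ⟨19 * ((Expr.npow k).cost + ((var 3).isClique (2 * k)).cost + 30) + C₁ + C₂,
    fun n G env hn henv => ?_⟩
  have hN : 1 ≤ n ^ k := Nat.one_le_pow _ _ hn
  have hL : 1 ≤ blockLength (n ^ k) := by rw [blockLength_eq hN]; omega
  obtain ⟨env', hc, -, -, -, ht⟩ := exists_main_env G hn k henv
  have t₁ := h₁ n _ (adjFun G) env' hn hL hc
  have t₂ := h₂ n _ (adjFun G) env' hn hL hc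
  refine ht.trans ?_
  have h : (n ^ k) ^ 2 ≤ (n ^ k) ^ 3 * blockLength (n ^ k) :=
    (Nat.pow_le_pow_right hN (by norm_num)).trans (Nat.le_mul_of_pos_right _ hL)
  have h' := Nat.mul_le_mul_left (19 * ((Expr.npow k).cost +
    ((var 3).isClique (2 * k)).cost + 30)) h
  rw [add_mul, add_mul]
  linarith

/-! ### Tameness -/

theorem tame_letter {emit : Expr → Cmd} {d : ℕ} (hd : d ≤ 9)
    (hemit : ∀ e : Expr, e.Tame → (emit e).Tame 10) {e : Expr} (he : e.Tame) :
    (letter emit e).Tame d :=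
  ⟨hd, trivial, hemit _ ⟨Expr.tame_mod, ⟨Expr.tame_shr, he, trivial⟩, trivial⟩⟩

theorem tame_spreadLetter {d : ℕ} (hd : d ≤ 9) {e : Expr} (he : e.Tame) :
    (spreadLetter e).Tame d := by
  refine tame_seqs fun p hp => ?_
  simp only [List.mem_cons, List.not_mem_nil, or_false] at hp
  rcases hp with rfl | rfl | rfl
  · exact tame_letter hd (by exact fun e he => he) he
  all_goals exact tame_letter hd (by exact fun e he => he) trivial

theorem tame_spreadBelow {d : ℕ} (hd : d ≤ 7) (x : ℕ) : (spreadBelow x).Tame d :=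
  ⟨hd, trivial, tame_spreadLetter (by norm_num)
    ⟨Expr.tame_add, ⟨Expr.tame_sub, trivial, trivial⟩, trivial⟩⟩

theorem tame_spreadAbove {d : ℕ} (hd : d ≤ 7) (x : ℕ) : (spreadAbove x).Tame d :=
  ⟨hd, ⟨Expr.tame_sub, trivial, trivial⟩, tame_spreadLetter (by norm_num)
    ⟨Expr.tame_add, ⟨Expr.tame_sub, trivial, trivial⟩, trivial⟩⟩

theorem tame_word {l : List Cmd} {e : Expr} {d : ℕ} (hl : ∀ p ∈ l, p.Tame d) (he : e.Tame) :
    (word l e).Tame d := by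
  refine tame_seqs fun p hp => ?_
  rcases List.mem_append.1 hp with hp | hp
  · exact hl p hp
  · rw [List.mem_singleton.1 hp]
    exact ⟨Expr.tame_mul, he, trivial⟩

theorem tame_dictCmd (k : ℕ) : (dictCmd k).Tame 5 := by
  have v5 : (var 5).Tame := trivial
  have v6 : (var 6).Tame := trivial
  have s5 : (op .sub (var 1) (var 5)).Tame := ⟨Expr.tame_sub, trivial, trivial⟩
  have a6 : ∀ x, (op .add (var x) (const 6)).Tame := fun x => ⟨Expr.tame_add, trivial, trivial⟩
  have mul : ∀ {e f : Expr}, e.Tame → f.Tame → (op .mul e f).Tame := fun he hf =>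
    ⟨Expr.tame_mul, he, hf⟩
  have add : ∀ {e f : Expr}, e.Tame → f.Tame → (op .add e f).Tame := fun he hf =>
    ⟨Expr.tame_add, he, hf⟩
  have c : ∀ c, (const c).Tame := fun _ => trivial
  refine tame_seqs fun p hp => ?_
  simp only [List.mem_cons, List.not_mem_nil, or_false] at hp
  rcases hp with rfl | rfl | rfl | rfl | rfl
  · refine ⟨le_rfl, trivial, v5.isClique k, tame_word ?_ (mul (c 3) (add v5 (c 1))), trivial⟩
    intro p hp
    simp only [List.mem_cons, List.not_mem_nil, or_false] at hp
    rcases hp with rfl | rfl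
    · exact tame_spreadLetter (by norm_num) trivial
    · exact tame_spreadBelow (by norm_num) _
  · refine ⟨le_rfl, trivial, v5.isClique k, tame_word ?_ (mul (c 3) s5), trivial⟩
    intro p hp
    rw [List.mem_singleton.1 hp]
    exact tame_spreadAbove (by norm_num) _
  · refine ⟨le_rfl, trivial, v5.isClique k, ⟨le_rfl, trivial, v5.joinsVertex v6 k,
      tame_word ?_ (mul (c 3) (add (trivial : (var 1).Tame) (c 3))), trivial⟩, trivial⟩
    intro p hp
    simp only [List.mem_cons, List.not_mem_nil, or_false] at hp
    rcases hp with rfl | rfl | rfl | rfl | rfl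
    · exact tame_spreadAbove (by norm_num) _
    · exact tame_spreadLetter (by norm_num) trivial
    · exact tame_spreadLetter (by norm_num) (a6 6)
    · exact tame_spreadLetter (by norm_num) trivial
    · exact tame_spreadBelow (by norm_num) _
  · refine ⟨le_rfl, trivial, v5.isClique k, ⟨le_rfl, trivial,
      mul (v6.isClique k) (v5.joins v6 k), tame_word ?_ (mul (c 3) (add s5 (add (c 3) v6))),
      trivial⟩, trivial⟩
    intro p hp
    simp only [List.mem_cons, List.not_mem_nil, or_false] at hp
    rcases hp with rfl | rfl | rfl | rfl | rfl
    · exact tame_spreadAbove (by norm_num) _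
    · exact tame_spreadLetter (by norm_num) trivial
    · exact tame_spreadLetter (by norm_num) trivial
    · exact tame_spreadLetter (by norm_num) trivial
    · exact tame_spreadBelow (by norm_num) _
  · have short : ∀ {d : ℕ}, d ≤ 9 → ∀ l : List Expr, (∀ e ∈ l, e.Tame) → (shortWord l).Tame d := by
      intro d hd l hl
      refine tame_word (fun p hp => ?_) trivial
      obtain ⟨e, he, rfl⟩ := List.mem_map.1 hp
      exact tame_letter hd (by exact fun e he => he) (hl e he)
    refine tame_seqs fun p hp => ?_
    simp only [List.map_cons, List.map_nil, List.cons_append, List.nil_append, List.mem_cons,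
      List.not_mem_nil, or_false] at hp
    rcases hp with rfl | rfl | rfl | rfl | rfl | rfl | rfl | rfl | rfl | rfl | rfl | rfl | rfl
    all_goals first
      | exact short (by norm_num) _ (by simp [c])
      | exact ⟨le_rfl, trivial, short (by norm_num) _ (by simp [c, a6])⟩

theorem tame_token {e : Option Expr} (he : ∀ e', e = some e' → e'.Tame) {d : ℕ} (hd : d ≤ 9) :
    (token e).Tame d := by
  match e with
  | none => exact ⟨trivial, Expr.tame_sub, trivial, trivial⟩
  | some e => exact tame_letter hd (by exact fun e he => ⟨trivial, he⟩) (he e rfl)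

theorem tame_flag : flag.Tame := ⟨Expr.tame_sub, trivial, Expr.tame_sub, trivial, trivial⟩

theorem tame_slpCmd (k : ℕ) : (slpCmd k).Tame 5 := by
  have hspread : ∀ {e₀ : Expr}, e₀.Tame → ∀ e ∈ spreadExprs e₀, ∀ e', e = some e' → e'.Tame := by
    intro e₀ h₀ e he e' he'
    simp only [spreadExprs, List.mem_cons, List.not_mem_nil, or_false] at he
    subst he'
    rcases he with h | h | h <;> cases h
    · trivial
    · exact h₀
    · trivial
  have hgadget : ∀ e ∈ gadgetExprs (2 * k), ∀ e', e = some e' → e'.Tame := by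
    intro e he
    simp only [gadgetExprs, List.mem_append, List.mem_cons, List.mem_flatMap,
      List.not_mem_nil, or_false] at he
    rcases he with h | rfl | ⟨i, -, h | h | h | rfl⟩ | h
    · exact hspread (by trivial) e h
    · simp
    · exact hspread (by trivial) e h
    · exact hspread (by exact ⟨Expr.tame_add, Expr.Tame.digit (by trivial) i, trivial⟩) e h
    · exact hspread (by trivial) e h
    · simp
    · exact hspread (by trivial) e h
  have hblock : ∀ e ∈ blockExprs (2 * k), ∀ e', e = some e' → e'.Tame := by
    intro e he
    simp only [blockExprs, List.mem_append] at he
    rcases he with h | h | h | h | h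
    · exact hspread (by trivial) e h
    · exact hgadget e h
    · exact hspread (by trivial) e h
    · exact hgadget e h
    · exact hspread (by trivial) e h
  refine tame_seqs fun p hp => ?_
  simp only [List.mem_cons, List.not_mem_nil, or_false] at hp
  rcases hp with rfl | rfl | rfl | rfl | rfl
  · exact ⟨trivial, trivial⟩
  · exact ⟨trivial, trivial⟩
  · refine ⟨le_rfl, ⟨Expr.tame_mul, trivial, tame_flag⟩, tame_seqs fun p hp => ?_⟩
    simp only [List.mem_cons, List.not_mem_nil, or_false] at hp
    rcases hp with rfl | rfl | rfl
    · exact tame_letter (by norm_num) (by exact fun e he => ⟨trivial, he⟩) trivial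
    · exact tame_letter (by norm_num) (by exact fun e he => ⟨trivial, he⟩)
        ⟨Expr.tame_add, ⟨Expr.tame_sub, trivial, trivial⟩, trivial⟩
    · exact tame_letter (by norm_num) (by exact fun e he => ⟨trivial, he⟩) trivial
  · refine ⟨le_rfl, ⟨Expr.tame_mul, trivial, trivial⟩, Expr.Tame.isClique (by trivial) _,
      tame_seqs fun p hp => ?_, trivial⟩
    obtain ⟨e, he, rfl⟩ := List.mem_map.1 hp
    exact tame_token (hblock e he) (by norm_num)
  · refine tame_seqs fun p hp => ?_
    obtain ⟨e, he, rfl⟩ := List.mem_map.1 hp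
    refine tame_token (fun e' he' => ?_) (by norm_num)
    subst he'
    simp only [List.mem_cons, List.not_mem_nil, or_false, or_self, Option.some.injEq] at he
    rw [he]
    trivial

theorem tame_main (k : ℕ) : (main k).Tame 1 :=
  ⟨le_rfl, trivial, Expr.tame_npow k, le_rfl, ⟨Expr.tame_add, trivial, trivial⟩,
    ⟨Expr.tame_sub, trivial, Expr.tame_sub, trivial, Expr.tame_shr,
      ⟨Expr.tame_mul, trivial, trivial⟩, Expr.tame_add, trivial, trivial⟩,
    le_rfl, ⟨Expr.tame_mul, trivial, trivial⟩, Expr.Tame.isClique (by trivial) _, le_rfl, trivial,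
    ⟨Expr.tame_add, trivial, Expr.tame_mul, ⟨Expr.tame_mul, trivial, tame_flag⟩,
      Expr.tame_mul, trivial, trivial⟩, tame_slpCmd k, tame_dictCmd k⟩

end Cmd

/-! ### The reduction on the word RAM -/

/-- The environment of the program for a graph with `n` vertices. -/
def inputEnv (n : ℕ) : ℕ → ℕ := Function.update (fun _ => 0) 0 n

theorem inputEnv_zero (n : ℕ) : inputEnv n 0 = n := Function.update_self ..

/-- Move the adjacency matrix to array `5`, and set up the registers. -/
def prologue : Prog :=
  .seq (.const 4 1) (.seq (.op .add (varReg 0) 0 1) (.seq (.op .mul (tmpReg 0) 0 0)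
    (.seq (.loop (tmpReg 0) (.seq (.op .sub (tmpReg 0) (tmpReg 0) 4)
        (.seq (.load (tmpReg 1) 0 (tmpReg 0)) (.seq (.store 5 (tmpReg 0) (tmpReg 1))
          (.seq (.const (tmpReg 1) 0) (.store 0 (tmpReg 0) (tmpReg 1)))))))
      (.const 0 0))))

/-- Erase the adjacency matrix and the auxiliary registers, and write the starting nonterminal. -/
def epilogue : Prog :=
  .seq (.op .mul (tmpReg 0) (varReg 0) (varReg 0))
    (.seq (.loop (tmpReg 0) (.seq (.op .sub (tmpReg 0) (tmpReg 0) 4)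
        (.store 5 (tmpReg 0) (tmpReg 1))))
      (.seq (.const (varReg 0) 0) (.seq (.const 3 0) (.seq (.op .sub 1 0 4) (.const 4 0)))))

/-- The program of the reduction. -/
def reduction (k : ℕ) : Prog := .seq prologue (.seq (Cmd.main k).compile epilogue)

/-- The arrays while the matrix is moved, if `j` entries remain. -/
def movingArrs (E : ℕ → ℕ) (j : ℕ) : ℕ → ℕ → ℕ
  | 0 => fun i => if i < j then E i else 0
  | 5 => fun i => if j ≤ i then E i else 0
  | _ => fun _ => 0

theorem graphStore_eq {n : ℕ} (G : SimpleGraph (Fin n)) : graphStore G =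
    layout (Function.update (fun _ => 0) 0 n) (fun _ => 0) (fun _ => 0)
      (movingArrs (adjFun G) (n * n)) := by
  refine Store.ext (funext fun x => ?_) (funext fun a => funext fun i => ?_)
  · simp only [graphStore, layout, Function.update_apply]
    split_ifs <;> first | rfl | omega
  · have h0 : ∀ i, n * n ≤ i → adjFun G i = 0 := fun i h => adjFun_of_ge G h
    match a with
    | 0 =>
      simp only [graphStore, layout, movingArrs, true_and]
      by_cases hi : i < n * n
      · rw [if_pos hi]; rfl
      · rw [if_neg hi]; exact h0 i (by omega)
    | 5 =>
      simp only [graphStore, layout, movingArrs]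
      rw [if_neg fun h => absurd h.1 (by norm_num)]
      split_ifs with h
      · exact (h0 i h).symm
      · rfl
    | 1 | 2 | 3 | 4 | a + 6 => simp [graphStore, layout, movingArrs]

/-- The prologue turns the initial store into that of the program with output: nothing is written
yet, and variable `0` holds `n`. -/
theorem runs_prologue {n W : ℕ} (G : SimpleGraph (Fin n)) (h1 : 1 ≤ W) (hn : n ≤ W)
    (hnn : n * n ≤ W) : Runs W prologue (graphStore G) (6 * (n * n) + 5)
      (st (adjFun G) (inputEnv n) []) := by
  rw [graphStore_eq]
  set E := adjFun G with hE
  set R := Function.update (Function.update (fun _ => 0) 0 n) 4 1 with hR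
  have hR4 : R 4 = 1 := Function.update_self ..
  set S : ℕ → Store := fun j => layout R (inputEnv n) (Function.update (fun _ => 0) 0 j)
    (movingArrs E j) with hS
  have hbody : ∀ j < n * n, Runs W (.seq (.op .sub (tmpReg 0) (tmpReg 0) 4)
        (.seq (.load (tmpReg 1) 0 (tmpReg 0)) (.seq (.store 5 (tmpReg 0) (tmpReg 1))
          (.seq (.const (tmpReg 1) 0) (.store 0 (tmpReg 0) (tmpReg 1))))))
      (S (j + 1)) 5 (S j) := by
    intro j hj
    refine (Runs.op (v := j) ?_ (by omega) layout_setTmp).seq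
      ((Runs.load (v := E j) ?_ ((adjFun_le_one G j).trans h1) layout_setTmp).seq
      ((Runs.store (i := j) (v := E j) ?_ ?_ ((adjFun_le_one G j).trans h1) layout_setArr).seq
      ((Runs.const (Nat.zero_le _) layout_setTmp).seq
      (Runs.store (i := j) (v := 0) ?_ ?_ (Nat.zero_le _) ?_) le_rfl) le_rfl) le_rfl) le_rfl
    · rw [layout_tmpReg, layout_reg (by norm_num), hR4, Function.update_self]
      rfl
    · rw [layout_tmpReg, Function.update_self, layout_arr]
      simp [movingArrs]
    · rw [layout_tmpReg, Function.update_of_ne (by norm_num), Function.update_self]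
    · rw [layout_tmpReg, Function.update_self]
    · rw [layout_tmpReg, Function.update_of_ne (by norm_num),
        Function.update_of_ne (by norm_num), Function.update_self]
    · rw [layout_tmpReg, Function.update_self]
    · rw [layout_setArr, hS]
      simp only
      congr 1
      · funext d
        simp only [Function.update_apply]
        split_ifs <;> first | rfl | omega
      · funext a i
        match a with
        | 0 =>
          rw [Function.update_self, Function.update_of_ne (show (0 : ℕ) ≠ 5 by norm_num)]
          by_cases hi : i = j
          · rw [hi, Function.update_self]
            simp [movingArrs]
          · rw [Function.update_of_ne hi]
            simp only [movingArrs]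
            split_ifs <;> first | rfl | omega
        | 5 =>
          rw [Function.update_of_ne (show (5 : ℕ) ≠ 0 by norm_num), Function.update_self]
          by_cases hi : i = j
          · rw [hi, Function.update_self]
            simp [movingArrs]
          · rw [Function.update_of_ne hi]
            simp only [movingArrs]
            split_ifs <;> first | rfl | omega
        | 1 | 2 | 3 | 4 | a + 6 => simp [movingArrs]
  have hloop := Runs.countdown (W := W) (x := tmpReg 0) S (fun _ => 5) (n * n)
    (fun j _ => by rw [hS]; simp only [layout_tmpReg, Function.update_self]) hbody
  refine (Runs.const h1 (layout_setReg (by norm_num))).seq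
    ((Runs.op (v := n) ?_ hn layout_setVar).seq
    ((Runs.op (v := n * n) ?_ hnn layout_setTmp).seq
    (hloop.seq (Runs.const (Nat.zero_le _) ?_) le_rfl) le_rfl) le_rfl) ?_
  · rw [layout_reg (by norm_num), layout_reg (by norm_num)]
    rfl
  · rw [layout_reg (by norm_num)]
    rfl
  · rw [hS]
    simp only
    rw [layout_setReg (by norm_num), Cmd.update_zero_zero, st, hR]
    congr 1
    · funext i
      match i with
      | 0 | 1 | 2 | 3 | 4 | i + 5 => simp [regsOf, items, lens, chars]
    · funext a
      match a with
      | 0 | 1 | 2 | 3 | 4 | 5 | a + 6 => simp [movingArrs, arrsOf, items, lens, chars]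
  · simp only [Finset.sum_const, Finset.card_range, smul_eq_mul]
    omega

/-- The registers at the end. -/
def finalRegs (o : List Event) : ℕ → ℕ
  | 0 => (items o).length
  | 1 => (items o).length - 1
  | 2 => (lens o).length
  | _ => 0

theorem update_arrsOf_matrix (E : ℕ → ℕ) (o : List Event) (E' : ℕ → ℕ) :
    Function.update (arrsOf E o) 5 E' = arrsOf E' o := by
  funext a
  match a with
  | 0 | 1 | 2 | 3 | 4 | 5 | a + 6 => simp [arrsOf]

/-- The epilogue leaves nothing in the store but the output and its size. -/
theorem runs_epilogue {n W : ℕ} {E : ℕ → ℕ} (hE : ∀ i, n * n ≤ i → E i = 0) (o : List Event)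
    (hnn : n * n ≤ W) (ho : o.length ≤ W) : Runs W epilogue (st E (inputEnv n) o)
      (3 * (n * n) + 6)
      (layout (finalRegs o) (fun _ => 0) (fun _ => 0) (arrsOf (fun _ => 0) o)) := by
  set S : ℕ → Store := fun j => layout (regsOf o) (inputEnv n) (Function.update (fun _ => 0) 0 j)
    (arrsOf (fun i => if i < j then E i else 0) o) with hS
  have hbody : ∀ j < n * n, Runs W (.seq (.op .sub (tmpReg 0) (tmpReg 0) 4)
        (.store 5 (tmpReg 0) (tmpReg 1))) (S (j + 1)) 2 (S j) := by
    intro j hj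
    refine (Runs.op (v := j) ?_ (by omega) layout_setTmp).seq
      (Runs.store (i := j) (v := 0) ?_ ?_ (Nat.zero_le _) ?_) le_rfl
    · rw [layout_tmpReg, layout_reg (by norm_num), Function.update_self]
      rfl
    · rw [layout_tmpReg, Function.update_self]
    · rw [layout_tmpReg, Function.update_of_ne (by norm_num), Function.update_of_ne (by norm_num)]
    · rw [layout_setArr, update_arrsOf_matrix, Function.update_idem, hS]
      simp only
      congr 2
      funext i
      simp only [Function.update_apply, arrsOf]
      split_ifs <;> first | rfl | omega
  have hloop := Runs.countdown (W := W) (x := tmpReg 0) S (fun _ => 2) (n * n)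
    (fun j _ => by rw [hS]; simp only [layout_tmpReg, Function.update_self]) hbody
  have hlen := Cmd.length_items_le o
  have h0 : (fun i => if i < n * n then E i else 0) = E := by
    funext i
    split_ifs with h
    · rfl
    · exact (hE i (by omega)).symm
  refine (Runs.op (v := n * n) ?_ hnn (s' := S (n * n)) ?_).seq
    (hloop.seq ((Runs.const (Nat.zero_le _) layout_setVar).seq
    ((Runs.const (Nat.zero_le _) (layout_setReg (by norm_num))).seq
    ((Runs.op (v := (items o).length - 1) ?_ (by omega) (layout_setReg (by norm_num))).seq
    (Runs.const (Nat.zero_le _) ?_) le_rfl) le_rfl) le_rfl) le_rfl) ?_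
  · rw [st, layout_varReg]
    rfl
  · rw [st, layout_setTmp, hS]
    simp only [h0]
  · rw [layout_reg (by norm_num), layout_reg (by norm_num)]
    rfl
  · rw [layout_setReg (by norm_num), Cmd.update_zero_zero, inputEnv, Function.update_idem,
      Cmd.update_zero_zero]
    congr 1
    funext i
    match i with
    | 0 | 1 | 2 | 3 | 4 | i + 5 => simp [regsOf, finalRegs]
  · simp only [Finset.sum_const, Finset.card_range, smul_eq_mul]
    omega

/-! ### The instance that is written -/

/-- The second component of an item is a nonterminal if the item stands for two nonterminals, and
one of the `a` letters otherwise. -/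
theorem chainItems_spec {a : ℕ} {us ms : List ℕ} (hus : ∀ x ∈ us, x < a)
    (hms : ∀ x ∈ ms, x < a + us.length) (hhead : ∀ x ∈ ms.head?, x < a) {r : ℕ}
    (hr : r < (chainItems a us ms).length) :
    ((chainItems a us ms)[r].1 < r → (chainItems a us ms)[r].2 < (chainItems a us ms).length) ∧
      (r ≤ (chainItems a us ms)[r].1 → (chainItems a us ms)[r].2 < a) := by
  have hlen := length_chainItems a us ms
  rcases chain_cases hr with h | ⟨j, hj, rfl⟩ | ⟨j, hj, rfl⟩
  · rw [chainItems_leaf h hr]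
    exact ⟨fun _ => hr, fun _ => h⟩
  · rw [chainItems_aux hj hr]
    have := hus _ (List.getElem_mem hj)
    exact ⟨fun _ => by simp only; omega, fun _ => this⟩
  · rw [chainItems_main hj hr]
    have := hms _ (List.getElem_mem hj)
    refine ⟨fun _ => by simp only; omega, fun h => ?_⟩
    obtain rfl : j = 0 := by simp only at h; omega
    exact hhead _ (by rw [List.head?_eq_getElem?, List.getElem?_eq_getElem hj]; rfl)

theorem mem_grammarOf_rules {s : ℕ} (start : Fin s) (rhs : Fin s → ℕ ⊕ (Fin s × Fin s))
    (r : ContextFreeRule ℕ (Fin s)) :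
    r ∈ (grammarOf start rhs).rules ↔ ∃ v, r = slpRule rhs v := by
  refine Finset.mem_image.trans ?_
  simp only [Finset.mem_univ, true_and]
  refine exists_congr fun v => ?_
  rw [slpRule]
  cases rhs v <;> exact eq_comm

section ToStore

variable (I : Instance) {i : ℕ}

theorem toStore_arr_zero (h : i < I.numNT) :
    I.toStore.arr 0 i = (I.rhs ⟨i, h⟩).elim (fun _ => 0) fun _ => 1 := by
  change dite _ _ _ = _
  rw [dif_pos h]
  cases I.rhs ⟨i, h⟩ <;> rfl

theorem toStore_arr_one (h : i < I.numNT) :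
    I.toStore.arr 1 i = (I.rhs ⟨i, h⟩).elim (fun a => a) fun p => (p.1 : ℕ) := by
  change dite _ _ _ = _
  rw [dif_pos h]
  cases I.rhs ⟨i, h⟩ <;> rfl

theorem toStore_arr_two (h : i < I.numNT) :
    I.toStore.arr 2 i = (I.rhs ⟨i, h⟩).elim (fun _ => 0) fun p => (p.2 : ℕ) := by
  change dite _ _ _ = _
  rw [dif_pos h]
  cases I.rhs ⟨i, h⟩ <;> rfl

end ToStore

section Reduced

variable {n : ℕ} (G : SimpleGraph (Fin n)) (hn : 0 < n) (k : ℕ)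

theorem two_le_blockLength {N : ℕ} (hN : 1 ≤ N) : 2 ≤ blockLength N := by
  rw [blockLength_eq hN]; omega

theorem blockCode_lt_two {L c : ℕ} {x : Letter} (h : c ∈ blockCode L x) : c < 2 := bits_lt_two h

/-- Both bits occur in the block of `μ`, so both letters are used even if the string is `μ μ`. -/
theorem mem_blockCode_mu {L c : ℕ} (hL : 2 ≤ L) (hc : c < 2) : c ∈ blockCode L mu := by
  simp only [blockCode, bits, List.mem_map, List.mem_reverse, List.mem_range, letterIndex]
  interval_cases c
  · exact ⟨1, by omega, rfl⟩
  · exact ⟨0, by omega, rfl⟩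

theorem lt_two_of_mem_auxSymbols {L N c : ℕ} {As : List (List (Fin n))}
    (h : c ∈ auxSymbols (blockCode L) N As) : c < 2 := by
  rw [auxSymbols] at h
  split_ifs at h
  · simp at h
  · obtain ⟨x, -, hx⟩ := List.mem_flatMap.1 h
    exact blockCode_lt_two hx

theorem blockCode_ne_nil {L : ℕ} (hL : 2 ≤ L) (x : Letter) : blockCode L x ≠ [] := by
  rw [← List.length_pos_iff, blockCode, length_bits]; omega

/-- The main chain begins with a letter, and both letters occur after its beginning. -/
theorem mainSymbols_eq_cons {L : ℕ} (hL : 2 ≤ L) (N : ℕ) (As : List (List (Fin n))) :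
    ∃ c r, c < 2 ∧ mainSymbols (blockCode L) 2 N As = c :: r ∧ ∀ d < 2, d ∈ r := by
  obtain ⟨x, r, -, hr⟩ := exists_wordTokens_cons As
  obtain ⟨c, l, hcl⟩ := List.exists_cons_of_ne_nil (blockCode_ne_nil hL x)
  refine ⟨c, l ++ (r ++ [some mu]).flatMap
    (tokenSymbols (blockCode L) (2 + (auxSymbols (blockCode L) N As).length - 1)),
    blockCode_lt_two (hcl ▸ List.mem_cons_self), ?_, fun d hd => ?_⟩
  · rw [mainSymbols, hr, List.flatMap_cons, tokenSymbols, hcl]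
    rfl
  · exact List.mem_append_right _ (List.mem_flatMap.2 ⟨some mu, by simp, mem_blockCode_mu hL hd⟩)

theorem slpItems_spec {r : ℕ} (hr : r < (slpItems G hn k).length) :
    ((slpItems G hn k)[r].1 < r → (slpItems G hn k)[r].2 < (slpItems G hn k).length) ∧
      (r ≤ (slpItems G hn k)[r].1 → (slpItems G hn k)[r].2 < 2) := by
  have hL := two_le_blockLength (Nat.one_le_pow k n hn)
  obtain ⟨c, l, hc, hcl, -⟩ := mainSymbols_eq_cons hL (n ^ k) (cliqueLists G hn k)
  refine chainItems_spec (fun x hx => lt_two_of_mem_auxSymbols hx) (fun x hx => ?_) ?_ hr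
  · obtain ⟨t, -, ht⟩ := List.mem_flatMap.1 hx
    cases t with
    | none => rw [List.mem_singleton.1 ht]; omega
    | some y => have := blockCode_lt_two ht; omega
  · rw [hcl]; simpa using hc

theorem slpItems_length_pos : 0 < (slpItems G hn k).length := by
  rw [slpItems, length_chainItems]; omega

theorem itemRhs_slpItems {i : ℕ} (h : i < (slpItems G hn k).length) :
    itemRhs id (slpItems G hn k) ⟨i, h⟩ =
      if h' : i ≤ (slpItems G hn k)[i].1 then .inl (slpItems G hn k)[i].2 else
        .inr (⟨i - 1, by omega⟩, ⟨(slpItems G hn k)[i].2,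
          (slpItems_spec G hn k h).1 (by omega)⟩) := by
  by_cases h' : i ≤ (slpItems G hn k)[i].1
  · rw [dif_pos h', itemRhs, dif_neg]
    · rfl
    · simp only [Fin.getElem_fin]; omega
  · rw [dif_neg h', itemRhs, dif_pos]
    · rfl
    · exact ⟨by simp only [Fin.getElem_fin]; omega, (slpItems_spec G hn k h).1 (by omega)⟩

theorem isSLP_slpItems (hk : 1 ≤ k) :
    IsSLP (grammarOf ⟨(slpItems G hn k).length - 1, by have := slpItems_length_pos G hn k; omega⟩
      (itemRhs id (slpItems G hn k)))
      ((graphWord (n ^ k) (cliqueLists G hn k)).flatMap (blockCode (blockLength (n ^ k)))) := by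
  have hL := two_le_blockLength (Nat.one_le_pow k n hn)
  have hpos := slpItems_length_pos G hn k
  obtain ⟨c, l, hc, hcl, hl⟩ := mainSymbols_eq_cons hL (n ^ k) (cliqueLists G hn k)
  have h := isSLP_graphWord hn hk id 2 (blockCode (blockLength (n ^ k))) (cliqueLists G hn k)
    (fun x _ => blockCode_ne_nil hL x) (fun x _ _ c hc => blockCode_lt_two hc)
    (fun c hc => .inr (by rw [hcl]; exact hl c hc)) (slpItems G hn k) rfl
    ⟨(slpItems G hn k).length - 1, by omega⟩ (by simp only; omega)
    (grammarOf ⟨(slpItems G hn k).length - 1, by omega⟩ (itemRhs id (slpItems G hn k))).rules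
    (mem_grammarOf_rules _ _)
  simp only [List.map_id] at h
  exact h

theorem ne_nil_of_mem_graphDict {ι : Finset (Fin n) → ℕ} (hι : IsCliqueNumbering G k ι)
    {d : List Letter} (hd : d ∈ graphDict G k ι) : d ≠ [] := by
  rcases mem_graphDict.1 hd with ⟨u, hu, rfl⟩ | ⟨x, -, rfl⟩ | ⟨x, -, rfl⟩ | rfl | rfl | rfl
  · rcases hu.eq_cons hι with ⟨B, -, rfl⟩ | ⟨B, -, u', rfl⟩ <;> simp [f₁]
  all_goals simp

/-- The instance for a graph. -/
def reducedInstance (hk : 1 ≤ k) : Instance where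
  numNT := (slpItems G hn k).length
  start := ⟨(slpItems G hn k).length - 1, by have := slpItems_length_pos G hn k; omega⟩
  rhs := itemRhs id (slpItems G hn k)
  text := (graphWord (n ^ k) (cliqueLists G hn k)).flatMap (blockCode (blockLength (n ^ k)))
  isSLP := isSLP_slpItems G hn k hk
  dict := (dictList G k).map fun d => d.flatMap (blockCode (blockLength (n ^ k)))
  nodup := by
    have hN := Nat.one_le_pow k n hn
    refine nodup_dictList.map_on fun d hd e he h => ?_
    rw [mem_dictList hn] at hd he
    have hι := isCliqueNumbering_cliqueNumber G hn k
    exact (isBlockCode_blockCode (add_six_le_two_pow_blockLength hN)).flatMap_injOn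
      (by have := two_le_blockLength hN; omega)
      (fun x hx => mem_alphabet_of_mem_graphDict hk hι hd hx)
      (fun x hx => mem_alphabet_of_mem_graphDict hk hι he hx) h
  dict_ne_nil := by simp [dictList, shortWords]
  word_ne_nil := by
    intro d hd
    obtain ⟨e, he, rfl⟩ := List.mem_map.1 hd
    rw [mem_dictList hn] at he
    obtain ⟨x, e', rfl⟩ := List.exists_cons_of_ne_nil
      (ne_nil_of_mem_graphDict G k (isCliqueNumbering_cliqueNumber G hn k) he)
    rw [List.flatMap_cons]
    simp [blockCode_ne_nil (two_le_blockLength (Nat.one_le_pow k n hn))]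

theorem items_output : items (output G hn k) = slpItems G hn k := by
  have h1 : ∀ l : List (ℕ × ℕ), items (l.map fun p => Event.sym p.1 p.2) = l := by
    intro l
    rw [items, List.filterMap_map]
    exact List.filterMap_some
  have h2 : ∀ L, items ((dictList G k).flatMap (wordEvents L)) = [] := by
    intro L
    simp [items, wordEvents, encodeEvents, List.filterMap_flatMap, List.filterMap_map]
  rw [output, items, List.filterMap_append, ← items, ← items, h1, h2, List.append_nil]

theorem lens_output : lens (output G hn k) =
    (dictList G k).map fun d => d.length * blockLength (n ^ k) := by
  have h1 : ∀ l : List (ℕ × ℕ), lens (l.map fun p => Event.sym p.1 p.2) = [] := by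
    intro l
    simp [lens]
  have h2 : ∀ l : List (List Letter), lens (l.flatMap (wordEvents (blockLength (n ^ k)))) =
      l.map fun d => d.length * blockLength (n ^ k) := by
    intro l
    induction l with
    | nil => rfl
    | cons d l ih =>
      rw [List.flatMap_cons, lens, List.filterMap_append, ← lens, ← lens, ih]
      simp [lens, wordEvents, encodeEvents]
  rw [output, lens, List.filterMap_append, ← lens, ← lens, h1, h2, List.nil_append]

theorem chars_output : chars (output G hn k) =
    ((dictList G k).map fun d => d.flatMap (blockCode (blockLength (n ^ k)))).flatten := by
  have h1 : ∀ l : List (ℕ × ℕ), chars (l.map fun p => Event.sym p.1 p.2) = [] := by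
    intro l
    simp [chars]
  have h3 : ∀ l : List ℕ, chars (l.map Event.chr) = l := by
    intro l
    rw [chars, List.filterMap_map]
    exact List.filterMap_some
  have h2 : ∀ l : List (List Letter), chars (l.flatMap (wordEvents (blockLength (n ^ k)))) =
      (l.map fun d => d.flatMap (blockCode (blockLength (n ^ k)))).flatten := by
    intro l
    induction l with
    | nil => rfl
    | cons d l ih =>
      rw [List.flatMap_cons, chars, List.filterMap_append, ← chars, ← chars, ih, List.map_cons,
        List.flatten_cons, wordEvents, encodeEvents, chars, List.filterMap_append, ← chars, h3]
      simp
  rw [output, chars, List.filterMap_append, ← chars, ← chars, h1, h2, List.nil_append]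

theorem length_flatMap_blockCode (L : ℕ) (w : List Letter) :
    (w.flatMap (blockCode L)).length = w.length * L := by
  simp [List.length_flatMap, blockCode, length_bits]

/-- At the end, the store holds the instance. -/
theorem toStore_reducedInstance (hk : 1 ≤ k) : (reducedInstance G hn k hk).toStore =
    layout (finalRegs (output G hn k)) (fun _ => 0) (fun _ => 0)
      (arrsOf (fun _ => 0) (output G hn k)) := by
  have hlens : (reducedInstance G hn k hk).dict.map List.length = lens (output G hn k) := by
    rw [lens_output, reducedInstance, List.map_map]
    exact List.map_congr_left fun d _ => length_flatMap_blockCode _ d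
  refine Store.ext (funext fun x => ?_) (funext fun a => funext fun i => ?_)
  · match x with
    | 0 => simp [Instance.toStore, layout, finalRegs, items_output, reducedInstance]
    | 1 => simp [Instance.toStore, layout, finalRegs, items_output, reducedInstance]
    | 2 =>
      simp only [Instance.toStore, layout, finalRegs, ← hlens, List.length_map]
      rfl
    | x + 3 =>
      simp only [Instance.toStore, layout]
      split_ifs
      · simp [finalRegs]
      · rfl
      · rfl
  · match a with
    | 0 =>
      simp only [layout, arrsOf, items_output]
      by_cases h : i < (slpItems G hn k).length
      · refine (toStore_arr_zero (reducedInstance G hn k hk) h).trans ?_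
        change (itemRhs id (slpItems G hn k) ⟨i, h⟩).elim _ _ = _
        rw [itemRhs_slpItems G hn k h, List.getElem?_eq_getElem h]
        simp only [Option.elim]
        split_ifs <;> rfl
      · rw [List.getElem?_eq_none (by omega)]
        exact dif_neg h
    | 1 =>
      simp only [layout, arrsOf, items_output]
      by_cases h : i < (slpItems G hn k).length
      · refine (toStore_arr_one (reducedInstance G hn k hk) h).trans ?_
        change (itemRhs id (slpItems G hn k) ⟨i, h⟩).elim _ _ = _
        rw [itemRhs_slpItems G hn k h, List.getElem?_eq_getElem h]
        simp only [Option.elim]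
        split_ifs <;> rfl
      · rw [List.getElem?_eq_none (by omega)]
        exact dif_neg h
    | 2 =>
      simp only [layout, arrsOf, items_output]
      by_cases h : i < (slpItems G hn k).length
      · refine (toStore_arr_two (reducedInstance G hn k hk) h).trans ?_
        change (itemRhs id (slpItems G hn k) ⟨i, h⟩).elim _ _ = _
        rw [itemRhs_slpItems G hn k h, List.getElem?_eq_getElem h]
        simp only [Option.elim]
        split_ifs <;> rfl
      · rw [List.getElem?_eq_none (by omega)]
        exact dif_neg h
    | 3 =>
      simp only [Instance.toStore, layout, arrsOf, hlens]
    | 4 =>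
      simp only [Instance.toStore, layout, arrsOf, chars_output]
      rfl
    | 5 => simp [Instance.toStore, layout, arrsOf]
    | a + 6 => simp [Instance.toStore, layout, arrsOf]

theorem overAlphabet_reducedInstance (hk : 1 ≤ k) :
    (reducedInstance G hn k hk).OverAlphabet 2 := by
  constructor
  · rintro ⟨i, hi⟩ a h
    change itemRhs id (slpItems G hn k) ⟨i, hi⟩ = _ at h
    rw [itemRhs_slpItems G hn k hi] at h
    split_ifs at h with h'
    cases h
    exact (slpItems_spec G hn k hi).2 h'
  · intro d hd a ha
    obtain ⟨e, -, rfl⟩ := List.mem_map.1 hd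
    obtain ⟨x, -, hx⟩ := List.mem_flatMap.1 ha
    exact blockCode_lt_two hx

theorem slpSize_reducedInstance_le (hk : 1 ≤ k) : (reducedInstance G hn k hk).slpSize ≤
    (60 + 80 * k) * ((n ^ k) ^ 2 * blockLength (n ^ k)) := by
  have hN := Nat.one_le_pow k n hn
  have hL := two_le_blockLength hN
  have h1 : (reducedInstance G hn k hk).slpSize ≤ 2 * (slpItems G hn k).length :=
    grammarSize_le (reducedInstance G hn k hk).start
      (grammarOf (reducedInstance G hn k hk).start (reducedInstance G hn k hk).rhs).rules
      (reducedInstance G hn k hk).rhs (mem_grammarOf_rules _ _)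
  have h2 := length_chainItems_graphWord_le hn hk (isCliqueList_cliqueLists G hn k)
    (code := blockCode (blockLength (n ^ k))) (L := blockLength (n ^ k)) (by omega)
    (fun x _ => (length_bits _ _).le) 2
  change (slpItems G hn k).length ≤ _ at h2
  have h3 : 1 ≤ (n ^ k) ^ 2 * blockLength (n ^ k) :=
    Nat.mul_pos (Nat.pow_pos hN) (by omega)
  nlinarith

/-- The running time is polynomial in `n`, and hence so are the counters of the output. -/
theorem cube_mul_blockLength_le {n : ℕ} (hn : 0 < n) (k : ℕ) :
    (n ^ k) ^ 3 * blockLength (n ^ k) ≤ (n + 2) ^ (3 * k + (k + 3)) := by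
  have hN := Nat.one_le_pow k n hn
  rw [pow_add]
  refine Nat.mul_le_mul ?_ ?_
  · rw [← pow_mul, mul_comm]
    exact Nat.pow_le_pow_left (by omega) _
  · rw [blockLength_eq hN, pow_add]
    have h1 := Nat.log_lt_self 2 (show n ^ k ≠ 0 by omega)
    have h2 : n ^ k ≤ (n + 2) ^ k := Nat.pow_le_pow_left (by omega) k
    have h3 : 2 ^ 3 ≤ (n + 2) ^ 3 := Nat.pow_le_pow_left (by omega) 3
    have h4 := Nat.mul_le_mul_left ((n + 2) ^ k) h3
    omega

/-- The program of the reduction turns a graph into its instance, within the bounds on time and on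
the size of words. -/
theorem runs_reduction (hk : 1 ≤ k) : ∃ C b : ℕ, ∀ (n : ℕ) (hn : 0 < n) (G : SimpleGraph (Fin n)),
    Runs ((n + 2) ^ b) (reduction k) (graphStore G)
      (C * ((n ^ k) ^ 3 * (Nat.log 2 (n ^ k) + 1))) (reducedInstance G hn k hk).toStore := by
  obtain ⟨C, hC⟩ := Cmd.exists_time_main k hk
  obtain ⟨D, hD⟩ := Cmd.exists_sound (Cmd.main k) 1 (Cmd.tame_main k) 1
  refine ⟨5 * C + 30, D + C + 4 * k + 5, fun n hn G => ?_⟩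
  have hN := Nat.one_le_pow k n hn
  have ht := hC n G (inputEnv n) hn (inputEnv_zero n)
  have hlen := Cmd.length_out_le (adjFun G) (Cmd.main k) (inputEnv n)
  rw [Cmd.out_main G hn k (inputEnv_zero n)] at hlen
  have hle : ∀ b, b ≤ D + C + 4 * k + 5 → (n + 2) ^ b ≤ (n + 2) ^ (D + C + 4 * k + 5) := fun b hb =>
    Nat.pow_le_pow_right (by omega) hb
  have hn1 : n + 2 ≤ (n + 2) ^ (D + C + 4 * k + 5) := by
    simpa using hle 1 (by omega)
  have hn2 : n * n ≤ (n + 2) ^ (D + C + 4 * k + 5) :=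
    le_trans (by nlinarith) (hle 2 (by omega))
  have hout : (output G hn k).length ≤ (n + 2) ^ (D + C + 4 * k + 5) := by
    -- The constant `C` is less than `2 ^ C`.
    refine (hlen.trans ht).trans (le_trans ?_ (hle (C + (3 * k + (k + 3))) (by omega)))
    rw [pow_add]
    exact Nat.mul_le_mul ((Nat.lt_two_pow_self (n := C)).le.trans
      (Nat.pow_le_pow_left (by omega) C)) (cube_mul_blockLength_le hn k)
  have hmain := hD (n + 2) (by omega) _ (hle D (by omega)) (adjFun G) (inputEnv n) []
    (adjFun_le_one G) (fun x => ?_) (fun y hy => Function.update_of_ne (by omega) _ _) (by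
      rw [Cmd.out_main G hn k (inputEnv_zero n)]
      exact hout)
  · rw [List.nil_append, Cmd.out_main G hn k (inputEnv_zero n)] at hmain
    have hfin := runs_epilogue (fun i hi => adjFun_of_ge G hi) (output G hn k) hn2 hout
    rw [toStore_reducedInstance]
    refine (runs_prologue G (by omega) (by omega) hn2).seq (hmain.seq hfin le_rfl) ?_
    have h5 : blockLength (n ^ k) ≤ 5 * (Nat.log 2 (n ^ k) + 1) := by
      rw [blockLength_eq hN]; omega
    have h6 := Nat.mul_le_mul_left (C * (n ^ k) ^ 3) h5
    have h7 : n * n ≤ (n ^ k) ^ 3 * (Nat.log 2 (n ^ k) + 1) := by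
      have h8 : n ≤ n ^ k := Nat.le_self_pow (by omega) n
      calc n * n ≤ n ^ k * n ^ k := Nat.mul_le_mul h8 h8
        _ = (n ^ k) ^ 2 := (pow_two _).symm
        _ ≤ (n ^ k) ^ 3 := Nat.pow_le_pow_right hN (by norm_num)
        _ ≤ _ := Nat.le_mul_of_pos_right _ (by omega)
    have h9 : 1 ≤ n * n := Nat.mul_pos hn hn
    generalize n * n = q at *
    generalize (Cmd.main k).time _ _ = t at *
    calc _ ≤ 30 * q + t := by omega
      _ ≤ 30 * ((n ^ k) ^ 3 * (Nat.log 2 (n ^ k) + 1)) +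
          C * (n ^ k) ^ 3 * (5 * (Nat.log 2 (n ^ k) + 1)) := by
        refine Nat.add_le_add (Nat.mul_le_mul_left _ h7) (ht.trans ?_)
        rw [← mul_assoc]
        exact h6
      _ = _ := by ring
  · rw [pow_one, inputEnv, Function.update_apply]
    split_ifs <;> omega

end Reduced

/-! ### The lower bound -/

section Reduced

variable {n : ℕ} (G : SimpleGraph (Fin n)) (hn : 0 < n) (k : ℕ)

theorem factorizable_iff {ι : Finset (Fin n) → ℕ} {As : List (List (Fin n))} {k : ℕ} (hk : 1 ≤ k)
    {G : SimpleGraph (Fin n)} (hι : IsCliqueNumbering G k ι) (hAs : IsCliqueList G k As) :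
    Factorizable (graphDict G k ι : Set (List Letter)) (graphWord (n ^ k) As) ↔
      HasClique G (4 * k) :=
  ⟨hasClique_of_factorizable hk hι hAs, factorizable_of_hasClique hk hι hAs⟩

theorem toFinset_dict_reducedInstance (hk : 1 ≤ k) : (reducedInstance G hn k hk).dict.toFinset =
    (graphDict G k (cliqueNumber G hn k)).image
      fun d => d.flatMap (blockCode (blockLength (n ^ k))) := by
  ext d
  simp only [reducedInstance, List.mem_toFinset, List.mem_map, Finset.mem_image, mem_dictList hn]

theorem answer_reducedInstance (hk : 1 ≤ k) :
    (reducedInstance G hn k hk).Answer ↔ HasClique G (4 * k) := by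
  have hN := Nat.one_le_pow k n hn
  have hL := two_le_blockLength hN
  have hι := isCliqueNumbering_cliqueNumber G hn k
  have hAs := isCliqueList_cliqueLists G hn k
  rw [← factorizable_iff hk hι hAs,
    ← (isBlockCode_blockCode (add_six_le_two_pow_blockLength hN)).factorizable_iff (by omega)
      (fun d hd x hx => mem_alphabet_of_mem_graphDict hk hι hd hx)
      (fun x hx => mem_alphabet_of_mem_graphWord hk hx)]
  have h : {d | d ∈ (reducedInstance G hn k hk).dict} =
      (fun d => d.flatMap (blockCode (blockLength (n ^ k)))) ''
        (graphDict G k (cliqueNumber G hn k) : Set (List Letter)) := by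
    rw [← Finset.coe_image, ← toFinset_dict_reducedInstance, List.coe_toFinset]
  rw [Instance.Answer, h]
  rfl

theorem length_le_of_mem_dict (hk : 1 ≤ k) {d : List ℕ}
    (hd : d ∈ (reducedInstance G hn k hk).dict) :
    d.length ≤ 15 * (n ^ k * blockLength (n ^ k)) := by
  obtain ⟨e, he, rfl⟩ := List.mem_map.1 hd
  rw [mem_dictList hn] at he
  rw [length_flatMap_blockCode, ← mul_assoc]
  exact Nat.mul_le_mul_right _
    (length_le_of_mem_graphDict hn (isCliqueNumbering_cliqueNumber G hn k) he)

theorem maxLength_reducedInstance_le (hk : 1 ≤ k) :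
    (reducedInstance G hn k hk).maxLength ≤ 15 * (n ^ k * blockLength (n ^ k)) := by
  have h : ∀ l : List (List ℕ), (∀ d ∈ l, d.length ≤ 15 * (n ^ k * blockLength (n ^ k))) →
      (l.map List.length).foldr max 0 ≤ 15 * (n ^ k * blockLength (n ^ k)) := by
    intro l
    induction l with
    | nil => simp
    | cons d l ih => exact fun hl => max_le (hl d (by simp)) (ih fun e he => hl e (by simp [he]))
  exact h _ fun d hd => length_le_of_mem_dict G hn k hk hd

theorem one_le_maxLength (I : Instance) : 1 ≤ I.maxLength := by
  obtain ⟨d, l, hd⟩ := List.exists_cons_of_ne_nil I.dict_ne_nil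
  rw [Instance.maxLength, hd, List.map_cons, List.foldr_cons]
  exact le_max_of_le_left (List.length_pos_iff.2 (I.word_ne_nil d (by simp [hd])))

theorem totalLength_reducedInstance_le (hk : 1 ≤ k) :
    (reducedInstance G hn k hk).totalLength ≤ 255 * ((n ^ k) ^ 3 * blockLength (n ^ k)) := by
  have hcard : (dictList G k).length ≤ 17 * (n ^ k) ^ 2 := by
    rw [← List.toFinset_card_of_nodup nodup_dictList]
    refine le_of_eq_of_le (congrArg Finset.card ?_)
      (card_graphDict_le G hn hk (cliqueNumber G hn k))
    ext w
    rw [List.mem_toFinset, mem_dictList hn]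
  have h : (reducedInstance G hn k hk).totalLength ≤
      (dictList G k).length * (15 * (n ^ k * blockLength (n ^ k))) := by
    rw [Instance.totalLength]
    refine (List.sum_le_card_nsmul _ (15 * (n ^ k * blockLength (n ^ k))) fun x hx => ?_).trans
      (le_of_eq ?_)
    · obtain ⟨d, hd, rfl⟩ := List.mem_map.1 hx
      exact length_le_of_mem_dict G hn k hk hd
    · simp [reducedInstance]
  refine h.trans ((Nat.mul_le_mul_right _ hcard).trans (le_of_eq (by ring)))

end Reduced

theorem computesReduction_reduction {k : ℕ} (hk : 1 ≤ k) : ComputesReduction k (reduction k) := by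
  obtain ⟨C, b, h⟩ := runs_reduction k hk
  refine ⟨C + 5, b, fun n hn G => ?_⟩
  obtain ⟨t, ht, hexec⟩ := h n hn G
  have hN := Nat.one_le_pow k n hn
  refine ⟨cliqueNumber G hn k, cliqueLists G hn k, blockLength (n ^ k), blockCode _,
    reducedInstance G hn k hk, t, isCliqueNumbering_cliqueNumber G hn k,
    isCliqueList_cliqueLists G hn k, ?_, isBlockCode_blockCode (add_six_le_two_pow_blockLength hN),
    overAlphabet_reducedInstance G hn k hk, rfl, toFinset_dict_reducedInstance G hn k hk, hexec,
    ht.trans (Nat.mul_le_mul_right _ (by omega))⟩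
  rw [blockLength_eq hN]
  nlinarith

theorem Instance.OverAlphabet.mono {I : Instance} {σ τ : ℕ} (h : I.OverAlphabet σ) (hστ : σ ≤ τ) :
    I.OverAlphabet τ :=
  ⟨fun v a hv => (h.1 v a hv).trans_le hστ, fun d hd a ha => (h.2 d hd a ha).trans_le hστ⟩

/-- Logarithms are dominated by powers. -/
theorem exists_blockLength_le {δ : ℝ} (hδ : 0 < δ) : ∃ c : ℝ, 1 ≤ c ∧ ∀ N : ℕ, 1 ≤ N →
    (blockLength N : ℝ) ≤ c * (N : ℝ) ^ δ := by
  have hlog : 0 < Real.log 2 := Real.log_pos (by norm_num)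
  have hpos : 0 < 1 / (δ * Real.log 2) := by positivity
  refine ⟨4 + 1 / (δ * Real.log 2), by linarith, fun N hN => ?_⟩
  have hN' : (1 : ℝ) ≤ N := by exact_mod_cast hN
  have h1 : (Nat.log 2 N : ℝ) ≤ Real.logb 2 N := Real.natLog_le_logb N 2
  have h2 : Real.logb 2 N ≤ 1 / (δ * Real.log 2) * (N : ℝ) ^ δ := by
    rw [Real.logb, div_le_iff₀ hlog]
    refine (Real.log_le_rpow_div (by linarith) hδ).trans (le_of_eq ?_)
    field_simp
  have h3 : (1 : ℝ) ≤ (N : ℝ) ^ δ := Real.one_le_rpow hN' hδ.le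
  rw [blockLength_eq hN]
  push_cast
  nlinarith

/-- The time of an algorithm for Word Break on the instance of a graph. -/
theorem exists_time_bound {k : ℕ} (hk : 1 ≤ k) {ε : ℝ} (hε : 0 < ε) : ∃ (K : ℕ) (ε' : ℝ), 0 < ε' ∧
    ∀ (n : ℕ) (hn : 0 < n) (G : SimpleGraph (Fin n)),
      ((n ^ k : ℕ) : ℝ) ^ 3 * blockLength (n ^ k) ≤ K * (n : ℝ) ^ (4 * k - ε') ∧
      ((reducedInstance G hn k hk).slpSize : ℝ) *
        ((reducedInstance G hn k hk).maxLength : ℝ) ^ (2 - ε) +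
        (reducedInstance G hn k hk).totalLength ≤ K * (n : ℝ) ^ (4 * k - ε') := by
  -- A saving of at most one keeps `2 - ε₀` positive, and `N ^ 3` below `N ^ (4 - ε₀)`.
  set ε₀ := min ε 1 with hε₀
  have hε₀_pos : 0 < ε₀ := lt_min hε one_pos
  have hε₀_le : ε₀ ≤ 1 := min_le_right _ _
  obtain ⟨c, hc1, hc⟩ := exists_blockLength_le (δ := ε₀ / 6) (by positivity)
  have hk' : (0 : ℝ) < k := by exact_mod_cast hk
  set K : ℝ := ((60 + 80 * k) * 15 ^ 2 + 255) * c ^ 3 with hK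
  refine ⟨⌈K⌉₊, k * (ε₀ / 2), by positivity, fun n hn G => ?_⟩
  have hN := Nat.one_le_pow k n hn
  have hpow : (n : ℝ) ^ (4 * k - k * (ε₀ / 2) : ℝ) = ((n ^ k : ℕ) : ℝ) ^ (4 - ε₀ / 2) := by
    rw [Nat.cast_pow, ← Real.rpow_natCast, ← Real.rpow_mul (by positivity)]
    congr 1; ring
  have hslp := slpSize_reducedInstance_le G hn k hk
  have hmax := maxLength_reducedInstance_le G hn k hk
  have hmax1 := one_le_maxLength (reducedInstance G hn k hk)
  have htot := totalLength_reducedInstance_le G hn k hk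
  have hL := hc (n ^ k) hN
  have hL1 : 1 ≤ blockLength (n ^ k) := by rw [blockLength_eq hN]; omega
  rw [hpow]
  generalize (reducedInstance G hn k hk).slpSize = s at *
  generalize (reducedInstance G hn k hk).maxLength = m at *
  generalize (reducedInstance G hn k hk).totalLength = M at *
  generalize blockLength (n ^ k) = L at *
  generalize n ^ k = N at *
  have hN' : (1 : ℝ) ≤ N := by exact_mod_cast hN
  have hL1' : (1 : ℝ) ≤ L := by exact_mod_cast hL1
  have hm1 : (1 : ℝ) ≤ m := by exact_mod_cast hmax1
  have hs' : (s : ℝ) ≤ (60 + 80 * k) * ((N : ℝ) ^ 2 * L) := by exact_mod_cast hslp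
  have hm' : (m : ℝ) ≤ 15 * ((N : ℝ) * L) := by exact_mod_cast hmax
  have hM' : (M : ℝ) ≤ 255 * ((N : ℝ) ^ 3 * L) := by exact_mod_cast htot
  have hN0 : (0 : ℝ) < N := by linarith
  -- Three logarithmic factors are absorbed by half of the saving.
  have hL3 : (L : ℝ) ^ 3 ≤ c ^ 3 * (N : ℝ) ^ (ε₀ / 2) := by
    refine (pow_le_pow_left₀ (by linarith) hL 3).trans (le_of_eq ?_)
    rw [mul_pow, ← Real.rpow_natCast ((N : ℝ) ^ (ε₀ / 6)), ← Real.rpow_mul hN0.le]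
    congr 2; push_cast; ring
  have hX : (N : ℝ) ^ (4 - ε₀) * (L : ℝ) ^ 3 ≤ c ^ 3 * (N : ℝ) ^ (4 - ε₀ / 2) := by
    have h : (N : ℝ) ^ (4 - ε₀) * (N : ℝ) ^ (ε₀ / 2) = (N : ℝ) ^ (4 - ε₀ / 2) := by
      rw [← Real.rpow_add hN0]; congr 1; ring
    calc _ ≤ (N : ℝ) ^ (4 - ε₀) * (c ^ 3 * (N : ℝ) ^ (ε₀ / 2)) :=
          mul_le_mul_of_nonneg_left hL3 (by positivity)
      _ = c ^ 3 * ((N : ℝ) ^ (4 - ε₀) * (N : ℝ) ^ (ε₀ / 2)) := by ring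
      _ = _ := by rw [h]
  have hcube : (N : ℝ) ^ 3 * L ≤ (N : ℝ) ^ (4 - ε₀) * (L : ℝ) ^ 3 := by
    refine mul_le_mul ?_ (le_self_pow₀ hL1' (by norm_num)) (by linarith) (by positivity)
    rw [← Real.rpow_natCast]
    exact Real.rpow_le_rpow_of_exponent_le hN' (by push_cast; linarith)
  have hmpow : (m : ℝ) ^ (2 - ε) ≤ 15 ^ 2 * ((N : ℝ) ^ (2 - ε₀) * (L : ℝ) ^ 2) := by
    calc (m : ℝ) ^ (2 - ε) ≤ (m : ℝ) ^ (2 - ε₀) :=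
          Real.rpow_le_rpow_of_exponent_le hm1 (by have := min_le_left ε 1; linarith)
      _ ≤ (15 * ((N : ℝ) * L)) ^ (2 - ε₀) := Real.rpow_le_rpow (by linarith) hm' (by linarith)
      _ = 15 ^ (2 - ε₀) * ((N : ℝ) ^ (2 - ε₀) * (L : ℝ) ^ (2 - ε₀)) := by
        rw [Real.mul_rpow (by norm_num) (by positivity), Real.mul_rpow hN0.le (by linarith)]
      _ ≤ _ := by
        have h2 : ∀ x : ℝ, 1 ≤ x → x ^ (2 - ε₀) ≤ x ^ 2 := fun x hx => by
          rw [← Real.rpow_natCast]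
          exact Real.rpow_le_rpow_of_exponent_le hx (by push_cast; linarith)
        gcongr
        · exact h2 15 (by norm_num)
        · exact h2 L hL1'
  have hprod : (s : ℝ) * (m : ℝ) ^ (2 - ε) ≤
      (60 + 80 * k) * 15 ^ 2 * ((N : ℝ) ^ (4 - ε₀) * (L : ℝ) ^ 3) := by
    have h : (N : ℝ) ^ (4 - ε₀) = (N : ℝ) ^ 2 * (N : ℝ) ^ (2 - ε₀) := by
      rw [← Real.rpow_natCast, ← Real.rpow_add hN0]; congr 1; push_cast; ring
    calc _ ≤ ((60 + 80 * k) * ((N : ℝ) ^ 2 * L)) *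
          (15 ^ 2 * ((N : ℝ) ^ (2 - ε₀) * (L : ℝ) ^ 2)) :=
          mul_le_mul hs' hmpow (by positivity) (by positivity)
      _ = _ := by rw [h]; ring
  have hK0 : 0 ≤ (N : ℝ) ^ (4 - ε₀ / 2) := by positivity
  have hKle := mul_le_mul_of_nonneg_right (Nat.le_ceil K) hK0
  constructor
  · refine le_trans ?_ hKle
    refine (hcube.trans hX).trans (mul_le_mul_of_nonneg_right ?_ hK0)
    rw [hK]
    exact le_mul_of_one_le_left (by positivity) (by nlinarith)
  · refine le_trans ?_ hKle
    calc _ ≤ (60 + 80 * k) * 15 ^ 2 * ((N : ℝ) ^ (4 - ε₀) * (L : ℝ) ^ 3) +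
          255 * ((N : ℝ) ^ (4 - ε₀) * (L : ℝ) ^ 3) := add_le_add hprod
            (hM'.trans (mul_le_mul_of_nonneg_left hcube (by norm_num)))
      _ = ((60 + 80 * k) * 15 ^ 2 + 255) * ((N : ℝ) ^ (4 - ε₀) * (L : ℝ) ^ 3) := by ring
      _ ≤ ((60 + 80 * k) * 15 ^ 2 + 255) * (c ^ 3 * (N : ℝ) ^ (4 - ε₀ / 2)) :=
          mul_le_mul_of_nonneg_left hX (by positivity)
      _ = _ := by rw [hK]; ring

/-- A fast algorithm for Word Break yields a fast algorithm for detecting cliques. -/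
theorem exists_solvesClique {k : ℕ} (hk : 1 ≤ k) {σ : ℕ} (hσ : 2 ≤ σ) {A : Prog} {ε : ℝ}
    (hε : 0 < ε) (hA : SolvesWordBreak σ A ε) :
    ∃ ε' : ℝ, 0 < ε' ∧ SolvesClique (.seq (reduction k) A) (4 * k) (4 * k - ε') := by
  obtain ⟨C, b, hR⟩ := runs_reduction k hk
  obtain ⟨C', b', hA⟩ := hA
  obtain ⟨K, ε', hε', hK⟩ := exists_time_bound hk hε
  refine ⟨ε', hε', C * K + C' * K, b + (60 + 80 * k + 255 + (3 * k + (k + 3))) * b',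
    fun n hn G => ?_⟩
  have hN := Nat.one_le_pow k n hn
  obtain ⟨t, ht, hexec⟩ := hR n hn G
  obtain ⟨t', s', hexec', hans, ht'⟩ := hA (reducedInstance G hn k hk)
    ((overAlphabet_reducedInstance G hn k hk).mono hσ)
  obtain ⟨hK₁, hK₂⟩ := hK n hn G
  refine ⟨t + t', s', .seq (hexec.mono ?_) (hexec'.mono ?_), ?_, ?_⟩
  · exact Nat.pow_le_pow_right (by omega) (by omega)
  · refine le_trans ?_ (Nat.pow_le_pow_right (by omega) (Nat.le_add_left _ b))
    rw [pow_mul]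
    refine Nat.pow_le_pow_left ?_ b'
    have h1 : (reducedInstance G hn k hk).slpSize + (reducedInstance G hn k hk).totalLength ≤
        (60 + 80 * k + 255) * ((n ^ k) ^ 3 * blockLength (n ^ k)) := by
      have h2 := slpSize_reducedInstance_le G hn k hk
      have h3 := totalLength_reducedInstance_le G hn k hk
      have h4 : (n ^ k) ^ 2 * blockLength (n ^ k) ≤ (n ^ k) ^ 3 * blockLength (n ^ k) :=
        Nat.mul_le_mul_right _ (Nat.pow_le_pow_right hN (by norm_num))
      have h5 := Nat.mul_le_mul_left (60 + 80 * k) h4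
      rw [add_mul _ 255]
      omega
    refine h1.trans ((Nat.mul_le_mul ?_ (cube_mul_blockLength_le hn k)).trans (pow_add _ _ _).ge)
    exact (Nat.lt_two_pow_self).le.trans (Nat.pow_le_pow_left (by omega) _)
  · rw [hans]
    exact if_congr (answer_reducedInstance G hn k hk) rfl rfl
  · have h1 : (t : ℝ) ≤ C * (((n ^ k : ℕ) : ℝ) ^ 3 * blockLength (n ^ k)) := by
      have : Nat.log 2 (n ^ k) + 1 ≤ blockLength (n ^ k) := by rw [blockLength_eq hN]; omega
      exact_mod_cast ht.trans (Nat.mul_le_mul_left _ (Nat.mul_le_mul_left _ this))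
    have h2 := mul_le_mul_of_nonneg_left hK₁ (Nat.cast_nonneg (α := ℝ) C)
    have h3 := mul_le_mul_of_nonneg_left hK₂ (Nat.cast_nonneg (α := ℝ) C')
    push_cast
    linarith

end

end WordBreak

theorem mainTheorem3 (k : ℕ) (hk : 1 ≤ k) :
    (∃ C : ℕ, ∀ n : ℕ, 1 ≤ n → ∀ (G : SimpleGraph (Fin n)) (ι : Finset (Fin n) → ℕ)
        (As : List (List (Fin n))),
        WordBreak.IsCliqueNumbering G k ι → WordBreak.IsCliqueList G k As →
        (WordBreak.Factorizable (WordBreak.graphDict G k ι : Set (List WordBreak.Letter))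
            (WordBreak.graphWord (n ^ k) As) ↔ WordBreak.HasClique G (4 * k)) ∧
        (∃ g : ContextFreeGrammar WordBreak.Letter,
          WordBreak.IsSLP g (WordBreak.graphWord (n ^ k) As) ∧
          WordBreak.grammarSize g ≤ C * (n ^ k) ^ 2) ∧
        ∑ d ∈ WordBreak.graphDict G k ι, d.length ≤ C * (n ^ k) ^ 3 ∧
        ∀ d ∈ WordBreak.graphDict G k ι, d.length ≤ C * n ^ k) ∧
    ∃ R : WordBreak.Prog, WordBreak.ComputesReduction k R ∧
      ∀ 𝒞 : Set WordBreak.Prog, (∀ A ∈ 𝒞, WordBreak.Prog.seq R A ∈ 𝒞) →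
        WordBreak.CliqueConjecture 𝒞 k →
        ∀ σ : ℕ, 2 ≤ σ →
          ¬ ∃ A ∈ 𝒞, ∃ ε : ℝ, 0 < ε ∧ WordBreak.SolvesWordBreak σ A ε := by
  refine ⟨⟨255 + 80 * k, fun n hn G ι As hι hAs =>
      ⟨WordBreak.factorizable_iff hk hι hAs, ?_, ?_, ?_⟩⟩,
    WordBreak.reduction k, WordBreak.computesReduction_reduction hk,
    fun 𝒞 h𝒞 hconj σ hσ ⟨A, hA, ε, hε, hsolve⟩ => ?_⟩
  · obtain ⟨g, hg, hsize⟩ := WordBreak.exists_slp_graphWord hn hk hAs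
    exact ⟨g, hg, hsize.trans (Nat.mul_le_mul_right _ (by omega))⟩
  · refine (Finset.sum_le_card_nsmul _ _ _ fun d hd =>
      WordBreak.length_le_of_mem_graphDict hn hι hd).trans ?_
    rw [smul_eq_mul]
    calc _ ≤ 17 * (n ^ k) ^ 2 * (15 * n ^ k) :=
          Nat.mul_le_mul_right _ (WordBreak.card_graphDict_le G hn hk ι)
      _ = 255 * (n ^ k) ^ 3 := by ring
      _ ≤ _ := Nat.mul_le_mul_right _ (by omega)
  · intro d hd
    exact (WordBreak.length_le_of_mem_graphDict hn hι hd).trans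
      (Nat.mul_le_mul_right _ (by omega))
  · obtain ⟨ε', hε', h⟩ := WordBreak.exists_solvesClique hk hσ hε hsolve
    exact hconj ⟨_, h𝒞 A hA, ε', hε', h⟩
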